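/- Let $R$ be an Iwanaga–Gorenstein ring, i.e. a left and right Noetherian ring with $\operatorname{idim}{}_RR<\infty$ and $\operatorname{idim}R_R<\infty$. Modules are right modules, and $\mathsf{proj}\,R$ is the category of finitely generated projective modules. Let $\mathsf{CM}\,R$ be the category of finitely presented modules $X$ with $\operatorname{Ext}^i_R(X,R)=0$ for all $i>0$. Let $\mathsf{Mor}^{\mathrm e}(\mathsf{CM}\,R)$ be the category whose objects are the surjections $\alpha\colon X_\alpha\to T_\alpha$ with $X_\alpha,T_\alpha\in\mathsf{CM}\,R$ and whose morphisms are the commutative squares. A sequence $\alpha\to\beta\to\gamma$ in it is called exact if $0\to X_\alpha\to X_\beta\to X_\gamma\to0$ and $0\to T_\alpha\to T_\beta\to T_\gamma\to 0$ are exact. With these exact sequences $\mathsf{Mor}^{\mathrm e}(\mathsf{CM}\,R)$ has enough projectives and enough injectives, and these coincide (it is a Frobenius category). Let $\underline{\mathsf{Mor}}^{\mathrm e}(\mathsf{CM}\,R)$ be its stable category, in which morphisms are taken modulo those factoring through projective-injective objects. Its suspension $\Sigma$ is given by a choice of exact sequences $0\to\alpha\to q_\alpha\to\Sigma\alpha\to0$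 with $q_\alpha$ projective-injective. Its distinguished triangles are those isomorphic to $\alpha\xrightarrow{f}\beta\xrightarrow{g}\gamma\xrightarrow{h}\Sigma\alpha$ where $0\to\beta\xrightarrow{g}\gamma\xrightarrow{h}\Sigma\alpha\to0$ is exact and there is $w\colon q_\alpha\to\gamma$ such that $f$, $w$ and $1_{\Sigma\alpha}$ form a morphism to this sequence from the chosen one. Let $\mathsf K^{\infty,\mathrm b}(\mathsf{proj}\,R)$ be the homotopy category of complexes over $\mathsf{proj}\,R$ with bounded cohomology, $\mathsf K^{\mathrm b}(\mathsf{proj}\,R)$ its triangulated subcategory of bounded complexes, and $(\mathsf K^{\infty,\mathrm b}/\mathsf K^{\mathrm b})(\mathsf{proj}\,R)$ the Verdier quotient, with quotient functor $Q$. Every $\alpha\in\mathsf{Mor}^{\mathrm e}(\mathsf{CM}\,R)$ admits a complex $F_\alpha$ over $\mathsf{proj}\,R$ with maps $\rho_\alpha\colon F^0_\alpha\to X_\alpha$ and $\epsilon_\alpha\colon T_\alpha\to F^1_\alpha$ such that $\cdots\to F_\alpha^{-1}\to F_\alpha^0\xrightarrow{\rho_\alpha}X_\alpha\to0$ and $0\to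 T_\alpha\xrightarrow{\epsilon_\alpha}F_\alpha^1\to F_\alpha^2\to\cdots$ are exact and $d^0=\epsilon_\alpha\alpha\rho_\alpha$. For any choice of such complexes, every morphism $f=(f_X,f_T)\colon\alpha\to\beta$ lifts to a chain map $\varphi\colon F_\alpha\to F_\beta$ with $\rho_\beta\varphi^0=f_X\rho_\alpha$ and $\varphi^1\epsilon_\alpha=\epsilon_\beta f_T$. Sending $\alpha$ to $F_\alpha$ and $f$ to the homotopy class of any such lift is a functor $F\colon\mathsf{Mor}^{\mathrm e}(\mathsf{CM}\,R)\to\mathsf K^{\infty,\mathrm b}(\mathsf{proj}\,R)$. The composite $Q\circ F$ induces a functor $$\underline F\colon\underline{\mathsf{Mor}}^{\mathrm e}(\mathsf{CM}\,R)\longrightarrow(\mathsf K^{\infty,\mathrm b}/\mathsf K^{\mathrm b})(\mathsf{proj}\,R),$$ which is a triangle equivalence: it is an equivalence of categories and there is a natural isomorphism $\underline F\Sigma\cong\Sigma\underline F$ (for every choice of $\Sigma$ as above) under which a triangle is distinguished if and only if its image under $\underline F$ is distinguished. -/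

import Mathlib

open CategoryTheory CategoryTheory.Limits CategoryTheory.Pretriangulated
open scoped ZeroObject

universe u

noncomputable section

namespace IwanagaGorenstein

/-- Right `R`-modules. -/
abbrev RMod (R : Type u) [Ring R] := ModuleCat.{u} Rᵐᵒᵖ

/-- `R` as a right module over itself. -/
abbrev rightRegular (R : Type u) [Ring R] : RMod R := ModuleCat.of Rᵐᵒᵖ R

/-- A ring is Iwanaga-Gorenstein if it is (left and right) Noetherian and has finite injective
dimension both as a left and as a right module over itself. -/
structure IsIwanagaGorenstein (R : Type u) [Ring R] : Prop where
  left_noetherian : IsNoetherianRing R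
  right_noetherian : IsNoetherianRing Rᵐᵒᵖ
  left_idim : ∃ n : ℕ, HasInjectiveDimensionLE (ModuleCat.of R R) n
  right_idim : ∃ n : ℕ, HasInjectiveDimensionLE (rightRegular R) n

variable (R : Type u) [Ring R]

/-! ### Finitely generated projective modules and their homotopy categories -/

/-- The property of being a finitely generated projective right module. -/
def isFGProj : ObjectProperty (RMod R) :=
  fun P => Module.Finite Rᵐᵒᵖ P ∧ Module.Projective Rᵐᵒᵖ P

/-- The category `proj R`. -/
abbrev ProjCat := (isFGProj R).FullSubcategory

lemma isFGProj_of_iso {P Q : RMod R} (e : P ≅ Q) (h : isFGProj R P) : isFGProj R Q := by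
  obtain ⟨h1, h2⟩ := h
  exact ⟨Module.Finite.equiv e.toLinearEquiv, Module.Projective.of_equiv e.toLinearEquiv⟩

instance : (isFGProj R).IsClosedUnderIsomorphisms where
  of_iso e h := isFGProj_of_iso R e h

instance : (isFGProj R).ContainsZero where
  exists_zero := ⟨ModuleCat.of Rᵐᵒᵖ PUnit, ModuleCat.isZero_of_subsingleton _,
    by constructor <;> dsimp <;> infer_instance⟩

lemma isFGProj_biprod {P Q : RMod R} (hP : isFGProj R P) (hQ : isFGProj R Q) :
    isFGProj R (P ⊞ Q) := by
  obtain ⟨_, _⟩ := hP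
  obtain ⟨_, _⟩ := hQ
  refine isFGProj_of_iso R (ModuleCat.biprodIsoProd P Q).symm ⟨?_, ?_⟩ <;>
    dsimp <;> infer_instance

instance : HasBinaryBiproducts (ProjCat R) where
  has_binary_biproduct P Q := HasBinaryBiproduct.mk
    { bicone :=
        { pt := ⟨P.obj ⊞ Q.obj, isFGProj_biprod R P.property Q.property⟩
          fst := ObjectProperty.homMk biprod.fst
          snd := ObjectProperty.homMk biprod.snd
          inl := ObjectProperty.homMk biprod.inl
          inr := ObjectProperty.homMk biprod.inr
          inl_fst := by ext1; simp
          inl_snd := by ext1; simp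
          inr_fst := by ext1; simp
          inr_snd := by ext1; simp }
      isBilimit := isBinaryBilimitOfTotal _ (by ext1; exact biprod.total) }

/-- The homotopy category `K(proj R)` of cochain complexes over `proj R`. -/
abbrev KProj := HomotopyCategory (ProjCat R) (ComplexShape.up ℤ)

/-- The `i`-th cohomology of a complex in `K(proj R)`, as a right `R`-module. -/
abbrev KProj.homology (i : ℤ) : KProj R ⥤ RMod R :=
  (isFGProj R).ι.mapHomotopyCategory (ComplexShape.up ℤ) ⋙
    HomotopyCategory.homologyFunctor (RMod R) (ComplexShape.up ℤ) i

/-- Complexes in `K(proj R)` with bounded cohomology. -/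
def hasBoundedHomology : ObjectProperty (KProj R) :=
  fun X => ∃ N : ℕ, ∀ i : ℤ, (N : ℤ) < |i| → IsZero ((KProj.homology R i).obj X)

instance : (hasBoundedHomology R).IsClosedUnderIsomorphisms where
  of_iso := by
    rintro X Y e ⟨N, hN⟩
    exact ⟨N, fun i hi => (hN i hi).of_iso ((KProj.homology R i).mapIso e.symm)⟩

instance : (hasBoundedHomology R).IsTriangulated where
  exists_zero := ⟨0, isZero_zero _, 0, fun i _ => Functor.map_isZero _ (isZero_zero _)⟩
  isStableUnderShiftBy n :=
    { le_shift := by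
        rintro X ⟨N, hN⟩
        refine ⟨N + n.natAbs, fun i hi => ?_⟩
        have h := hN (n + i) (by
          rw [Nat.cast_add, Int.natCast_natAbs] at hi
          rcases abs_cases i with h | h <;> rcases abs_cases n with h' | h' <;>
            rcases abs_cases (n + i) with h'' | h'' <;> omega)
        refine h.of_iso ?_
        exact (HomotopyCategory.homologyFunctor (RMod R) (ComplexShape.up ℤ) i).mapIso
            ((((isFGProj R).ι.mapHomotopyCategory (ComplexShape.up ℤ)).commShiftIso n).app X) ≪≫
          ((HomotopyCategory.homologyFunctor (RMod R) (ComplexShape.up ℤ) 0).shiftIso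
            n i (n + i) rfl).app _ }
  toIsTriangulatedClosed₂ := .mk' (by
    rintro T hT ⟨N, hN⟩ ⟨M, hM⟩
    refine ⟨max N M, fun i hi => ?_⟩
    have hT' := ((isFGProj R).ι.mapHomotopyCategory (ComplexShape.up ℤ)).map_distinguished T hT
    have ex := (HomotopyCategory.homologyFunctor (RMod R)
      (ComplexShape.up ℤ) 0).homologySequence_exact₂ _ hT' i
    rw [Nat.cast_max] at hi
    exact ex.isZero_of_both_zeros
      ((hN i (lt_of_le_of_lt (le_max_left _ _) hi)).eq_of_src _ _)
      ((hM i (lt_of_le_of_lt (le_max_right _ _) hi)).eq_of_tgt _ _))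

/-- The triangulated category `K^{∞,b}(proj R)`. -/
abbrev KInfB := (hasBoundedHomology R).FullSubcategory

/-- Bounded complexes of finitely generated projective modules. -/
def isBoundedComplex : ObjectProperty (CochainComplex (ProjCat R) ℤ) :=
  fun A => ∃ N : ℕ, ∀ i : ℤ, (N : ℤ) < |i| → IsZero (A.X i)

/-- The objects of `K(proj R)` isomorphic to bounded complexes. -/
def isPerfect : ObjectProperty (KProj R) :=
  fun X => ∃ A : CochainComplex (ProjCat R) ℤ, isBoundedComplex R A ∧
    Nonempty (X ≅ (HomotopyCategory.quotient _ _).obj A)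

instance : (isPerfect R).IsClosedUnderIsomorphisms where
  of_iso := by
    rintro X Y e ⟨A, hA, ⟨i⟩⟩
    exact ⟨A, hA, ⟨e.symm ≪≫ i⟩⟩

instance : (isPerfect R).IsTriangulatedClosed₃ where
  ext₃' := by
    rintro T hT ⟨A, ⟨N, hN⟩, ⟨a⟩⟩ ⟨B, ⟨M, hM⟩, ⟨b⟩⟩
    obtain ⟨f : A ⟶ B, hf⟩ := (HomotopyCategory.quotient _ _).map_surjective
      (a.inv ≫ T.mor₁ ≫ b.hom)
    have e := isoTriangleOfIso₁₂ T _ hT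
      (HomotopyCategory.mappingCone_triangleh_distinguished f) a b (by
        change T.mor₁ ≫ b.hom = a.hom ≫ (HomotopyCategory.quotient _ _).map f
        rw [hf]; simp)
    refine ObjectProperty.le_isoClosure _ _
      ⟨CochainComplex.mappingCone f, ⟨N + M + 1, fun i hi => ?_⟩, ⟨Triangle.π₃.mapIso e⟩⟩
    rw [CochainComplex.mappingCone.isZero_X_iff]
    push_cast at hi
    refine ⟨hN _ ?_, hM _ ?_⟩
    · rcases abs_cases i with h | h <;> rcases abs_cases (i + 1) with h' | h' <;> omega
    · omega

instance : (isPerfect R).IsStableUnderShift ℤ where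
  isStableUnderShiftBy n :=
    { le_shift := by
        rintro X ⟨A, ⟨N, hN⟩, ⟨e⟩⟩
        refine ⟨A⟦n⟧, ⟨N + n.natAbs, fun i hi => ?_⟩,
          ⟨(shiftFunctor (KProj R) n).mapIso e ≪≫
            (((HomotopyCategory.quotient _ _).commShiftIso n).app A).symm⟩⟩
        refine hN (i + n) ?_
        rw [Nat.cast_add, Int.natCast_natAbs] at hi
        rcases abs_cases i with h | h <;> rcases abs_cases n with h' | h' <;>
          rcases abs_cases (i + n) with h'' | h'' <;> omega }

instance : (isPerfect R).IsTriangulated where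
  exists_zero := ⟨(HomotopyCategory.quotient _ _).obj 0, Functor.map_isZero _ (isZero_zero _),
    0, ⟨0, fun i _ => (HomologicalComplex.eval _ _ i).map_isZero (isZero_zero _)⟩,
    ⟨Iso.refl _⟩⟩
  toIsTriangulatedClosed₂ := .of_isTriangulatedClosed₃

/-- `K^b(proj R)` as a triangulated subcategory of `K^{∞,b}(proj R)`. -/
abbrev kB : ObjectProperty (KInfB R) :=
  (isPerfect R).inverseImage (hasBoundedHomology R).ι

/-- The Verdier quotient `(K^{∞,b}/K^b)(proj R)`: the localization of `K^{∞,b}(proj R)` at the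
morphisms whose cone lies in `K^b(proj R)`. -/
abbrev KQuot := (kB R).trW.Localization

/-- The Verdier quotient functor. -/
abbrev KQuot.Q : KInfB R ⥤ KQuot R := (kB R).trW.Q

/-! ### Cohen-Macaulay modules and surjections between them -/

/-- `CM R`: finitely presented right modules `X` with `Ext^i(X, R) = 0` for all `i > 0`. -/
def isCM : ObjectProperty (RMod R) :=
  fun X => Module.FinitePresentation Rᵐᵒᵖ X ∧
    ∀ i : ℕ, 0 < i → Subsingleton (Abelian.Ext X (rightRegular R) i)

/-- Surjections between Cohen-Macaulay modules. -/
def isCMSurjection : ObjectProperty (Arrow (RMod R)) :=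
  fun α => isCM R α.left ∧ isCM R α.right ∧ Function.Surjective α.hom

/-- The category `Mor^e(CM R)`, a full subcategory of the category of morphisms of right
`R`-modules. -/
abbrev MorE := (isCMSurjection R).FullSubcategory

namespace MorE

variable {R}

/-- The source `X` of `α : X ⟶ T`. -/
abbrev src (α : MorE R) : RMod R := α.obj.left

/-- The target `T` of `α : X ⟶ T`. -/
abbrev tgt (α : MorE R) : RMod R := α.obj.right

/-- The underlying surjection `X ⟶ T`. -/
abbrev arr (α : MorE R) : α.src ⟶ α.tgt := α.obj.hom

/-- The component of a morphism on the sources. -/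
abbrev onSrc {α β : MorE R} (f : α ⟶ β) : α.src ⟶ β.src := f.hom.left

/-- The component of a morphism on the targets. -/
abbrev onTgt {α β : MorE R} (f : α ⟶ β) : α.tgt ⟶ β.tgt := f.hom.right

/-- A sequence `α ⟶ β ⟶ γ` with zero composition and exact rows
`0 ⟶ X_α ⟶ X_β ⟶ X_γ ⟶ 0` and `0 ⟶ T_α ⟶ T_β ⟶ T_γ ⟶ 0`. -/
structure IsConflation {α β γ : MorE R} (i : α ⟶ β) (p : β ⟶ γ) : Prop where
  zero : i ≫ p = 0
  src_inj : Function.Injective (onSrc i)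
  src_exact : Function.Exact (onSrc i) (onSrc p)
  src_surj : Function.Surjective (onSrc p)
  tgt_inj : Function.Injective (onTgt i)
  tgt_exact : Function.Exact (onTgt i) (onTgt p)
  tgt_surj : Function.Surjective (onTgt p)

/-- Projective objects of the exact category `Mor^e(CM R)`. -/
def IsProj (q : MorE R) : Prop :=
  ∀ ⦃α β γ : MorE R⦄ (i : α ⟶ β) (p : β ⟶ γ), IsConflation i p →
    ∀ f : q ⟶ γ, ∃ g : q ⟶ β, g ≫ p = f

/-- Injective objects of the exact category `Mor^e(CM R)`. -/
def IsInj (q : MorE R) : Prop :=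
  ∀ ⦃α β γ : MorE R⦄ (i : α ⟶ β) (p : β ⟶ γ), IsConflation i p →
    ∀ f : α ⟶ q, ∃ g : β ⟶ q, i ≫ g = f

variable (R) in
/-- `Mor^e(CM R)` is a Frobenius category: it has enough projectives and enough injectives, and
these coincide. -/
structure IsFrobenius : Prop where
  proj_iff_inj : ∀ q : MorE R, IsProj q ↔ IsInj q
  enough_proj : ∀ α : MorE R, ∃ (γ q : MorE R) (i : γ ⟶ q) (p : q ⟶ α),
    IsConflation i p ∧ IsProj q
  enough_inj : ∀ α : MorE R, ∃ (q γ : MorE R) (i : α ⟶ q) (p : q ⟶ γ),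
    IsConflation i p ∧ IsInj q

variable (R) in
/-- Two morphisms are identified in the stable category if their difference factors through a
projective-injective object. -/
def stableRel : HomRel (MorE R) := fun α β f g =>
  ∃ (q : MorE R) (a : α ⟶ q) (b : q ⟶ β), IsProj q ∧ IsInj q ∧ f - g = a ≫ b

variable (R) in
/-- The stable category of the Frobenius category `Mor^e(CM R)`. -/
abbrev Stable := CategoryTheory.Quotient (stableRel R)

variable (R) in
/-- The projection onto the stable category. -/
abbrev toStable : MorE R ⥤ Stable R := CategoryTheory.Quotient.functor (stableRel R)

variable (R) in
/-- A choice, for every object `α`, of an exact sequence `0 ⟶ α ⟶ q α ⟶ Σ α ⟶ 0` with `q α`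
projective-injective. -/
structure Cosyzygies where
  q : MorE R → MorE R
  sus : MorE R → MorE R
  i : ∀ α, α ⟶ q α
  p : ∀ α, q α ⟶ sus α
  conf : ∀ α, IsConflation (i α) (p α)
  proj : ∀ α, IsProj (q α)
  inj : ∀ α, IsInj (q α)

lemma hom_ext {α β : MorE R} {f g : α ⟶ β} (h₁ : onSrc f = onSrc g) (h₂ : onTgt f = onTgt g) :
    f = g := by
  ext1
  exact Arrow.hom_ext _ _ h₁ h₂

lemma IsConflation.cancel {α β γ δ : MorE R} {i : α ⟶ β} {p : β ⟶ γ} (h : IsConflation i p)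
    {s t : γ ⟶ δ} (hst : p ≫ s = p ≫ t) : s = t := by
  have := (ModuleCat.epi_iff_surjective _).2 h.src_surj
  have := (ModuleCat.epi_iff_surjective _).2 h.tgt_surj
  refine hom_ext ?_ ?_
  · rw [← cancel_epi (onSrc p)]
    exact congrArg onSrc hst
  · rw [← cancel_epi (onTgt p)]
    exact congrArg onTgt hst

lemma exists_desc_module {A B C D : RMod R} (i : A ⟶ B) (p : B ⟶ C)
    (h : Function.Exact i p) (hp : Function.Surjective p) (u : B ⟶ D) (hu : i ≫ u = 0) :
    ∃ v : C ⟶ D, p ≫ v = u := by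
  let S : ShortComplex (RMod R) := ShortComplex.mk i p (by ext x; exact h.apply_apply_eq_zero x)
  have hS : S.Exact := (ShortComplex.ShortExact.moduleCat_exact_iff_function_exact S).2 h
  have : Epi S.g := (ModuleCat.epi_iff_surjective _).2 hp
  exact ⟨hS.desc u hu, hS.g_desc u hu⟩

lemma IsConflation.exists_desc {α β γ δ : MorE R} {i : α ⟶ β} {p : β ⟶ γ}
    (h : IsConflation i p) (u : β ⟶ δ) (hu : i ≫ u = 0) : ∃ v : γ ⟶ δ, p ≫ v = u := by
  obtain ⟨v₁, h₁⟩ := exists_desc_module _ _ h.src_exact h.src_surj (onSrc u)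
    (congrArg onSrc hu)
  obtain ⟨v₂, h₂⟩ := exists_desc_module _ _ h.tgt_exact h.tgt_surj (onTgt u)
    (congrArg onTgt hu)
  have := (ModuleCat.epi_iff_surjective _).2 h.src_surj
  refine ⟨ObjectProperty.homMk (Arrow.homMk v₁ v₂ ?_), hom_ext h₁ h₂⟩
  change v₁ ≫ δ.arr = γ.arr ≫ v₂
  rw [← cancel_epi (onSrc p), reassoc_of% h₁]
  have e₁ : onSrc p ≫ γ.arr = β.arr ≫ onTgt p := Arrow.w p.hom
  have e₂ : onSrc u ≫ δ.arr = β.arr ≫ onTgt u := Arrow.w u.hom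
  rw [reassoc_of% e₁, h₂, e₂]

namespace Cosyzygies

variable (S : Cosyzygies R)

/-- `s : Σ α ⟶ Σ β` is induced by `f : α ⟶ β` if it completes `f` to a morphism between the
chosen exact sequences. -/
def Induces {α β : MorE R} (f : α ⟶ β) (s : S.sus α ⟶ S.sus β) : Prop :=
  ∃ e : S.q α ⟶ S.q β, S.i α ≫ e = f ≫ S.i β ∧ S.p α ≫ s = e ≫ S.p β

lemma exists_induces {α β : MorE R} (f : α ⟶ β) : ∃ s, S.Induces f s := by
  obtain ⟨e, he⟩ := S.inj β _ _ (S.conf α) (f ≫ S.i β)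
  obtain ⟨s, hs⟩ := (S.conf α).exists_desc (e ≫ S.p β) (by
    rw [reassoc_of% he, (S.conf β).zero, comp_zero])
  exact ⟨s, e, he, hs⟩

lemma Induces.stable_eq {α β : MorE R} {f f' : α ⟶ β} {s s' : S.sus α ⟶ S.sus β}
    (h : S.Induces f s) (h' : S.Induces f' s') (hf : stableRel R f f') :
    (toStable R).map s = (toStable R).map s' := by
  obtain ⟨e, he, hs⟩ := h
  obtain ⟨e', he', hs'⟩ := h'
  obtain ⟨q, a, b, -, hq, hab⟩ := hf
  obtain ⟨a', ha'⟩ := hq _ _ (S.conf α) a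
  obtain ⟨t, ht⟩ := (S.conf α).exists_desc (e - e' - a' ≫ b ≫ S.i β) (by
    rw [Preadditive.comp_sub, Preadditive.comp_sub, he, he', reassoc_of% ha',
      ← Preadditive.sub_comp, hab, Category.assoc, sub_self])
  refine CategoryTheory.Quotient.sound _ ⟨S.q β, t, S.p β, S.proj β, S.inj β, ?_⟩
  refine (S.conf α).cancel ?_
  rw [Preadditive.comp_sub, hs, hs', reassoc_of% ht]
  simp [Preadditive.sub_comp, (S.conf β).zero]

lemma stableRel_refl (S : Cosyzygies R) {α β : MorE R} (f : α ⟶ β) : stableRel R f f :=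
  ⟨S.q α, 0, 0, S.proj α, S.inj α, by simp⟩

/-- The suspension functor of the stable category: an object `α` is sent to `Σ α` and the class
of `f` to the class of any morphism induced by `f`. -/
def suspension : Stable R ⥤ Stable R :=
  CategoryTheory.Quotient.lift (stableRel R)
    { obj α := (toStable R).obj (S.sus α)
      map f := (toStable R).map (S.exists_induces f).choose
      map_id α := by
        rw [← (toStable R).map_id]
        exact Induces.stable_eq S (S.exists_induces (𝟙 α)).choose_spec
          ⟨𝟙 _, by simp, by simp⟩ (S.stableRel_refl _)
      map_comp f g := by
        rw [← (toStable R).map_comp]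
        obtain ⟨e, he, hs⟩ := (S.exists_induces f).choose_spec
        obtain ⟨e', he', hs'⟩ := (S.exists_induces g).choose_spec
        exact Induces.stable_eq S (S.exists_induces (f ≫ g)).choose_spec
          ⟨e ≫ e', by rw [reassoc_of% he, he', Category.assoc],
            by rw [reassoc_of% hs, hs', Category.assoc]⟩ (S.stableRel_refl _) }
    (fun _ _ f g h => Induces.stable_eq S (S.exists_induces f).choose_spec
      (S.exists_induces g).choose_spec h)

/-- The distinguished triangles `a ⟶ b ⟶ c ⟶ Σ a` of the stable category: those isomorphic to
the image of `α ⟶ β ⟶ γ ⟶ Σ α`, where `f : α ⟶ β` and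
```
0 ⟶ α ⟶ q α ⟶ Σ α ⟶ 0
    |f    |w     ‖
0 ⟶ β ⟶  γ  ⟶ Σ α ⟶ 0
      g     h
```
is a commutative diagram with exact rows. -/
def Distinguished {a b c : Stable R} (x : a ⟶ b) (y : b ⟶ c) (z : c ⟶ S.suspension.obj a) :
    Prop :=
  ∃ (α β γ : MorE R) (f : α ⟶ β) (g : β ⟶ γ) (h : γ ⟶ S.sus α) (w : S.q α ⟶ γ)
    (e₁ : a ≅ (toStable R).obj α) (e₂ : b ≅ (toStable R).obj β) (e₃ : c ≅ (toStable R).obj γ),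
    IsConflation g h ∧ S.i α ≫ w = f ≫ g ∧ w ≫ h = S.p α ∧
    x ≫ e₂.hom = e₁.hom ≫ (toStable R).map f ∧
    y ≫ e₃.hom = e₂.hom ≫ (toStable R).map g ∧
    z ≫ S.suspension.map e₁.hom = e₃.hom ≫ (toStable R).map h

/-- A functor `Φ` from the stable category, with the suspension functor and distinguished
triangles given by `S`, to a pretriangulated category `D` respects the triangulated structures
if it commutes with the suspensions up to a natural isomorphism for which a triangle is
distinguished if and only if its image under `Φ` is. -/
def RespectsTriangles {D : Type*} [Category D] [HasZeroObject D] [HasShift D ℤ] [Preadditive D]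
    [∀ n : ℤ, (shiftFunctor D n).Additive] [Pretriangulated D] (Φ : Stable R ⥤ D) : Prop :=
  ∃ θ : S.suspension ⋙ Φ ≅ Φ ⋙ shiftFunctor D (1 : ℤ),
    ∀ ⦃a b c : Stable R⦄ (x : a ⟶ b) (y : b ⟶ c) (z : c ⟶ S.suspension.obj a),
      S.Distinguished x y z ↔
        Triangle.mk (Φ.map x) (Φ.map y) (Φ.map z ≫ θ.hom.app a) ∈ distTriang D

end Cosyzygies

/-! ### The gluing functor -/

/-- A complex `F_α` of finitely generated projective modules obtained from `α : X ⟶ T` by gluing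
a projective resolution `⋯ ⟶ F^{-1} ⟶ F^0 ⟶ X ⟶ 0` and a projective coresolution
`0 ⟶ T ⟶ F^1 ⟶ F^2 ⟶ ⋯` along `α`. -/
structure Gluing (α : MorE R) where
  cplx : CochainComplex (ProjCat R) ℤ
  ρ : (cplx.X 0).obj ⟶ α.src
  ε : α.tgt ⟶ (cplx.X 1).obj
  d_zero_one : (cplx.d 0 1).hom = ρ ≫ α.arr ≫ ε
  ρ_surj : Function.Surjective ρ
  exact_zero : Function.Exact (cplx.d (-1) 0).hom ρ
  exact_neg : ∀ i : ℤ, i < 0 → Function.Exact (cplx.d (i - 1) i).hom (cplx.d i (i + 1)).hom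
  ε_inj : Function.Injective ε
  exact_one : Function.Exact ε (cplx.d 1 2).hom
  exact_pos : ∀ i : ℤ, 1 < i → Function.Exact (cplx.d (i - 1) i).hom (cplx.d i (i + 1)).hom

/-- A chain map `F_α ⟶ F_β` lifting `f : α ⟶ β`. -/
structure Gluing.IsLift {α β : MorE R} (A : Gluing α) (B : Gluing β) (f : α ⟶ β)
    (φ : A.cplx ⟶ B.cplx) : Prop where
  src : (φ.f 0).hom ≫ B.ρ = A.ρ ≫ onSrc f
  tgt : A.ε ≫ (φ.f 1).hom = onTgt f ≫ B.ε

/-- `F : Mor^e(CM R) ⥤ K^{∞,b}(proj R)` is the functor `α ↦ F_α`, `f ↦ F_f` given by the gluings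
`G`: every `f` has a lift to a chain map, and `F f` is the homotopy class of any lift of `f`. -/
def IsGluingFunctor (G : ∀ α : MorE R, Gluing α) (F : MorE R ⥤ KInfB R) : Prop :=
  ∃ e : ∀ α : MorE R, (F.obj α).obj ≅ (HomotopyCategory.quotient _ _).obj (G α).cplx,
    ∀ ⦃α β : MorE R⦄ (f : α ⟶ β),
      (∃ φ : (G α).cplx ⟶ (G β).cplx, (G α).IsLift (G β) f φ) ∧
      ∀ φ : (G α).cplx ⟶ (G β).cplx, (G α).IsLift (G β) f φ →
        (F.map f).hom ≫ (e β).hom = (e α).hom ≫ (HomotopyCategory.quotient _ _).map φ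

end MorE

end IwanagaGorenstein

end

/-! The complexes `F_α` are characterised by exactness. The complex `F_α` is exact in every degree
except 0, since `α` is surjective. It also stays exact in every degree except 0 after applying
Hom(-, P) with P in proj R ("coexact"): in negative degrees because Ext(X, R) = 0, in positive
degrees because R has finite injective dimension on the right. Conversely, a complex that is exact
in positive and coexact in negative degrees is a gluing of Coker d⁻¹ ⟶ Ker d¹. Here finite injective
dimension on the left turns coexactness in all degrees ≤ i into exactness in degree i, by dualising
twice.

In the homotopy category, every chain map `F_α ⟶ F_β` lifts a morphism `α ⟶ β`, and it is
null-homotopic only if that morphism factors through some P = P (`Gluing.exists_of_chainMap`,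
`Gluing.exists_factorization`). To pass to the Verdier quotient, perfect complexes are cut by brutal
truncation. Maps from `F_α` to a bounded complex in degrees < 0 vanish by coexactness, and maps from
a bounded complex in degrees > 0 to `F_β` vanish by exactness. Hence a map through a perfect complex
factors through a complex in degree 0, a gluing of P ⟶ 0, and fractions can be straightened to
honest morphisms. The projective-injectives are the surjections of finitely generated projectives,
which split into objects P = P and P ⟶ 0, so the stable category embeds fully faithfully
(`Gluing.exists_Q_map_eq`, `Gluing.toStable_map_eq`).

For density, a complex with bounded cohomology is made exact in positive degrees, then coexact in
negative degrees, by finitely many cones and cocones on stalk complexes, which do not change it in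
the quotient (`exists_iso_exactAt_coexactAt`).

For triangles, an exact sequence `α ⟶ β ⟶ γ` lets `F_β` be realised as an extension of `F_γ` by
`F_α` along a cocycle of degree 1, unique up to coboundary and natural (`exists_connection`,
`Connection.naturality`). If `β` is projective-injective, its class becomes an isomorphism `F_γ ≅
F_α[1]`; its negative is the comparison of suspensions. All constructions of lifts, homotopies and
cocycles rest on solving δu = z degree by degree away from the critical degrees
(`Gluing.exists_δ_eq`). -/

noncomputable section

namespace IwanagaGorenstein

/-! ### Vanishing of `Ext` along short exact sequences of modules -/

section Ext

variable {A : Type u} [Ring A]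

/-- `0 ⟶ M ⟶ N ⟶ P ⟶ 0` is a short exact sequence of modules. -/
structure IsSES {M N P : ModuleCat.{u} A} (f : M ⟶ N) (g : N ⟶ P) : Prop where
  inj : Function.Injective f
  exact : Function.Exact f g
  surj : Function.Surjective g

namespace IsSES

variable {M N P : ModuleCat.{u} A} {f : M ⟶ N} {g : N ⟶ P}

lemma zero (h : IsSES f g) : f ≫ g = 0 := by
  ext x
  exact h.exact.apply_apply_eq_zero x

lemma shortExact (h : IsSES f g) : (ShortComplex.mk f g h.zero).ShortExact where
  exact := (ShortComplex.ShortExact.moduleCat_exact_iff_function_exact _).2 h.exact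
  mono_f := (ModuleCat.mono_iff_injective _).2 h.inj
  epi_g := (ModuleCat.epi_iff_surjective _).2 h.surj

lemma exists_desc (h : IsSES f g) {Y : ModuleCat.{u} A} (u : N ⟶ Y) (hu : f ≫ u = 0) :
    ∃ v : P ⟶ Y, g ≫ v = u := by
  have := h.shortExact.epi_g
  exact ⟨h.shortExact.exact.desc u hu, h.shortExact.exact.g_desc u hu⟩

lemma exists_lift (h : IsSES f g) {Y : ModuleCat.{u} A} (u : Y ⟶ N) (hu : u ≫ g = 0) :
    ∃ v : Y ⟶ M, v ≫ f = u := by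
  have := h.shortExact.mono_f
  exact ⟨h.shortExact.exact.lift u hu, h.shortExact.exact.lift_f u hu⟩

lemma subsingleton_ext_left (h : IsSES f g) (Y : ModuleCat.{u} A) (k : ℕ)
    (h₂ : Subsingleton (Abelian.Ext N Y k)) (h₃ : Subsingleton (Abelian.Ext P Y (k + 1))) :
    Subsingleton (Abelian.Ext M Y k) := by
  refine subsingleton_of_forall_eq 0 fun x => ?_
  obtain ⟨y, hy⟩ := Abelian.Ext.contravariant_sequence_exact₁ h.shortExact Y x
    (Nat.add_comm 1 k) (h₃.elim _ _)
  rw [← hy, h₂.elim y 0, Abelian.Ext.comp_zero]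

lemma subsingleton_ext_middle (h : IsSES f g) (Y : ModuleCat.{u} A) (k : ℕ)
    (h₁ : Subsingleton (Abelian.Ext M Y k)) (h₃ : Subsingleton (Abelian.Ext P Y k)) :
    Subsingleton (Abelian.Ext N Y k) := by
  refine subsingleton_of_forall_eq 0 fun x => ?_
  obtain ⟨y, hy⟩ := Abelian.Ext.contravariant_sequence_exact₂ h.shortExact Y x (h₁.elim _ _)
  rw [← hy, h₃.elim y 0, Abelian.Ext.comp_zero]

lemma subsingleton_ext_right (h : IsSES f g) (Y : ModuleCat.{u} A) (k : ℕ)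
    (h₁ : Subsingleton (Abelian.Ext M Y k)) (h₂ : Subsingleton (Abelian.Ext N Y (k + 1))) :
    Subsingleton (Abelian.Ext P Y (k + 1)) := by
  refine subsingleton_of_forall_eq 0 fun x => ?_
  obtain ⟨y, hy⟩ := Abelian.Ext.contravariant_sequence_exact₃ h.shortExact Y x (h₂.elim _ _)
    (Nat.add_comm 1 k)
  rw [← hy, h₁.elim y 0, Abelian.Ext.comp_zero]

/-- If `Ext¹(P, Y) = 0`, morphisms to `Y` extend from `M` to `N`. -/
lemma exists_extension (h : IsSES f g) {Y : ModuleCat.{u} A}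
    (h₃ : Subsingleton (Abelian.Ext P Y 1)) (u : M ⟶ Y) : ∃ v : N ⟶ Y, f ≫ v = u := by
  obtain ⟨y, hy⟩ := Abelian.Ext.contravariant_sequence_exact₁ h.shortExact Y (Abelian.Ext.mk₀ u)
    (Nat.add_comm 1 0) (h₃.elim _ _)
  obtain ⟨v, rfl⟩ := (Abelian.Ext.mk₀_bijective _ _).2 y
  refine ⟨v, (Abelian.Ext.mk₀_bijective _ _).1 ?_⟩
  rwa [Abelian.Ext.mk₀_comp_mk₀] at hy

/-- As Ext¹(N, Y) = 0, each class in Ext¹(P, Y) is the image of a map M ⟶ Y under the connecting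
map, and maps that extend to N go to zero. -/
lemma subsingleton_ext_one (h : IsSES f g) {Y : ModuleCat.{u} A}
    (h₂ : Subsingleton (Abelian.Ext N Y 1)) (hu : ∀ u : M ⟶ Y, ∃ v : N ⟶ Y, f ≫ v = u) :
    Subsingleton (Abelian.Ext P Y 1) := by
  refine subsingleton_of_forall_eq 0 fun x => ?_
  obtain ⟨y, hy⟩ := Abelian.Ext.contravariant_sequence_exact₃ h.shortExact Y x (h₂.elim _ _)
    (Nat.add_comm 1 0)
  obtain ⟨u, rfl⟩ := (Abelian.Ext.mk₀_bijective _ _).2 y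
  obtain ⟨v, rfl⟩ := hu u
  rw [← hy, ← Abelian.Ext.mk₀_comp_mk₀,
    ← Abelian.Ext.comp_assoc _ _ _ (Nat.add_comm 1 0) (zero_add 0) (by lia)]
  have := h.shortExact.extClass_comp
  rw [this, Abelian.Ext.zero_comp]

end IsSES

/-- `Ext^k(M, Y) = 0` for all `k > 0`. -/
def ExtVanishes (M Y : ModuleCat.{u} A) : Prop :=
  ∀ k : ℕ, 0 < k → Subsingleton (Abelian.Ext M Y k)

lemma extVanishes_of_projective {P : ModuleCat.{u} A} [Module.Projective A P]
    (Y : ModuleCat.{u} A) : ExtVanishes P Y := by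
  rintro (_ | k) hk
  · omega
  · have : Projective P := P.projective_of_categoryTheory_projective
    exact subsingleton_of_forall_eq 0 fun x => Abelian.Ext.eq_zero_of_projective x

section Sequence

variable (E : ℕ → ModuleCat.{u} A) (d : ∀ n, E n ⟶ E (n + 1))

/-- The exact sequence `0 ⟶ Ker d_n ⟶ E_n ⟶ Ker d_{n+1} ⟶ 0`. -/
lemma exists_isSES_ker (n : ℕ) (h : Function.Exact (d n) (d (n + 1))) :
    ∃ g : E n ⟶ ModuleCat.of A (LinearMap.ker (d (n + 1)).hom),
      IsSES (ModuleCat.ofHom (LinearMap.ker (d n).hom).subtype) g ∧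
      g ≫ ModuleCat.ofHom (LinearMap.ker (d (n + 1)).hom).subtype = d n := by
  refine ⟨ModuleCat.ofHom ((d n).hom.codRestrict _ fun x => h.apply_apply_eq_zero x), ⟨?_, ?_, ?_⟩,
    ?_⟩
  · exact Subtype.val_injective
  · intro x
    constructor
    · intro hx
      exact ⟨⟨x, congrArg Subtype.val hx⟩, rfl⟩
    · rintro ⟨⟨y, hy⟩, rfl⟩
      exact Subtype.ext hy
  · rintro ⟨y, hy⟩
    obtain ⟨x, rfl⟩ := (h y).1 hy
    exact ⟨x, rfl⟩
  · rfl

/-- Dimension shifting: j passages from Ker d_n to Ker d_{n+1} raise the degree from k to k + j,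
which exceeds the injective dimension e. Only exactness below N enters, so finite pieces of a
complex suffice. -/
lemma subsingleton_ext_ker_of_exact {Y : ModuleCat.{u} A} {e : ℕ} [HasInjectiveDimensionLE Y e]
    (hE : ∀ n, ExtVanishes (E n) Y) (N : ℕ)
    (h : ∀ n < N, Function.Exact (d n) (d (n + 1))) :
    ∀ (j n k : ℕ), 0 < k → e < k + j → n + j ≤ N →
      Subsingleton (Abelian.Ext (ModuleCat.of A (LinearMap.ker (d n).hom)) Y k) := by
  intro j
  induction j with
  | zero => exact fun n k _ hk _ => HasInjectiveDimensionLT.subsingleton Y (e + 1) k (by lia) _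
  | succ j ih =>
    intro n k hk hk' hn
    obtain ⟨g, hg, -⟩ := exists_isSES_ker E d n (h n (by lia))
    exact hg.subsingleton_ext_left Y k (hE n k hk) (ih (n + 1) (k + 1) (by lia) (by lia) (by lia))

/-- Along an exact sequence of `Ext(-, Y)`-acyclic modules that is longer than the injective
dimension of `Y`, morphisms to `Y` extend. -/
lemma exists_extension_of_exact {Y : ModuleCat.{u} A} {e : ℕ} [HasInjectiveDimensionLE Y e]
    (hE : ∀ n, ExtVanishes (E n) Y)
    (h : ∀ n < e + 2, Function.Exact (d n) (d (n + 1))) (f : E 0 ⟶ Y)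
    (hf : ∀ x, d 0 x = 0 → f x = 0) : ∃ g : E 1 ⟶ Y, d 0 ≫ g = f := by
  obtain ⟨g₀, h₀, e₀⟩ := exists_isSES_ker E d 0 (h 0 (by lia))
  obtain ⟨g₁, h₁, -⟩ := exists_isSES_ker E d 1 (h 1 (by lia))
  obtain ⟨u, hu⟩ := h₀.exists_desc f (by ext ⟨x, hx⟩; exact hf x hx)
  -- The map `u` is defined on Ker d_1, and the obstruction to extending it to E_1 lies in Ext¹(Ker
  -- d_2, Y). It dies after e shifts starting from index 2, hence the bound e + 2.
  obtain ⟨v, hv⟩ := h₁.exists_extension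
    (subsingleton_ext_ker_of_exact (e := e) E d hE (e + 2) h e 2 1 (by lia) (by lia) (by lia)) u
  refine ⟨v, ?_⟩
  rw [← hu, ← hv, ← Category.assoc, e₀]

lemma extVanishes_ker_of_exact {Y : ModuleCat.{u} A} {e : ℕ} [HasInjectiveDimensionLE Y e]
    (hE : ∀ n, ExtVanishes (E n) Y) (h : ∀ n, Function.Exact (d n) (d (n + 1))) (n : ℕ) :
    ExtVanishes (ModuleCat.of A (LinearMap.ker (d n).hom)) Y := fun k hk =>
  subsingleton_ext_ker_of_exact (e := e) E d hE (n + e) (fun n _ => h n) e n k hk (by lia) le_rfl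

end Sequence

end Ext

/-! ### Finitely generated projective modules and their duals -/

section Dual

variable {R : Type u} [Ring R]

variable (R) in
/-- The identification of `Rᵐᵒᵖ` with `R` as right modules. -/
def opEquivSelf : Rᵐᵒᵖ ≃ₗ[Rᵐᵒᵖ] R where
  toFun x := x.unop
  invFun x := MulOpposite.op x
  map_add' _ _ := rfl
  map_smul' _ _ := rfl
  left_inv _ := rfl
  right_inv _ := rfl

variable (R) in
lemma isFGProj_rightRegular : isFGProj R (rightRegular R) :=
  ⟨Module.Finite.equiv (opEquivSelf R), Module.Projective.of_equiv (opEquivSelf R)⟩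

lemma isFGProj_pi (n : ℕ) : isFGProj R (ModuleCat.of Rᵐᵒᵖ (Fin n → R)) := by
  let e : (Fin n → Rᵐᵒᵖ) ≃ₗ[Rᵐᵒᵖ] (Fin n → R) := LinearEquiv.piCongrRight fun _ => opEquivSelf R
  exact ⟨Module.Finite.equiv e, Module.Projective.of_equiv e⟩

/-- A finitely generated module is a quotient of a finitely generated projective module. -/
lemma exists_cover (M : RMod R) [Module.Finite Rᵐᵒᵖ M] :
    ∃ (P : RMod R) (p : P ⟶ M), isFGProj R P ∧ Function.Surjective p := by
  obtain ⟨n, f, hf⟩ := Module.Finite.exists_fin' Rᵐᵒᵖ M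
  let e : (Fin n → R) ≃ₗ[Rᵐᵒᵖ] (Fin n → Rᵐᵒᵖ) :=
    LinearEquiv.piCongrRight fun _ => (opEquivSelf R).symm
  exact ⟨ModuleCat.of Rᵐᵒᵖ (Fin n → R), ModuleCat.ofHom (f ∘ₗ e.toLinearMap), isFGProj_pi n,
    hf.comp e.surjective⟩

/-- A dual basis of a finitely generated projective module. -/
lemma exists_dualBasis (P : Type u) [AddCommGroup P] [Module Rᵐᵒᵖ P] [Module.Finite Rᵐᵒᵖ P]
    [Module.Projective Rᵐᵒᵖ P] : ∃ (n : ℕ) (x : Fin n → P) (f : Fin n → P →ₗ[Rᵐᵒᵖ] R),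
      ∀ y : P, ∑ i, MulOpposite.op (f i y) • x i = y := by
  obtain ⟨n, f, hf⟩ := Module.Finite.exists_fin' Rᵐᵒᵖ P
  obtain ⟨s, hs⟩ := Module.projective_lifting_property f LinearMap.id hf
  refine ⟨n, fun i => f fun j => if i = j then 1 else 0,
    fun i => (opEquivSelf R).toLinearMap ∘ₗ LinearMap.proj i ∘ₗ s, fun y => ?_⟩
  conv_rhs => rw [← LinearMap.id_apply (R := Rᵐᵒᵖ) y, ← hs, LinearMap.comp_apply,
    LinearMap.pi_apply_eq_sum_univ f (s y)]
  rfl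

/-- Coordinates in a dual basis of Q reduce the problem to the target R. The hypothesis concerns
only maps that factor through φ, so that side conditions on φ, such as vanishing on a submodule,
pass to them. -/
lemma exists_factorization_of_regular {M N Q : RMod R} (hQ : isFGProj R Q) (u : M ⟶ N)
    (φ : M ⟶ Q)
    (h : ∀ f : M ⟶ rightRegular R, (∃ a : Q ⟶ rightRegular R, f = φ ≫ a) →
      ∃ ψ : N ⟶ rightRegular R, u ≫ ψ = f) :
    ∃ ψ : N ⟶ Q, u ≫ ψ = φ := by
  obtain ⟨_, _⟩ := hQ
  obtain ⟨n, x, f, hf⟩ := exists_dualBasis (R := R) Q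
  choose ψ hψ using fun i => h (φ ≫ ModuleCat.ofHom (f i)) ⟨_, rfl⟩
  refine ⟨ModuleCat.ofHom (∑ i, (LinearMap.toSpanSingleton Rᵐᵒᵖ Q (x i)) ∘ₗ
    (opEquivSelf R).symm.toLinearMap ∘ₗ (ψ i).hom), ?_⟩
  ext m
  conv_rhs => rw [← hf (φ m)]
  simp only [ModuleCat.hom_comp, ModuleCat.hom_ofHom, LinearMap.comp_apply, LinearMap.sum_apply]
  refine Finset.sum_congr rfl fun i _ => ?_
  have := congrArg (fun g : M ⟶ rightRegular R => g m) (hψ i)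
  change MulOpposite.op ((ψ i) (u m)) • x i = _
  exact congrArg (fun r : R => MulOpposite.op r • x i) this

section

variable (P : Type u) [AddCommGroup P] [Module Rᵐᵒᵖ P]

/-- The functionals of a dual basis generate the dual module, with coefficients given by evaluation.
This makes the dual a summand of Rⁿ and yields reflexivity. -/
lemma sum_dualBasis {n : ℕ} {x : Fin n → P} {f : Fin n → P →ₗ[Rᵐᵒᵖ] R}
    (h : ∀ y : P, ∑ i, MulOpposite.op (f i y) • x i = y) (φ : P →ₗ[Rᵐᵒᵖ] R) :
    ∑ i, φ (x i) • f i = φ := by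
  ext y
  conv_rhs => rw [← h y, map_sum]
  simp [LinearMap.sum_apply]

variable [Module.Finite Rᵐᵒᵖ P] [Module.Projective Rᵐᵒᵖ P]

instance projective_dual : Module.Projective R (P →ₗ[Rᵐᵒᵖ] R) := by
  obtain ⟨n, x, f, h⟩ := exists_dualBasis (R := R) P
  let i : (P →ₗ[Rᵐᵒᵖ] R) →ₗ[R] (Fin n → R) :=
    { toFun φ j := φ (x j)
      map_add' _ _ := rfl
      map_smul' _ _ := rfl }
  refine Module.Projective.of_split i (Fintype.linearCombination R f) ?_
  ext1 φ
  exact sum_dualBasis P h φ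

/-- Finitely generated projective modules are reflexive. -/
lemma exists_eval_eq (g : (P →ₗ[Rᵐᵒᵖ] R) →ₗ[R] R) : ∃ p : P, ∀ φ, g φ = φ p := by
  obtain ⟨n, x, f, h⟩ := exists_dualBasis (R := R) P
  refine ⟨∑ i, MulOpposite.op (g (f i)) • x i, fun φ => ?_⟩
  conv_lhs => rw [← sum_dualBasis P h φ]
  simp

lemma eq_of_forall_dual {p q : P} (hpq : ∀ φ : P →ₗ[Rᵐᵒᵖ] R, φ p = φ q) : p = q := by
  obtain ⟨n, x, f, h⟩ := exists_dualBasis (R := R) P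
  rw [← h p, ← h q]
  simp only [hpq]

end

/-- A sequence of finitely generated projective right modules whose dual is exact is exact, if `R`
has finite injective dimension as a left module. -/
lemma exact_of_dual_exact {e : ℕ} [HasInjectiveDimensionLE (ModuleCat.of R R) e]
    (F : ℕ → RMod R) (hF : ∀ n, isFGProj R (F n)) (d : ∀ n, F (n + 1) ⟶ F n)
    (hd : ∀ n, d (n + 1) ≫ d n = 0)
    (h : ∀ n (φ : F (n + 1) ⟶ rightRegular R), d (n + 1) ≫ φ = 0 →
      ∃ ψ : F n ⟶ rightRegular R, d n ≫ ψ = φ) :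
    Function.Exact (d 1) (d 0) := by
  have _ n : Module.Finite Rᵐᵒᵖ (F n) := (hF n).1
  have _ n : Module.Projective Rᵐᵒᵖ (F n) := (hF n).2
  have hd' n x : d n (d (n + 1) x) = 0 := congrArg (fun f : F (n + 2) ⟶ F n => f x) (hd n)
  -- The index shift places the dual of F 1, where exactness is claimed, at the start of the dual
  -- complex.
  let E (n : ℕ) : ModuleCat.{u} R := ModuleCat.of R (F (n + 1) →ₗ[Rᵐᵒᵖ] R)
  let δ (n : ℕ) : E n ⟶ E (n + 1) := ModuleCat.ofHom
    { toFun φ := φ ∘ₗ (d (n + 1)).hom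
      map_add' _ _ := rfl
      map_smul' _ _ := rfl }
  have hδ n (φ : E n) x : (δ n φ : F (n + 2) →ₗ[Rᵐᵒᵖ] R) x =
    (φ : F (n + 1) →ₗ[Rᵐᵒᵖ] R) (d (n + 1) x) := rfl
  have hE n : Function.Exact (δ n) (δ (n + 1)) := by
    intro φ
    constructor
    · intro hφ
      obtain ⟨ψ, hψ⟩ := h (n + 1) (ModuleCat.ofHom φ) (by ext x; exact LinearMap.congr_fun hφ x)
      exact ⟨ψ.hom, congrArg ModuleCat.Hom.hom hψ⟩
    · rintro ⟨ψ, rfl⟩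
      refine LinearMap.ext fun x => ?_
      rw [hδ, hδ, hd', map_zero]
      rfl
  intro p
  constructor
  -- Evaluation at a cycle p is a functional on E 0 that kills Ker δ_0, because such φ factor
  -- through d 0. It extends along δ_0 by finite injective dimension, the extension is evaluation at
  -- some q by reflexivity, and d 1 sends q to p since functionals separate points.
  · intro hp
    obtain ⟨g, hg⟩ := exists_extension_of_exact (e := e) E δ
      (fun n => extVanishes_of_projective (P := E n) _) (fun n _ => hE n) (Y := ModuleCat.of R R)
      (ModuleCat.ofHom (X := F 1 →ₗ[Rᵐᵒᵖ] R) (LinearMap.applyₗ' R p)) (by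
        intro φ hφ
        obtain ⟨ψ, hψ⟩ := h 0 (ModuleCat.ofHom φ) (by ext x; exact LinearMap.congr_fun hφ x)
        change φ p = 0
        have := congrArg (fun f : F 1 ⟶ rightRegular R => f p) hψ
        change ψ (d 0 p) = φ p at this
        rw [← this, hp, map_zero])
    obtain ⟨q, hq⟩ := exists_eval_eq (F 2) g.hom
    refine ⟨q, eq_of_forall_dual (R := R) _ fun φ => ?_⟩
    have := congrArg (fun f : E 0 ⟶ ModuleCat.of R R => f φ) hg
    change g (δ 0 φ) = φ p at this
    rw [← this]
    exact (hq (δ 0 φ)).symm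
  · rintro ⟨q, rfl⟩
    exact hd' 0 q

/-- Finitely generated modules over a left Noetherian ring admit left approximations by finitely
generated projective modules. -/
lemma exists_left_approximation [IsNoetherianRing R] (M : RMod R) [Module.Finite Rᵐᵒᵖ M] :
    ∃ (P : RMod R) (u : M ⟶ P), isFGProj R P ∧
      ∀ (Q : RMod R) (_ : isFGProj R Q) (φ : M ⟶ Q), ∃ ψ : P ⟶ Q, u ≫ ψ = φ := by
  obtain ⟨k, x, hx⟩ := Module.Finite.exists_fin (R := Rᵐᵒᵖ) (M := M)
  -- Evaluation at generators of M embeds the dual into R^k, so the dual is finitely generated by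
  -- left Noetherianity. Its generators are the coordinates of the approximation.
  let ev : (M →ₗ[Rᵐᵒᵖ] R) →ₗ[R] (Fin k → R) :=
    { toFun φ j := φ (x j)
      map_add' _ _ := rfl
      map_smul' _ _ := rfl }
  have hev : Function.Injective ev := fun φ ψ h =>
    LinearMap.ext_on_range hx fun i => congrFun h i
  have : Module.Finite R (M →ₗ[Rᵐᵒᵖ] R) := Module.Finite.of_injective ev hev
  obtain ⟨n, f, hf⟩ := Module.Finite.exists_fin (R := R) (M := M →ₗ[Rᵐᵒᵖ] R)
  refine ⟨ModuleCat.of Rᵐᵒᵖ (Fin n → R), ModuleCat.ofHom (LinearMap.pi f), isFGProj_pi n,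
    fun Q hQ φ => exists_factorization_of_regular hQ _ φ fun g _ => ?_⟩
  have hg : g.hom ∈ Submodule.span R (Set.range f) := hf ▸ Submodule.mem_top
  obtain ⟨c, hc⟩ := (Submodule.mem_span_range_iff_exists_fun R).1 hg
  refine ⟨ModuleCat.ofHom (∑ i, c i • LinearMap.proj i), ?_⟩
  ext m
  have := LinearMap.congr_fun hc m
  refine Eq.trans ?_ this
  simp [LinearMap.sum_apply]

end Dual

/-! ### Solving `δ u = z` degree by degree -/

section Cochain

open CochainComplex.HomComplex

variable {C : Type*} [Category* C] [Preadditive C] {K L : CochainComplex C ℤ}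

/-- To be applied to the error e = z - δu of a partial solution: once the error vanishes in one
degree, its next component is killed by the differential of K and can be removed by coexactness. -/
lemma d_comp_v_of_δ_eq_zero {m : ℤ} {e : Cochain K L m} (he : δ m (m + 1) e = 0) (p q : ℤ)
    (hpq : p + m = q) (h : e.v (p - 1) (q - 1) (by lia) = 0) :
    K.d (p - 1) p ≫ e.v p q hpq = 0 := by
  have h₁ := Cochain.congr_v he (p - 1) q (by lia)
  rw [δ_v m (m + 1) rfl e (p - 1) q (by lia) (q - 1) p rfl (by lia), h, zero_comp, zero_add,
    Cochain.zero_v] at h₁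
  rcases Int.even_or_odd (m + 1) with hm | hm
  · simpa [Int.negOnePow_even _ hm] using h₁
  · simpa [Int.negOnePow_odd _ hm] using h₁

lemma v_comp_d_of_δ_eq_zero {m : ℤ} {e : Cochain K L m} (he : δ m (m + 1) e = 0) (p q : ℤ)
    (hpq : p + m = q) (h : e.v (p + 1) (q + 1) (by lia) = 0) :
    e.v p q hpq ≫ L.d q (q + 1) = 0 := by
  have h₁ := Cochain.congr_v he p (q + 1) (by lia)
  rwa [δ_v m (m + 1) rfl e p (q + 1) (by lia) q (p + 1) (by lia) rfl, h, comp_zero, smul_zero,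
    add_zero, Cochain.zero_v] at h₁

/-- Two cochains whose values agree at `p` and `p + 1` have differentials that agree at `p`. -/
lemma δ_v_congr {n m : ℤ} (hnm : n + 1 = m) {u u' : Cochain K L n} (p q : ℤ) (hpq : p + m = q)
    (h₀ : u.v p (q - 1) (by lia) = u'.v p (q - 1) (by lia))
    (h₁ : u.v (p + 1) q (by lia) = u'.v (p + 1) q (by lia)) :
    (δ n m u).v p q hpq = (δ n m u').v p q hpq := by
  rw [δ_v n m hnm u p q hpq (q - 1) (p + 1) rfl rfl,
    δ_v n m hnm u' p q hpq (q - 1) (p + 1) rfl rfl, h₀, h₁]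

/-- A solution of `δ u = z` in degree `b` extends to all degrees `≥ b` if `K` is exact for
morphisms to the relevant terms of `L`. -/
lemma exists_δ_eq_up {n m : ℤ} (hnm : n + 1 = m) (z : Cochain K L m) (hz : δ m (m + 1) z = 0)
    (u : Cochain K L n) (b : ℤ)
    (hu : (δ n m u).v b (b + m) rfl = z.v b (b + m) rfl)
    (h : ∀ (p q : ℤ), b < p → p + m = q → ∀ f : K.X p ⟶ L.X q, K.d (p - 1) p ≫ f = 0 →
      ∃ g : K.X (p + 1) ⟶ L.X q, K.d p (p + 1) ≫ g = f) :
    ∃ u' : Cochain K L n, u'.EqUpTo u (b + 1) ∧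
      ∀ (p q : ℤ) (hpq : p + m = q), b ≤ p → (δ n m u').v p q hpq = z.v p q hpq := by
  let X (k : ℕ) : Set (Cochain K L n) :=
    Set.ofPred fun x => ∀ (p q : ℤ) (hpq : p + m = q), b ≤ p → p ≤ b + k →
      (δ n m x).v p q hpq = z.v p q hpq
  have step : ∀ (k : ℕ) (x : X k), ∃ x' : X (k + 1), x'.val.EqUpTo x.val (b + 1 + k) := by
    rintro k ⟨x, hx⟩
    obtain ⟨p, hp⟩ : ∃ p, p = b + k + 1 := ⟨_, rfl⟩
    have he : δ m (m + 1) (z - δ n m x) = 0 := by rw [δ_sub, hz, δ_δ, sub_zero]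
    obtain ⟨g, hg⟩ := h p (p + m) (by lia) rfl ((z - δ n m x).v p (p + m) rfl)
      (d_comp_v_of_δ_eq_zero he p _ rfl (by
        rw [Cochain.sub_v, hx (p - 1) _ _ (by lia) (by lia), sub_self]))
    -- The correction sits in degree p + 1 and changes δx only in degrees p and p + 1, so the solved
    -- degrees stay solved. The sign cancels the one before the differential of K in δ.
    refine ⟨⟨x + m.negOnePow • Cochain.single g n, ?_⟩, ?_⟩
    · intro p' q' hpq' hp₀ hp'
      rcases hp'.lt_or_eq with hlt | heq
      · rw [← hx p' q' hpq' hp₀ (by push_cast at hlt; lia)]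
        apply δ_v_congr hnm
        · rw [Cochain.add_v, Cochain.units_smul_v,
            Cochain.single_v_eq_zero _ _ _ _ _ (by push_cast at hlt; lia), smul_zero, add_zero]
        · rw [Cochain.add_v, Cochain.units_smul_v,
            Cochain.single_v_eq_zero _ _ _ _ _ (by push_cast at hlt; lia), smul_zero, add_zero]
      · obtain rfl : p' = p := by rw [heq, hp]; push_cast; ring
        subst hpq'
        rw [δ_add, Cochain.add_v, ← eq_sub_iff_add_eq', ← Cochain.sub_v, ← hg, δ_units_smul,
          Cochain.units_smul_v, δ_v n m hnm _ p' _ rfl (p' + m - 1) (p' + 1) rfl rfl,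
          Cochain.single_v_eq_zero _ _ _ _ _ (by lia), zero_comp, zero_add, Cochain.single_v,
          smul_smul, Int.units_mul_self, one_smul]
    · intro p' q' hpq' hp'
      change (x + m.negOnePow • Cochain.single g n).v p' q' hpq' = _
      rw [Cochain.add_v, Cochain.units_smul_v,
        Cochain.single_v_eq_zero _ _ _ _ _ (by lia), smul_zero, add_zero]
  choose φ hφ using step
  let x₀ : X 0 := ⟨u, fun p q hpq hp₀ hp => by
    obtain rfl : p = b := le_antisymm (by simpa using hp) hp₀
    subst hpq
    exact hu⟩
  refine ⟨Cochain.InductionUp.limitSequence φ hφ x₀, ?_, ?_⟩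
  · intro p q hpq hp
    rw [Cochain.InductionUp.limitSequence_eqUpTo φ hφ x₀ 0 p q hpq (by simpa using hp)]
    rfl
  · intro p q hpq hp
    have hk : p ≤ b + (p - b).toNat := by lia
    rw [← (Cochain.InductionUp.sequence φ x₀ (p - b).toNat).2 p q hpq hp hk]
    apply δ_v_congr hnm
    · exact Cochain.InductionUp.limitSequence_eqUpTo φ hφ x₀ _ _ _ _ (by lia)
    · exact Cochain.InductionUp.limitSequence_eqUpTo φ hφ x₀ _ _ _ _ (by lia)

/-- A solution of `δ u = z` in degree `a` extends to all degrees `≤ a` if `L` is exact for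
morphisms from the relevant terms of `K`. -/
lemma exists_δ_eq_down {n m : ℤ} (hnm : n + 1 = m) (z : Cochain K L m) (hz : δ m (m + 1) z = 0)
    (u : Cochain K L n) (a : ℤ)
    (hu : (δ n m u).v a (a + m) rfl = z.v a (a + m) rfl)
    (h : ∀ (p q : ℤ), p < a → p + m = q → ∀ f : K.X p ⟶ L.X q, f ≫ L.d q (q + 1) = 0 →
      ∃ g : K.X p ⟶ L.X (q - 1), g ≫ L.d (q - 1) q = f) :
    ∃ u' : Cochain K L n, (∀ (p q : ℤ) (hpq : p + n = q), a ≤ p → u'.v p q hpq = u.v p q hpq) ∧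
      ∀ (p q : ℤ) (hpq : p + m = q), p ≤ a → (δ n m u').v p q hpq = z.v p q hpq := by
  let X (k : ℕ) (x : Cochain K L n) : Prop :=
    ∀ (p q : ℤ) (hpq : p + m = q), p ≤ a → a - k ≤ p → (δ n m x).v p q hpq = z.v p q hpq
  have step : ∀ (k : ℕ) (x : { x // X k x }), ∃ x' : { x // X (k + 1) x },
      ∀ (p q : ℤ) (hpq : p + n = q), a - k ≤ p → x'.1.v p q hpq = x.1.v p q hpq := by
    rintro k ⟨x, hx⟩
    obtain ⟨p, hp⟩ : ∃ p, p = a - k - 1 := ⟨_, rfl⟩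
    have he : δ m (m + 1) (z - δ n m x) = 0 := by rw [δ_sub, hz, δ_δ, sub_zero]
    obtain ⟨g, hg⟩ := h p (p + m) (by lia) rfl ((z - δ n m x).v p (p + m) rfl)
      (v_comp_d_of_δ_eq_zero he p _ rfl (by
        rw [Cochain.sub_v, hx (p + 1) _ _ (by lia) (by lia), sub_self]))
    -- A correction in degree p changes δx only in degrees p - 1 and p, below the solved range.
    refine ⟨⟨x + Cochain.single g n, ?_⟩, ?_⟩
    · intro p' q' hpq' hp₀ hp'
      rcases hp'.lt_or_eq with hlt | heq
      · rw [← hx p' q' hpq' hp₀ (by push_cast at hlt; lia)]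
        apply δ_v_congr hnm
        · rw [Cochain.add_v, Cochain.single_v_eq_zero _ _ _ _ _ (by push_cast at hlt; lia),
            add_zero]
        · rw [Cochain.add_v, Cochain.single_v_eq_zero _ _ _ _ _ (by push_cast at hlt; lia),
            add_zero]
      · obtain rfl : p' = p := by rw [← heq, hp]; push_cast; ring
        subst hpq'
        rw [δ_add, Cochain.add_v, ← eq_sub_iff_add_eq', ← Cochain.sub_v, ← hg,
          δ_v n m hnm _ p' _ rfl (p' + m - 1) (p' + 1) rfl rfl,
          Cochain.single_v_eq_zero _ _ (p' + 1) _ _ (by lia), comp_zero, smul_zero, add_zero,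
          Cochain.single_v]
    · intro p' q' hpq' hp'
      change (x + Cochain.single g n).v p' q' hpq' = _
      rw [Cochain.add_v, Cochain.single_v_eq_zero _ _ _ _ _ (by lia), add_zero]
  choose φ hφ using step
  let s (k : ℕ) : { x // X k x } :=
    Nat.rec (motive := fun k => { x // X k x }) ⟨u, fun p q hpq hp₀ hp => by
      obtain rfl : p = a := le_antisymm hp₀ (by simpa using hp)
      subst hpq
      exact hu⟩ φ k
  have hs (k j : ℕ) : ∀ (p q : ℤ) (hpq : p + n = q), a - k ≤ p →
      (s (k + j)).1.v p q hpq = (s k).1.v p q hpq := by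
    induction j with
    | zero => exact fun _ _ _ _ => rfl
    | succ j ih =>
      intro p q hpq hp
      exact (hφ (k + j) (s (k + j)) p q hpq (by lia)).trans (ih p q hpq hp)
  -- From stage a - p on, the value in degree p no longer changes.
  let U : Cochain K L n := Cochain.mk fun p q hpq => (s (a - p).toNat).1.v p q hpq
  have hU (k : ℕ) (p q : ℤ) (hpq : p + n = q) (hp : a - k ≤ p) :
      U.v p q hpq = (s k).1.v p q hpq := by
    obtain ⟨j, rfl⟩ := Nat.exists_eq_add_of_le (show (a - p).toNat ≤ k by lia)
    exact (hs _ _ p q hpq (by lia)).symm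
  refine ⟨U, fun p q hpq hp => hU 0 p q hpq (by simpa using hp), ?_⟩
  intro p q hpq hp
  rw [← (s (a - p).toNat).2 p q hpq hp (by lia)]
  apply δ_v_congr hnm
  · exact hU _ _ _ _ (by lia)
  · exact hU _ _ _ _ (by lia)

/-- A solution of `δ u = z` in degrees `a ≤ p ≤ b` extends to all degrees. -/
lemma exists_δ_eq {n m : ℤ} (hnm : n + 1 = m) (z : Cochain K L m) (hz : δ m (m + 1) z = 0)
    (u : Cochain K L n) (a b : ℤ) (hab : a ≤ b)
    (hu : ∀ (p q : ℤ) (hpq : p + m = q), a ≤ p → p ≤ b → (δ n m u).v p q hpq = z.v p q hpq)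
    (h₁ : ∀ (p q : ℤ), b < p → p + m = q → ∀ f : K.X p ⟶ L.X q, K.d (p - 1) p ≫ f = 0 →
      ∃ g : K.X (p + 1) ⟶ L.X q, K.d p (p + 1) ≫ g = f)
    (h₂ : ∀ (p q : ℤ), p < a → p + m = q → ∀ f : K.X p ⟶ L.X q, f ≫ L.d q (q + 1) = 0 →
      ∃ g : K.X p ⟶ L.X (q - 1), g ≫ L.d (q - 1) q = f) :
    ∃ u' : Cochain K L n, (∀ (p q : ℤ) (hpq : p + n = q), a ≤ p → p ≤ b + 1 →
      u'.v p q hpq = u.v p q hpq) ∧ δ n m u' = z := by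
  obtain ⟨u₁, hu₁, hu₁'⟩ := exists_δ_eq_up hnm z hz u b (hu _ _ _ hab le_rfl) h₁
  have hu₂ (p q : ℤ) (hpq : p + m = q) (hp : a ≤ p) : (δ n m u₁).v p q hpq = z.v p q hpq := by
    by_cases hb : b ≤ p
    · exact hu₁' p q hpq hb
    · rw [← hu p q hpq hp (by lia)]
      exact δ_v_congr hnm _ _ _ (hu₁ _ _ _ (by lia)) (hu₁ _ _ _ (by lia))
  obtain ⟨u₃, hu₃, hu₃'⟩ := exists_δ_eq_down hnm z hz u₁ a (hu₂ _ _ _ le_rfl) h₂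
  refine ⟨u₃, fun p q hpq hp hp' => (hu₃ p q hpq hp).trans (hu₁ p q hpq hp'), ?_⟩
  ext p q hpq
  by_cases ha : p ≤ a
  · exact hu₃' p q hpq ha
  · rw [← hu₂ p q hpq (by lia)]
    exact δ_v_congr hnm _ _ _ (hu₃ _ _ _ (by lia)) (hu₃ _ _ _ (by lia))

end Cochain

/-! ### Exactness and coexactness of complexes of finitely generated projective modules -/

section Exactness

variable {R : Type u} [Ring R]

/-- Extensions of morphisms along a resolution of an `Ext(-, Y)`-acyclic module. -/
lemma exists_extension_of_resolution {A : Type u} [Ring A] {Y : ModuleCat.{u} A} (n : ℕ) :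
    ∀ (F : ℕ → ModuleCat.{u} A) (d : ∀ n, F (n + 1) ⟶ F n) (X : ModuleCat.{u} A) (ρ : F 0 ⟶ X)
      (_ : ∀ n, ExtVanishes (F n) Y) (_ : ExtVanishes X Y) (_ : Function.Surjective ρ)
      (_ : Function.Exact (d 0) ρ) (_ : ∀ n, Function.Exact (d (n + 1)) (d n))
      (f : F (n + 1) ⟶ Y) (_ : d (n + 1) ≫ f = 0), ∃ g : F n ⟶ Y, d n ≫ g = f := by
  induction n with
  | zero =>
    intro F d X ρ hF hX hρ h₀ h f hf
    obtain ⟨g, hg⟩ : ∃ g : F 1 ⟶ ModuleCat.of A (LinearMap.ker ρ.hom),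
        IsSES (ModuleCat.ofHom (LinearMap.ker (d 0).hom).subtype) g ∧
        g ≫ ModuleCat.ofHom (LinearMap.ker ρ.hom).subtype = d 0 := by
      refine ⟨ModuleCat.ofHom ((d 0).hom.codRestrict _ fun x => h₀.apply_apply_eq_zero x),
        ⟨Subtype.val_injective, fun x => ⟨fun hx => ⟨⟨x, congrArg Subtype.val hx⟩, rfl⟩, ?_⟩, ?_⟩,
        rfl⟩
      · rintro ⟨⟨y, hy⟩, rfl⟩
        exact Subtype.ext hy
      · rintro ⟨y, hy⟩
        obtain ⟨x, rfl⟩ := (h₀ y).1 hy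
        exact ⟨x, rfl⟩
    -- The map f kills Im d 1 = Ker d 0, so it descends to Im d 0 = Ker ρ; from there Ext¹(X, Y) = 0
    -- extends it to F 0.
    obtain ⟨v, hv⟩ := hg.1.exists_desc f (by
      ext ⟨x, hx⟩
      obtain ⟨y, rfl⟩ := (h 0 x).1 hx
      exact congrArg (fun f : F 2 ⟶ Y => f y) hf)
    have hS : IsSES (ModuleCat.ofHom (LinearMap.ker ρ.hom).subtype) ρ :=
      ⟨Subtype.val_injective, fun x => ⟨fun hx => ⟨⟨x, hx⟩, rfl⟩, by rintro ⟨y, rfl⟩; exact y.2⟩,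
        hρ⟩
    obtain ⟨w, hw⟩ := hS.exists_extension (hX 1 one_pos) v
    exact ⟨w, by rw [← hg.2, Category.assoc, hw, hv]⟩
  | succ n ih =>
    intro F d X ρ hF hX hρ h₀ h f hf
    have hS : IsSES (ModuleCat.ofHom (LinearMap.ker ρ.hom).subtype) ρ :=
      ⟨Subtype.val_injective, fun x => ⟨fun hx => ⟨⟨x, hx⟩, rfl⟩, by rintro ⟨y, rfl⟩; exact y.2⟩,
        hρ⟩
    -- The syzygy Ker ρ is again Ext(-, Y)-acyclic and is resolved by the shifted sequence.
    refine ih (fun n => F (n + 1)) (fun n => d (n + 1)) (ModuleCat.of A (LinearMap.ker ρ.hom))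
      (ModuleCat.ofHom ((d 0).hom.codRestrict _ fun x => h₀.apply_apply_eq_zero x))
      (fun n => hF _) (fun k hk => ?_) ?_ ?_ (fun n => h _) f hf
    · exact hS.subsingleton_ext_left Y k (hF 0 k hk) (hX _ (by lia))
    · rintro ⟨y, hy⟩
      obtain ⟨x, rfl⟩ := (h₀ y).1 hy
      exact ⟨x, rfl⟩
    · intro x
      refine Iff.trans ?_ (h 0 x)
      exact ⟨fun hx => congrArg Subtype.val hx, fun hx => Subtype.ext hx⟩

/-- The complex `K` is exact in degree `i`. -/
def ExactAt (K : CochainComplex (ProjCat R) ℤ) (i : ℤ) : Prop :=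
  Function.Exact (K.d (i - 1) i).hom (K.d i (i + 1)).hom

/-- The complex `K` is exact in degree `i` after applying `Hom(-, P)`, `P` in `proj R`. -/
def CoexactAt (K : CochainComplex (ProjCat R) ℤ) (i : ℤ) : Prop :=
  ∀ ⦃P : ProjCat R⦄ (f : K.X i ⟶ P), K.d (i - 1) i ≫ f = 0 →
    ∃ g : K.X (i + 1) ⟶ P, K.d i (i + 1) ≫ g = f

variable {K : CochainComplex (ProjCat R) ℤ}

/-- Free indices with equations between them allow use at concrete degrees without transporting
terms of the complex. -/
lemma ExactAt.exact {j : ℤ} (h : ExactAt K j) {i k : ℤ} (hi : i + 1 = j) (hk : j + 1 = k) :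
    Function.Exact (K.d i j).hom (K.d j k).hom := by
  obtain rfl : i = j - 1 := by lia
  subst hk
  exact h

lemma exactAt_of_exact {i j k : ℤ} (hi : i + 1 = j) (hk : j + 1 = k)
    (h : Function.Exact (K.d i j).hom (K.d j k).hom) : ExactAt K j := by
  obtain rfl : i = j - 1 := by lia
  subst hk
  exact h

lemma exactAt_of_d_eq {i j k : ℤ} (hi : i + 1 = j) (hk : j + 1 = k) {f : K.X i ⟶ K.X j}
    {g : K.X j ⟶ K.X k} (hf : K.d i j = f) (hg : K.d j k = g) (h : Function.Exact f.hom g.hom) :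
    ExactAt K j := by
  subst hf hg
  exact exactAt_of_exact hi hk h

lemma CoexactAt.exists_factor {j : ℤ} (h : CoexactAt K j) {i k : ℤ} (hi : i + 1 = j)
    (hk : j + 1 = k) {P : ProjCat R} (f : K.X j ⟶ P) (hf : K.d i j ≫ f = 0) :
    ∃ g : K.X k ⟶ P, K.d j k ≫ g = f := by
  obtain rfl : i = j - 1 := by lia
  subst hk
  exact h f hf

/-- Morphisms from a projective module lift along surjections. -/
lemma exists_lift_of_surjective {P M N : RMod R} (hP : isFGProj R P) (p : M ⟶ N)
    (hp : Function.Surjective p) (f : P ⟶ N) : ∃ g : P ⟶ M, g ≫ p = f := by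
  have := hP.2
  obtain ⟨g, hg⟩ := Module.projective_lifting_property p.hom f.hom hp
  exact ⟨ModuleCat.ofHom g, ModuleCat.hom_ext hg⟩

/-- Morphisms from a projective module lift along exact sequences. -/
lemma exists_lift_of_exact {P L M N : RMod R} (hP : isFGProj R P) (p : L ⟶ M) (q : M ⟶ N)
    (h : Function.Exact p q) (f : P ⟶ M) (hf : f ≫ q = 0) : ∃ g : P ⟶ L, g ≫ p = f := by
  obtain ⟨g, hg⟩ := exists_lift_of_surjective hP
    (ModuleCat.ofHom (p.hom.codRestrict (LinearMap.ker q.hom) fun x => h.apply_apply_eq_zero x))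
    (by
      rintro ⟨y, hy⟩
      obtain ⟨x, rfl⟩ := (h y).1 hy
      exact ⟨x, rfl⟩)
    (ModuleCat.ofHom (f.hom.codRestrict (LinearMap.ker q.hom) fun x =>
      congrArg (fun f : P ⟶ N => f x) hf))
  refine ⟨g, ?_⟩
  ext x
  exact congrArg Subtype.val (congrArg (fun f : P ⟶ ModuleCat.of Rᵐᵒᵖ (LinearMap.ker q.hom) => f x)
    hg)

lemma ExactAt.exists_lift {j : ℤ} (h : ExactAt K j) {i k : ℤ} (hi : i + 1 = j)
    (hk : j + 1 = k) {P : ProjCat R} (f : P ⟶ K.X j) (hf : f ≫ K.d j k = 0) :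
    ∃ g : P ⟶ K.X i, g ≫ K.d i j = f := by
  obtain ⟨g, hg⟩ := exists_lift_of_exact P.property _ _ (h.exact hi hk) f.hom
    (congrArg (fun f => f.hom) hf)
  exact ⟨ObjectProperty.homMk g, by ext1; exact hg⟩

/-- Coexactness may be tested on `R`. -/
lemma coexactAt_of_regular {j : ℤ} (h : ∀ f : (K.X j).obj ⟶ rightRegular R,
      (K.d (j - 1) j).hom ≫ f = 0 → ∃ g : (K.X (j + 1)).obj ⟶ rightRegular R,
        (K.d j (j + 1)).hom ≫ g = f) : CoexactAt K j := by
  intro P f hf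
  obtain ⟨ψ, hψ⟩ := exists_factorization_of_regular P.property (K.d j (j + 1)).hom f.hom (by
    rintro _ ⟨a, rfl⟩
    refine h _ ?_
    have hf' : (K.d (j - 1) j).hom ≫ f.hom = 0 := congrArg (fun f => f.hom) hf
    rw [← Category.assoc, hf', zero_comp])
  exact ⟨ObjectProperty.homMk ψ, by ext1; exact hψ⟩

lemma extVanishes_of_isFGProj {P : RMod R} (hP : isFGProj R P) (Y : RMod R) : ExtVanishes P Y := by
  have := hP.2
  exact extVanishes_of_projective Y

variable (K) in
lemma d_hom_comp_d_hom (i j k : ℤ) : (K.d i j).hom ≫ (K.d j k).hom = 0 :=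
  congrArg (fun f => f.hom) (K.d_comp_d i j k)

/-- If `R` has finite injective dimension as a right module, sufficiently long exact complexes are
coexact. -/
lemma coexactAt_of_exactAt {e : ℕ} [HasInjectiveDimensionLE (rightRegular R) e] (i : ℤ)
    (h : ∀ j, i ≤ j → j ≤ i + e + 2 → ExactAt K j) : CoexactAt K i := by
  refine coexactAt_of_regular fun f hf => ?_
  have h' := exists_extension_of_exact (e := e) (fun n => (K.X (i + n)).obj)
    (fun n => (K.d (i + n) (i + (n + 1 : ℕ))).hom)
    (fun n => extVanishes_of_isFGProj (K.X (i + n)).property _)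
    (fun n hn => (h (i + (n + 1 : ℕ)) (by lia) (by push_cast; lia)).exact (by push_cast; ring)
      (by push_cast; ring))
    (Y := rightRegular R)
  dsimp only at h'
  -- The type of `f` depends on the degree, so `i + 0` is replaced by a variable before it is
  -- identified with `i`.
  generalize hi : i + 0 = i' at h'
  obtain rfl : i' = i := by lia
  refine h' f fun x hx => ?_
  obtain ⟨y, rfl⟩ := (h i' le_rfl (by lia) x).1 hx
  exact congrArg (fun f : (K.X (i' - 1)).obj ⟶ rightRegular R => f y) hf

/-- If `R` has finite injective dimension as a left module, complexes that are coexact in all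
degrees `≤ i` are exact in degree `i`. -/
lemma exactAt_of_coexactAt {e : ℕ} [HasInjectiveDimensionLE (ModuleCat.of R R) e] (i : ℤ)
    (h : ∀ j ≤ i, CoexactAt K j) : ExactAt K i := by
  -- Indexing downwards from i + 1 turns exactness of K in degree i into exactness at the term with
  -- index 1.
  have h' := exact_of_dual_exact (e := e) (fun n => (K.X (i + 1 - n)).obj)
    (fun n => (K.X (i + 1 - n)).property)
    (fun n => (K.d (i + 1 - (n + 1 : ℕ)) (i + 1 - n)).hom) (fun n => d_hom_comp_d_hom K _ _ _) (by
      intro n φ hφ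
      obtain ⟨ψ, hψ⟩ := (h (i + 1 - (n + 1 : ℕ)) (by push_cast; lia)).exists_factor
        (i := i + 1 - (n + 1 + 1 : ℕ)) (k := i + 1 - n) (by push_cast; lia) (by push_cast; lia)
        (P := ⟨rightRegular R, isFGProj_rightRegular R⟩) (ObjectProperty.homMk φ) (by ext1; exact hφ)
      exact ⟨ψ.hom, congrArg (fun f => f.hom) hψ⟩)
  generalize hj : i + 1 - ((0 + 1 : ℕ) : ℤ) = j at h'
  obtain rfl : j = i := by push_cast at hj; lia
  exact exactAt_of_exact (by push_cast; lia) (by push_cast; lia) h'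

end Exactness

namespace MorE

/-! ### Gluings and lifts of morphisms -/

section Gluing

variable {R : Type u} [Ring R]

lemma w {α β : MorE R} (f : α ⟶ β) : onSrc f ≫ β.arr = α.arr ≫ onTgt f := Arrow.w f.hom

/-- Constructor for morphisms of `Mor^e(CM R)`. -/
def mkHom {α β : MorE R} (a : α.src ⟶ β.src) (b : α.tgt ⟶ β.tgt) (h : a ≫ β.arr = α.arr ≫ b) :
    α ⟶ β :=
  ObjectProperty.homMk (Arrow.homMk a b h)

lemma extVanishes_src (α : MorE R) : ExtVanishes α.src (rightRegular R) := α.property.1.2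

lemma extVanishes_tgt (α : MorE R) : ExtVanishes α.tgt (rightRegular R) := α.property.2.1.2

lemma arr_surj (α : MorE R) : Function.Surjective α.arr := α.property.2.2

variable {α : MorE R} (A : Gluing α)

namespace Gluing

/-- In degree 1, where the two halves meet, `ρ` and `α` are onto, so the image of d⁰ is the image of
`ε`. The cohomology in the excluded degree 0 is Ker α. -/
lemma exactAt (i : ℤ) (hi : i ≠ 0) : ExactAt A.cplx i := by
  rcases lt_trichotomy i 1 with h | rfl | h
  · exact A.exact_neg i (by lia)
  · refine exactAt_of_exact (i := 0) (k := 2) rfl rfl ?_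
    rw [A.d_zero_one]
    intro x
    refine (A.exact_one x).trans ⟨?_, ?_⟩
    · rintro ⟨t, rfl⟩
      obtain ⟨y, rfl⟩ := (α.arr_surj.comp A.ρ_surj) t
      exact ⟨y, rfl⟩
    · rintro ⟨y, rfl⟩
      exact ⟨_, rfl⟩
  · exact A.exact_pos i h

/-- In negative degrees the complex resolves X, and Ext(X, R) = 0. In positive degrees it is exact
indefinitely to the right, so finite right injective dimension applies. -/
lemma coexactAt (hR : IsIwanagaGorenstein R) (i : ℤ) (hi : i ≠ 0) : CoexactAt A.cplx i := by
  rcases hi.lt_or_gt with h | h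
  · refine coexactAt_of_regular ?_
    obtain ⟨n, rfl⟩ : ∃ n : ℕ, i = -(n + 1 : ℕ) := ⟨(-i - 1).toNat, by lia⟩
    intro f hf
    have h₀ : Function.Exact (A.cplx.d (-(0 + 1 : ℕ)) (-(0 : ℕ))).hom A.ρ := A.exact_zero
    obtain ⟨g, hg⟩ := exists_extension_of_resolution n (fun n => (A.cplx.X (-n)).obj)
      (fun n => (A.cplx.d (-(n + 1 : ℕ)) (-n)).hom) α.src A.ρ
      (fun n => extVanishes_of_isFGProj (A.cplx.X (-n)).property _) α.extVanishes_src A.ρ_surj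
      h₀ (fun n => (A.exactAt (-(n + 1 : ℕ)) (by lia)).exact (by push_cast; ring)
        (by push_cast; ring)) f (by
          have : -((n + 1 : ℕ) : ℤ) - 1 = -((n + 1 + 1 : ℕ) : ℤ) := by push_cast; ring
          rwa [this] at hf)
    have : -((n + 1 : ℕ) : ℤ) + 1 = -(n : ℤ) := by push_cast; ring
    rw [this]
    exact ⟨g, hg⟩
  · obtain ⟨e, _⟩ := hR.right_idim
    exact coexactAt_of_exactAt (e := e) i fun j hj _ => A.exactAt j (by lia)

lemma exists_lift_ρ {P : ProjCat R} (f : P.obj ⟶ α.src) :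
    ∃ g : P ⟶ A.cplx.X 0, g.hom ≫ A.ρ = f := by
  obtain ⟨g, hg⟩ := exists_lift_of_surjective P.property A.ρ A.ρ_surj f
  exact ⟨ObjectProperty.homMk g, hg⟩

lemma exists_lift_zero {P : ProjCat R} (f : P ⟶ A.cplx.X 0) (hf : f.hom ≫ A.ρ = 0) :
    ∃ g : P ⟶ A.cplx.X (-1), g ≫ A.cplx.d (-1) 0 = f := by
  obtain ⟨g, hg⟩ := exists_lift_of_exact P.property _ _ A.exact_zero f.hom hf
  exact ⟨ObjectProperty.homMk g, by ext1; exact hg⟩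

/-- The sequence T ⟶ F¹ ⟶ F² ⟶ ⋯ is an exact sequence of Ext(-, R)-acyclic modules, injective at its
start, so finite right injective dimension extends maps out of T. -/
lemma exists_extension_ε (hR : IsIwanagaGorenstein R) {P : ProjCat R} (f : α.tgt ⟶ P.obj) :
    ∃ g : A.cplx.X 1 ⟶ P, A.ε ≫ g.hom = f := by
  obtain ⟨ψ, hψ⟩ := exists_factorization_of_regular P.property A.ε f (by
    rintro f' -
    obtain ⟨e, _⟩ := hR.right_idim
    let E : ℕ → RMod R := fun n => match n with
      | 0 => α.tgt
      | n + 1 => (A.cplx.X (n + 1 : ℕ)).obj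
    let d : ∀ n, E n ⟶ E (n + 1) := fun n => match n with
      | 0 => A.ε
      | n + 1 => (A.cplx.d (n + 1 : ℕ) (n + 1 + 1 : ℕ)).hom
    refine exists_extension_of_exact (e := e) E d ?_ ?_ f' ?_
    · rintro (_ | n)
      · exact α.extVanishes_tgt
      · exact extVanishes_of_isFGProj (A.cplx.X (n + 1 : ℕ)).property _
    · rintro (_ | n) _
      · exact A.exact_one
      · exact (A.exactAt (n + 1 + 1 : ℕ) (by lia)).exact (by push_cast; ring) (by push_cast; ring)
    · intro x hx
      obtain rfl : x = 0 := A.ε_inj (by rw [map_zero]; exact hx)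
      exact map_zero _)
  exact ⟨ObjectProperty.homMk ψ, hψ⟩

lemma exists_extension_one (hR : IsIwanagaGorenstein R) {P : ProjCat R} (f : A.cplx.X 1 ⟶ P)
    (hf : A.ε ≫ f.hom = 0) : ∃ g : A.cplx.X 2 ⟶ P, A.cplx.d 1 2 ≫ g = f := by
  refine (A.coexactAt hR 1 one_ne_zero).exists_factor (i := 0) rfl rfl f ?_
  ext1
  change (A.cplx.d 0 1).hom ≫ f.hom = 0
  rw [A.d_zero_one, Category.assoc, Category.assoc, hf, comp_zero, comp_zero]

lemma d_comp_ρ : (A.cplx.d (-1) 0).hom ≫ A.ρ = 0 := by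
  ext x
  exact A.exact_zero.apply_apply_eq_zero x

lemma ε_comp_d : A.ε ≫ (A.cplx.d 1 2).hom = 0 := by
  ext x
  exact A.exact_one.apply_apply_eq_zero x

end Gluing

end Gluing

end MorE

namespace MorE

open CochainComplex.HomComplex

section Lift

variable {R : Type u} [Ring R]

/-- Extending solutions of `δ u = z` between gluings. -/
lemma Gluing.exists_δ_eq (hR : IsIwanagaGorenstein R) {α β : MorE R} (A : Gluing α) (B : Gluing β)
    {n m : ℤ} (hnm : n + 1 = m) (hm : 0 ≤ m) (z : Cochain A.cplx B.cplx m)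
    (hz : δ m (m + 1) z = 0) (u : Cochain A.cplx B.cplx n)
    (hu : ∀ (p q : ℤ) (hpq : p + m = q), -m < p → p < 1 → (δ n m u).v p q hpq = z.v p q hpq)
    (hρ : ((z - δ n m u).v (-m) 0 (by lia)).hom ≫ B.ρ = 0)
    (hε : A.ε ≫ ((z - δ n m u).v 1 (1 + m) rfl).hom = 0) :
    ∃ u' : Cochain A.cplx B.cplx n, (∀ (p q : ℤ) (hpq : p + n = q), -m < p → p ≤ 1 →
      u'.v p q hpq = u.v p q hpq) ∧ δ n m u' = z := by
  -- The induction downwards needs B exact in negative degrees and the one upwards needs A coexact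
  -- in degrees > 1, which is automatic. At the two edges the error is removed by hand: into degree
  -- 0 of B it lifts to B⁻¹ because `ρ` kills it, and out of degree 1 of A it extends to A² because
  -- it vanishes on `ε`.
  obtain ⟨g, hg⟩ := B.exists_lift_zero _ hρ
  obtain ⟨h, hh⟩ := A.exists_extension_one hR _ hε
  let u₁ : Cochain A.cplx B.cplx n := u + Cochain.single g n + m.negOnePow • Cochain.single h n
  have hu₁ (p q : ℤ) (hpq : p + n = q) (h₁ : p ≠ -m) (h₂ : p ≠ 2) :
      u₁.v p q hpq = u.v p q hpq := by
    dsimp only [u₁]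
    rw [Cochain.add_v, Cochain.add_v, Cochain.units_smul_v, Cochain.single_v_eq_zero g _ _ _ _ h₁,
      Cochain.single_v_eq_zero h _ _ _ _ h₂, smul_zero, add_zero, add_zero]
  obtain ⟨u₂, hu₂, hu₂'⟩ := IwanagaGorenstein.exists_δ_eq hnm z hz u₁ (-m) 1 (by lia) (by
    intro p q hpq hp hp'
    rcases hp.eq_or_lt with rfl | hp
    · obtain rfl : q = 0 := by lia
      dsimp only [u₁]
      rw [δ_add, δ_add, Cochain.add_v, Cochain.add_v, add_assoc, ← eq_sub_iff_add_eq',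
        ← Cochain.sub_v, ← hg, δ_units_smul, Cochain.units_smul_v,
        δ_v n m hnm _ (-m) 0 hpq (-1) (-m + 1) rfl rfl,
        δ_v n m hnm _ (-m) 0 hpq (-1) (-m + 1) rfl rfl, Cochain.single_v,
        Cochain.single_v_eq_zero g n (-m + 1) _ _ (by lia),
        Cochain.single_v_eq_zero h n (-m + 1) _ _ (by lia),
        Cochain.single_v_eq_zero h n (-m) _ _ (by lia)]
      simp
    · rcases hp'.eq_or_lt with rfl | hp'
      · subst hpq
        dsimp only [u₁]
        rw [δ_add, δ_add, Cochain.add_v, Cochain.add_v, add_assoc, ← eq_sub_iff_add_eq',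
          ← Cochain.sub_v, ← hh, δ_units_smul, Cochain.units_smul_v,
          δ_v n m hnm _ 1 (1 + m) rfl m 2 (by lia) rfl,
          δ_v n m hnm _ 1 (1 + m) rfl m 2 (by lia) rfl, Cochain.single_v,
          Cochain.single_v_eq_zero g n 1 _ _ (by lia),
          Cochain.single_v_eq_zero g n 2 _ _ (by lia),
          Cochain.single_v_eq_zero h n 1 _ _ (by lia), zero_comp, comp_zero, smul_zero, add_zero,
          zero_add, zero_add, smul_smul, Int.units_mul_self, one_smul]
      · rw [← hu p q hpq hp hp']
        exact δ_v_congr hnm _ _ _ (hu₁ _ _ _ (by lia) (by lia)) (hu₁ _ _ _ (by lia) (by lia)))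
    (fun p q hp _ f hf => A.coexactAt hR p (by lia) f hf)
    (fun p q hp hpq f hf => (B.exactAt q (by lia)).exists_lift (by lia) rfl f hf)
  exact ⟨u₂, fun p q hpq hp hp' => (hu₂ p q hpq hp.le (by lia)).trans
    (hu₁ p q hpq (by lia) (by lia)), hu₂'⟩

variable {α β : MorE R} (A : Gluing α) (B : Gluing β)

/-- A chain map is a 0-cochain with δu = 0. Its components in degrees 0 and 1 are chosen first, by
projectivity along `ρ` and by extension along `ε`. They commute with d⁰ because f is a commutative
square, and the other degrees are filled in by `Gluing.exists_δ_eq`. -/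
lemma Gluing.exists_isLift (hR : IsIwanagaGorenstein R) (f : α ⟶ β) :
    ∃ φ : A.cplx ⟶ B.cplx, A.IsLift B f φ := by
  obtain ⟨a, ha⟩ := B.exists_lift_ρ (P := A.cplx.X 0) (A.ρ ≫ onSrc f)
  obtain ⟨b, hb⟩ := A.exists_extension_ε hR (P := B.cplx.X 1) (onTgt f ≫ B.ε)
  have hab : a ≫ B.cplx.d 0 1 = A.cplx.d 0 1 ≫ b := by
    ext1
    change a.hom ≫ (B.cplx.d 0 1).hom = (A.cplx.d 0 1).hom ≫ b.hom
    rw [A.d_zero_one, B.d_zero_one, reassoc_of% ha, Category.assoc, Category.assoc, hb,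
      reassoc_of% (w f)]
  let u : Cochain A.cplx B.cplx 0 := Cochain.single a 0 + Cochain.single b 0
  have h₀ : u.v 0 0 rfl = a := by
    dsimp only [u]
    rw [Cochain.add_v, Cochain.single_v, Cochain.single_v_eq_zero b _ _ _ _ (by lia), add_zero]
  have h₁ : u.v 1 1 rfl = b := by
    dsimp only [u]
    rw [Cochain.add_v, Cochain.single_v, Cochain.single_v_eq_zero a _ _ _ _ (by lia), zero_add]
  have h₂ (p q : ℤ) (hpq : p + 0 = q) (h : p ≠ 0) (h' : p ≠ 1) : u.v p q hpq = 0 := by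
    dsimp only [u]
    rw [Cochain.add_v, Cochain.single_v_eq_zero a _ _ _ _ h, Cochain.single_v_eq_zero b _ _ _ _ h',
      add_zero]
  obtain ⟨φ, hφ, hφ'⟩ := A.exists_δ_eq hR B (zero_add 1) zero_le_one 0 (by simp) u (by
    intro p q hpq hp hp'
    obtain rfl : p = 0 := by lia
    obtain rfl : q = 1 := by lia
    rw [δ_v 0 1 rfl u 0 1 rfl 0 1 rfl rfl, h₀, h₁, Cochain.zero_v, hab]
    simp) (by
    rw [zero_sub, Cochain.neg_v, δ_v 0 1 rfl u (-1) 0 rfl (-1) 0 rfl rfl, h₀,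
      h₂ (-1) _ _ (by lia) (by lia)]
    have : (A.cplx.d (-1) 0 ≫ a).hom ≫ B.ρ = 0 := by
      change ((A.cplx.d (-1) 0).hom ≫ a.hom) ≫ B.ρ = 0
      rw [Category.assoc, ha, reassoc_of% A.d_comp_ρ, zero_comp]
    simpa using this) (by
    rw [zero_sub, Cochain.neg_v, δ_v 0 1 rfl u 1 (1 + 1) rfl 1 2 rfl rfl, h₁,
      h₂ 2 _ _ (by lia) (by lia)]
    have : A.ε ≫ (b ≫ B.cplx.d 1 2).hom = 0 := by
      change A.ε ≫ b.hom ≫ (B.cplx.d 1 2).hom = 0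
      rw [reassoc_of% hb, B.ε_comp_d, comp_zero]
    rw [comp_zero, smul_zero, add_zero]
    change A.ε ≫ (-(b ≫ B.cplx.d 1 2).hom) = 0
    rw [Preadditive.comp_neg, this, neg_zero])
  refine ⟨Cocycle.homOf (Cocycle.mk φ 1 rfl hφ'), ?_, ?_⟩
  · have : (Cocycle.homOf (Cocycle.mk φ 1 rfl hφ')).f 0 = a :=
      (hφ 0 0 rfl (by lia) (by lia)).trans h₀
    rw [this, ha]
  · have : (Cocycle.homOf (Cocycle.mk φ 1 rfl hφ')).f 1 = b :=
      (hφ 1 1 rfl (by lia) (by lia)).trans h₁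
    rw [this, hb]

/-- Lifts of `0` are homotopic to zero. -/
lemma Gluing.quotient_map_eq_zero (hR : IsIwanagaGorenstein R) (φ : A.cplx ⟶ B.cplx)
    (hφ : A.IsLift B 0 φ) : (HomotopyCategory.quotient (ProjCat R) (.up ℤ)).map φ = 0 := by
  -- For m = 0 no degree lies strictly between the edges. The edge conditions for the zero homotopy
  -- say exactly that φ lifts 0.
  obtain ⟨u, -, hu⟩ := A.exists_δ_eq hR B (neg_add_cancel 1) le_rfl (Cochain.ofHom φ) (by simp) 0
    (by intro p q _ _ _; lia) (by
      simp only [δ_zero, sub_zero]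
      exact hφ.src.trans comp_zero) (by
      simp only [δ_zero, sub_zero]
      exact hφ.tgt.trans zero_comp)
  rw [← (HomotopyCategory.quotient (ProjCat R) (.up ℤ)).map_zero]
  exact HomotopyCategory.eq_of_homotopy _ _
    ((Cochain.equivHomotopy φ 0).symm ⟨u, by simp [hu]⟩)

lemma Gluing.IsLift.sub {f g : α ⟶ β} {φ ψ : A.cplx ⟶ B.cplx} (hφ : A.IsLift B f φ)
    (hψ : A.IsLift B g ψ) : A.IsLift B (f - g) (φ - ψ) where
  src := by
    change ((φ.f 0).hom - (ψ.f 0).hom) ≫ B.ρ = A.ρ ≫ (onSrc f - onSrc g)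
    rw [Preadditive.sub_comp, Preadditive.comp_sub, hφ.src, hψ.src]
  tgt := by
    change A.ε ≫ ((φ.f 1).hom - (ψ.f 1).hom) = (onTgt f - onTgt g) ≫ B.ε
    rw [Preadditive.sub_comp, Preadditive.comp_sub, hφ.tgt, hψ.tgt]

lemma Gluing.IsLift.comp {γ : MorE R} {C : Gluing γ} {f : α ⟶ β} {g : β ⟶ γ}
    {φ : A.cplx ⟶ B.cplx} {ψ : B.cplx ⟶ C.cplx} (hφ : A.IsLift B f φ) (hψ : B.IsLift C g ψ) :
    A.IsLift C (f ≫ g) (φ ≫ ψ) where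
  src := by
    change ((φ.f 0).hom ≫ (ψ.f 0).hom) ≫ C.ρ = A.ρ ≫ onSrc f ≫ onSrc g
    rw [Category.assoc, hψ.src, reassoc_of% hφ.src]
  tgt := by
    change A.ε ≫ (φ.f 1).hom ≫ (ψ.f 1).hom = (onTgt f ≫ onTgt g) ≫ C.ε
    rw [Category.assoc, ← hψ.tgt, reassoc_of% hφ.tgt]

lemma Gluing.isLift_id : A.IsLift A (𝟙 α) (𝟙 A.cplx) where
  src := (Category.id_comp _).trans (Category.comp_id _).symm
  tgt := (Category.comp_id _).trans (Category.id_comp _).symm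

variable {A B} in
lemma Gluing.IsLift.quotient_map_eq (hR : IsIwanagaGorenstein R) {f : α ⟶ β}
    {φ ψ : A.cplx ⟶ B.cplx} (hφ : A.IsLift B f φ) (hψ : A.IsLift B f ψ) :
    (HomotopyCategory.quotient (ProjCat R) (.up ℤ)).map φ =
      (HomotopyCategory.quotient (ProjCat R) (.up ℤ)).map ψ := by
  rw [← sub_eq_zero, ← Functor.map_sub]
  exact A.quotient_map_eq_zero B hR _ (by simpa using hφ.sub A B hψ)

end Lift

end MorE

/-! ### Cohen-Macaulay modules -/

section CM

variable {R : Type u} [Ring R]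

lemma isCM_of_isFGProj {P : RMod R} (hP : isFGProj R P) : isCM R P := by
  have := hP.1
  have := hP.2
  exact ⟨Module.finitePresentation_of_projective Rᵐᵒᵖ P, extVanishes_of_isFGProj hP _⟩

lemma IsIwanagaGorenstein.finite_ker (hR : IsIwanagaGorenstein R) {M N : RMod R}
    [Module.Finite Rᵐᵒᵖ M] (f : M ⟶ N) : Module.Finite Rᵐᵒᵖ (LinearMap.ker f.hom) := by
  have := hR.right_noetherian
  infer_instance

lemma IsIwanagaGorenstein.finitePresentation (hR : IsIwanagaGorenstein R) (M : Type u)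
    [AddCommGroup M] [Module Rᵐᵒᵖ M] [Module.Finite Rᵐᵒᵖ M] :
    Module.FinitePresentation Rᵐᵒᵖ M := by
  have := hR.right_noetherian
  exact Module.finitePresentation_of_finite Rᵐᵒᵖ M

lemma isCM.finite {X : RMod R} (hX : isCM R X) : Module.Finite Rᵐᵒᵖ X := by
  have := hX.1
  infer_instance

lemma isCM_left (hR : IsIwanagaGorenstein R) {M N P : RMod R} {f : M ⟶ N} {g : N ⟶ P}
    (h : IsSES f g) (hN : isCM R N) (hP : isCM R P) : isCM R M := by
  have := hR.right_noetherian
  have := hN.finite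
  have : Module.Finite Rᵐᵒᵖ M := Module.Finite.of_injective f.hom h.inj
  exact ⟨hR.finitePresentation M, fun k hk =>
    h.subsingleton_ext_left _ k (hN.2 k hk) (hP.2 _ (by lia))⟩

lemma isCM_middle (hR : IsIwanagaGorenstein R) {M N P : RMod R} {f : M ⟶ N} {g : N ⟶ P}
    (h : IsSES f g) (hM : isCM R M) (hP : isCM R P) : isCM R N := by
  have := hM.finite
  have := hP.finite
  have := hR.right_noetherian
  have : IsNoetherian Rᵐᵒᵖ N := isNoetherian_of_range_eq_ker f.hom g.hom
    (LinearMap.exact_iff.1 h.exact).symm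
  exact ⟨hR.finitePresentation N, fun k hk =>
    h.subsingleton_ext_middle _ k (hM.2 k hk) (hP.2 k hk)⟩

/-- Higher extensions vanish by the long exact sequence; only Ext¹ of the quotient needs the
extension property `hf`. -/
lemma isCM_right (hR : IsIwanagaGorenstein R) {M N P : RMod R} {f : M ⟶ N} {g : N ⟶ P}
    (h : IsSES f g) (hM : isCM R M) (hN : isCM R N)
    (hf : ∀ u : M ⟶ rightRegular R, ∃ v : N ⟶ rightRegular R, f ≫ v = u) : isCM R P := by
  have := hN.finite
  have : Module.Finite Rᵐᵒᵖ P := Module.Finite.of_surjective g.hom h.surj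
  refine ⟨hR.finitePresentation P, fun k hk => ?_⟩
  obtain _ | _ | k := k
  · omega
  · exact h.subsingleton_ext_one (hN.2 1 one_pos) hf
  · exact h.subsingleton_ext_right _ _ (hM.2 _ (by lia)) (hN.2 _ (by lia))

/-- Morphisms from Cohen-Macaulay modules to projective modules extend along admissible
monomorphisms. -/
lemma exists_extension_of_isCM {M N P Q : RMod R} {f : M ⟶ N} {g : N ⟶ P}
    (h : IsSES f g) (hP : isCM R P) (hQ : isFGProj R Q) (u : M ⟶ Q) : ∃ v : N ⟶ Q, f ≫ v = u :=
  exists_factorization_of_regular hQ f u fun w _ => h.exists_extension (hP.2 1 one_pos) w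

lemma isSES_ker {M N : RMod R} (f : M ⟶ N) (hf : Function.Surjective f) :
    IsSES (ModuleCat.ofHom (LinearMap.ker f.hom).subtype) f :=
  ⟨Subtype.val_injective, fun x => ⟨fun hx => ⟨⟨x, hx⟩, rfl⟩, by rintro ⟨y, rfl⟩; exact y.2⟩, hf⟩

lemma isSES_coker {M N : RMod R} (f : M ⟶ N) (hf : Function.Injective f) :
    IsSES f (ModuleCat.ofHom (LinearMap.range f.hom).mkQ) :=
  ⟨hf, fun _ => (Submodule.Quotient.mk_eq_zero _).trans ⟨fun ⟨y, h⟩ => ⟨y, h⟩, fun ⟨y, h⟩ => ⟨y, h⟩⟩,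
    Submodule.mkQ_surjective _⟩

/-- A Cohen-Macaulay module is the quotient of a projective module by a Cohen-Macaulay module. -/
lemma exists_syzygy (hR : IsIwanagaGorenstein R) (X : RMod R) (hX : isCM R X) :
    ∃ (Y P : RMod R) (i : Y ⟶ P) (p : P ⟶ X), isCM R Y ∧ isFGProj R P ∧ IsSES i p := by
  have := hX.finite
  obtain ⟨P, p, hP, hp⟩ := exists_cover X
  exact ⟨_, P, _, p, isCM_left hR (isSES_ker p hp) (isCM_of_isFGProj hP) hX, hP, isSES_ker p hp⟩

/-- A resolution of a Cohen-Macaulay module by projective modules. -/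
lemma exists_resolution (hR : IsIwanagaGorenstein R) (X : RMod R) (hX : isCM R X) :
    ∃ (F : ℕ → RMod R) (d : ∀ n, F (n + 1) ⟶ F n) (ρ : F 0 ⟶ X), (∀ n, isFGProj R (F n)) ∧
      Function.Surjective ρ ∧ Function.Exact (d 0) ρ ∧ ∀ n, Function.Exact (d (n + 1)) (d n) := by
  choose Y P i p hY hP hS using fun X : { X : RMod R // isCM R X } => exists_syzygy hR X.1 X.2
  let M : ℕ → { X : RMod R // isCM R X } := Nat.rec ⟨X, hX⟩ fun _ Z => ⟨Y Z, hY Z⟩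
  have key (n : ℕ) : Function.Exact (p (M (n + 1)) ≫ i (M n)) (p (M n)) := by
    intro x
    refine ((hS (M n)).exact x).trans ⟨?_, ?_⟩
    · rintro ⟨y, rfl⟩
      obtain ⟨z, rfl⟩ := (hS (M (n + 1))).surj y
      exact ⟨z, rfl⟩
    · rintro ⟨z, rfl⟩
      exact ⟨_, rfl⟩
  refine ⟨fun n => P (M n), fun n => p (M (n + 1)) ≫ i (M n), p (M 0), fun n => hP _,
    (hS (M 0)).surj, key 0, fun n x => Iff.trans ?_ (key (n + 1) x)⟩
  exact ⟨fun h => (hS (M n)).inj (h.trans (map_zero _).symm),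
    fun h => (congrArg (i (M n)) h).trans (map_zero _)⟩

/-- A Cohen-Macaulay module embeds into a projective module with Cohen-Macaulay cokernel. -/
lemma exists_cosyzygy (hR : IsIwanagaGorenstein R) (X : RMod R) (hX : isCM R X) :
    ∃ (P Y : RMod R) (i : X ⟶ P) (p : P ⟶ Y), isFGProj R P ∧ isCM R Y ∧ IsSES i p := by
  have := hX.finite
  have := hR.left_noetherian
  obtain ⟨e, _⟩ := hR.left_idim
  obtain ⟨P, u, hP, hu⟩ := exists_left_approximation X
  obtain ⟨F, d, ρ, hF, hρ, h₀, hd⟩ := exists_resolution hR X hX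
  have hu' (v : X ⟶ rightRegular R) := hu _ (isFGProj_rightRegular R) v
  have hinj : Function.Injective u := by
    -- The resolution of X followed by `u` has an exact dual: functionals on F 0 that kill Im d 0
    -- live on X, and these factor through the approximation `u`. Hence the sequence itself is
    -- exact, so Ker(ρ ≫ u) = Ker ρ and `u` is injective.
    let F' : ℕ → RMod R := fun n => match n with
      | 0 => P
      | n + 1 => F n
    let d' : ∀ n, F' (n + 1) ⟶ F' n := fun n => match n with
      | 0 => ρ ≫ u
      | n + 1 => d n
    have hex : Function.Exact (d 0) (ρ ≫ u) := by
      refine exact_of_dual_exact (e := e) F' ?_ d' ?_ ?_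
      · rintro (_ | n)
        · exact hP
        · exact hF n
      · rintro (_ | n)
        · ext x
          change u (ρ (d 0 x)) = 0
          rw [h₀.apply_apply_eq_zero, map_zero]
        · ext x
          exact (hd n).apply_apply_eq_zero x
      · rintro (_ | n) φ hφ
        · obtain ⟨v, hv⟩ := MorE.exists_desc_module (d 0) ρ h₀ hρ φ hφ
          obtain ⟨w, rfl⟩ := hu' v
          exact ⟨w, (Category.assoc _ _ _).trans hv⟩
        · exact exists_extension_of_resolution n F d X ρ
            (fun n => extVanishes_of_isFGProj (hF n) _) hX.2 hρ h₀ hd φ hφ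
    refine (injective_iff_map_eq_zero u.hom).2 fun x hx => ?_
    obtain ⟨y, rfl⟩ := hρ x
    exact (h₀ y).2 ((hex y).1 hx)
  exact ⟨P, _, u, _, hP, isCM_right hR (isSES_coker u hinj) hX (isCM_of_isFGProj hP) hu',
    isSES_coker u hinj⟩

/-- A coresolution of a Cohen-Macaulay module by projective modules. -/
lemma exists_coresolution (hR : IsIwanagaGorenstein R) (X : RMod R) (hX : isCM R X) :
    ∃ (F : ℕ → RMod R) (d : ∀ n, F n ⟶ F (n + 1)) (ε : X ⟶ F 0), (∀ n, isFGProj R (F n)) ∧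
      Function.Injective ε ∧ Function.Exact ε (d 0) ∧ ∀ n, Function.Exact (d n) (d (n + 1)) := by
  choose P Y i p hP hY hS using fun X : { X : RMod R // isCM R X } => exists_cosyzygy hR X.1 X.2
  let M : ℕ → { X : RMod R // isCM R X } := Nat.rec ⟨X, hX⟩ fun _ Z => ⟨Y Z, hY Z⟩
  have key (n : ℕ) : Function.Exact (i (M n)) (p (M n) ≫ i (M (n + 1))) := by
    intro x
    refine Iff.trans ?_ ((hS (M n)).exact x)
    exact ⟨fun h => (hS (M (n + 1))).inj (h.trans (map_zero _).symm),
      fun h => (congrArg (i (M (n + 1))) h).trans (map_zero _)⟩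
  refine ⟨fun n => P (M n), fun n => p (M n) ≫ i (M (n + 1)), i (M 0), fun n => hP _,
    (hS (M 0)).inj, key 0, fun n x => (key (n + 1) x).trans ⟨?_, ?_⟩⟩
  · rintro ⟨y, rfl⟩
    obtain ⟨z, rfl⟩ := (hS (M n)).surj y
    exact ⟨z, rfl⟩
  · rintro ⟨z, rfl⟩
    exact ⟨_, rfl⟩

end CM

namespace MorE

variable {R : Type u} [Ring R]

/-- Every object of `Mor^e(CM R)` has a gluing. -/
lemma exists_gluing (hR : IsIwanagaGorenstein R) (α : MorE R) : Nonempty (Gluing α) := by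
  obtain ⟨F, d, ρ, hF, hρ, h₀, hd⟩ := exists_resolution hR α.src α.property.1
  obtain ⟨F', d', ε, hF', hε, h₁, hd'⟩ := exists_coresolution hR α.tgt α.property.2.1
  -- Matching on the constructors of ℤ makes `n + 1` reduce in each branch, so the differentials
  -- below typecheck without casts. The constructor `.negSucc n` stands for -(n + 1), the place of F
  -- (n + 1).
  let X : ℤ → ProjCat R := fun n => match n with
    | .ofNat 0 => ⟨F 0, hF 0⟩
    | .ofNat (n + 1) => ⟨F' n, hF' n⟩
    | .negSucc n => ⟨F (n + 1), hF (n + 1)⟩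
  let D : ∀ n, X n ⟶ X (n + 1) := fun n => match n with
    | .ofNat 0 => ObjectProperty.homMk (ρ ≫ α.arr ≫ ε)
    | .ofNat (n + 1) => ObjectProperty.homMk (d' n)
    | .negSucc 0 => ObjectProperty.homMk (d 0)
    | .negSucc (n + 1) => ObjectProperty.homMk (d (n + 1))
  let K : CochainComplex (ProjCat R) ℤ := CochainComplex.of X D (by
    rintro ((_ | n) | (_ | _ | n))
    · ext x
      exact h₁.apply_apply_eq_zero (α.arr (ρ x))
    · ext x
      exact (hd' n).apply_apply_eq_zero x
    · ext x
      change ε (α.arr (ρ (d 0 x))) = 0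
      rw [h₀.apply_apply_eq_zero, map_zero, map_zero]
    · ext x
      exact (hd 0).apply_apply_eq_zero x
    · ext x
      exact (hd (n + 1)).apply_apply_eq_zero x)
  have hK (n : ℤ) : K.d n (n + 1) = D n := CochainComplex.of_d _ _ _
  have hK₀ : K.d (-1) 0 = ObjectProperty.homMk (d 0) := hK (-1)
  have hK₁ : K.d 0 1 = ObjectProperty.homMk (ρ ≫ α.arr ≫ ε) := hK 0
  have hKp (n : ℕ) : K.d (Int.ofNat (n + 1)) (Int.ofNat (n + 2)) = ObjectProperty.homMk (d' n) :=
    hK (Int.ofNat (n + 1))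
  have hKn (n : ℕ) : K.d (Int.negSucc (n + 1)) (Int.negSucc n) =
      ObjectProperty.homMk (d (n + 1)) := hK (Int.negSucc (n + 1))
  exact ⟨{
    cplx := K
    ρ := ρ
    ε := ε
    d_zero_one := congrArg (fun f => f.hom) hK₁
    ρ_surj := hρ
    exact_zero := by rw [hK₀]; exact h₀
    exact_neg := by
      rintro (n | n) hi
      · exact absurd hi (by simp)
      · cases n with
        | zero =>
          exact exactAt_of_d_eq (i := Int.negSucc 1) (j := Int.negSucc 0) (k := 0) rfl rfl
            (hKn 0) hK₀ (hd 0)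
        | succ n =>
          exact exactAt_of_d_eq (i := Int.negSucc (n + 2)) (j := Int.negSucc (n + 1))
            (k := Int.negSucc n) rfl rfl (hKn (n + 1)) (hKn n) (hd (n + 1))
    ε_inj := hε
    exact_one := by
      have h : K.d 1 2 = ObjectProperty.homMk (d' 0) := hKp 0
      rw [h]
      exact h₁
    exact_pos := by
      intro i hi
      obtain ⟨n, rfl⟩ : ∃ n : ℕ, i = Int.ofNat (n + 2) := ⟨(i - 2).toNat, by simp; lia⟩
      exact exactAt_of_d_eq (i := Int.ofNat (n + 1)) (j := Int.ofNat (n + 2))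
        (k := Int.ofNat (n + 3)) rfl rfl (hKp n) (hKp (n + 1)) (hd' n) }⟩

end MorE

namespace MorE

/-! ### The Frobenius structure -/

section Frobenius

variable {R : Type u} [Ring R]

/-- Constructor for objects of `Mor^e(CM R)`. -/
abbrev mkObj {X T : RMod R} (f : X ⟶ T) (hX : isCM R X) (hT : isCM R T)
    (hf : Function.Surjective f) : MorE R := ⟨Arrow.mk f, hX, hT, hf⟩

lemma w_apply {α β : MorE R} (f : α ⟶ β) (x : α.src) : β.arr (onSrc f x) = onTgt f (α.arr x) :=
  congrArg (fun g : α.src ⟶ β.tgt => g x) (w f)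

namespace IsConflation

variable {α β γ : MorE R} {i : α ⟶ β} {p : β ⟶ γ}

lemma src_isSES (h : IsConflation i p) : IsSES (onSrc i) (onSrc p) :=
  ⟨h.src_inj, h.src_exact, h.src_surj⟩

lemma tgt_isSES (h : IsConflation i p) : IsSES (onTgt i) (onTgt p) :=
  ⟨h.tgt_inj, h.tgt_exact, h.tgt_surj⟩

lemma mk' (hS : IsSES (onSrc i) (onSrc p)) (hT : IsSES (onTgt i) (onTgt p)) :
    IsConflation i p where
  zero := hom_ext hS.zero hT.zero
  src_inj := hS.inj
  src_exact := hS.exact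
  src_surj := hS.surj
  tgt_inj := hT.inj
  tgt_exact := hT.exact
  tgt_surj := hT.surj

/-- The kernel of the middle term surjects onto the kernel of the last term. -/
lemma exists_ker_lift (h : IsConflation i p) (x : γ.src) (hx : γ.arr x = 0) :
    ∃ y : β.src, β.arr y = 0 ∧ onSrc p y = x := by
  obtain ⟨y, rfl⟩ := h.src_surj x
  obtain ⟨t, ht⟩ := (h.tgt_exact (β.arr y)).1 (by rw [← w_apply, hx])
  obtain ⟨a, rfl⟩ := α.arr_surj t
  refine ⟨y - onSrc i a, ?_, ?_⟩
  · rw [map_sub, w_apply, ht, sub_self]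
  · rw [map_sub, h.src_exact.apply_apply_eq_zero, sub_zero]

end IsConflation

/-- Objects given by surjections between finitely generated projective modules. -/
def IsStandard (q : MorE R) : Prop := isFGProj R q.src ∧ isFGProj R q.tgt

lemma IsStandard.exists_section {q : MorE R} (hq : IsStandard q) :
    ∃ s : q.tgt ⟶ q.src, s ≫ q.arr = 𝟙 _ :=
  exists_lift_of_surjective hq.2 q.arr q.arr_surj (𝟙 _)

/-- A section `s` of q splits q into T = T and Ker q ⟶ 0. The first part is lifted through X_β ⟶
X_γ, the second through Ker β ⟶ Ker γ, which is onto by the snake argument in `exists_ker_lift`. -/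
lemma IsStandard.isProj {q : MorE R} (hq : IsStandard q) : IsProj q := by
  intro α β γ i p hip f
  obtain ⟨s, hs⟩ := hq.exists_section
  obtain ⟨a, ha⟩ := exists_lift_of_surjective hq.2 (onSrc p) hip.src_surj (s ≫ onSrc f)
  let κ : ModuleCat.of Rᵐᵒᵖ (LinearMap.ker β.arr.hom) ⟶ ModuleCat.of Rᵐᵒᵖ (LinearMap.ker γ.arr.hom) :=
    ModuleCat.ofHom ((onSrc p).hom.restrict fun x (hx : β.arr x = 0) => by
      change γ.arr (onSrc p x) = 0
      rw [w_apply, hx, map_zero])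
  have hκ : Function.Surjective κ := by
    rintro ⟨x, hx⟩
    obtain ⟨y, hy, rfl⟩ := hip.exists_ker_lift x hx
    exact ⟨⟨y, hy⟩, rfl⟩
  have he : ((𝟙 _ - q.arr ≫ s) ≫ onSrc f) ≫ γ.arr = 0 := by
    rw [Category.assoc, w f, Preadditive.sub_comp, Category.id_comp, Category.assoc,
      reassoc_of% hs, sub_self]
  obtain ⟨b, hb⟩ := exists_lift_of_surjective hq.1 κ hκ
    (ModuleCat.ofHom (((𝟙 _ - q.arr ≫ s) ≫ onSrc f).hom.codRestrict (LinearMap.ker γ.arr.hom)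
      fun x => congrArg (fun g : q.src ⟶ γ.tgt => g x) he))
  let b' : q.src ⟶ β.src := b ≫ ModuleCat.ofHom (LinearMap.ker β.arr.hom).subtype
  have hb₁ : b' ≫ onSrc p = (𝟙 _ - q.arr ≫ s) ≫ onSrc f := by
    ext x
    exact congrArg Subtype.val
      (congrArg (fun g : q.src ⟶ ModuleCat.of Rᵐᵒᵖ (LinearMap.ker γ.arr.hom) => g x) hb)
  have hb₂ : b' ≫ β.arr = 0 := by
    ext x
    exact (b x).2
  refine ⟨mkHom (q.arr ≫ a + b') (a ≫ β.arr) ?_, hom_ext ?_ ?_⟩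
  · rw [Preadditive.add_comp, hb₂, add_zero, Category.assoc]
  · change (q.arr ≫ a + b') ≫ onSrc p = onSrc f
    rw [Preadditive.add_comp, hb₁, Category.assoc, ha, Preadditive.sub_comp, Category.id_comp,
      Category.assoc, add_sub_cancel]
  · change (a ≫ β.arr) ≫ onTgt p = onTgt f
    rw [Category.assoc, ← w p, reassoc_of% ha, w f, reassoc_of% hs]

/-- Sources and targets are extended independently, since Ext¹ from Cohen-Macaulay modules to
projectives vanishes. The failure of the square to commute is moved into the source component by the
section `s`; it vanishes on X_α, so the extension property survives. -/
lemma IsStandard.isInj {q : MorE R} (hq : IsStandard q) : IsInj q := by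
  intro α β γ i p hip f
  obtain ⟨s, hs⟩ := hq.exists_section
  obtain ⟨a, ha⟩ := exists_extension_of_isCM hip.src_isSES γ.property.1 hq.1 (onSrc f)
  obtain ⟨b, hb⟩ := exists_extension_of_isCM hip.tgt_isSES γ.property.2.1 hq.2 (onTgt f)
  refine ⟨mkHom (a + (β.arr ≫ b - a ≫ q.arr) ≫ s) b ?_, hom_ext ?_ hb⟩
  · rw [Preadditive.add_comp, Category.assoc, hs, Category.comp_id, add_sub_cancel]
  · change onSrc i ≫ (a + (β.arr ≫ b - a ≫ q.arr) ≫ s) = onSrc f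
    rw [Preadditive.comp_add, ha, Preadditive.comp_sub_assoc, reassoc_of% (w i), hb,
      reassoc_of% ha, w f, sub_self, zero_comp, add_zero]

lemma isFGProj_of_retract {P Q : RMod R} (hQ : isFGProj R Q) (i : P ⟶ Q) (p : Q ⟶ P)
    (h : i ≫ p = 𝟙 P) : isFGProj R P := by
  have := hQ.1
  have := hQ.2
  have h' : p.hom ∘ₗ i.hom = LinearMap.id := congrArg ModuleCat.Hom.hom h
  exact ⟨Module.Finite.of_surjective p.hom fun x => ⟨i x, LinearMap.congr_fun h' x⟩,
    Module.Projective.of_split i.hom p.hom h'⟩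

lemma IsStandard.of_retract {q r : MorE R} (hr : IsStandard r) (i : q ⟶ r) (p : r ⟶ q)
    (h : i ≫ p = 𝟙 q) : IsStandard q :=
  ⟨isFGProj_of_retract hr.1 (onSrc i) (onSrc p) (congrArg onSrc h),
    isFGProj_of_retract hr.2 (onTgt i) (onTgt p) (congrArg onTgt h)⟩

/-- The kernel of an admissible epimorphism. -/
lemma exists_kernel (hR : IsIwanagaGorenstein R) {β γ : MorE R} (p : β ⟶ γ)
    (h₁ : Function.Surjective (onSrc p)) (h₂ : Function.Surjective (onTgt p))
    (h₃ : ∀ t : β.tgt, onTgt p t = 0 → ∃ x : β.src, β.arr x = t ∧ onSrc p x = 0) :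
    ∃ (α : MorE R) (i : α ⟶ β), IsConflation i p := by
  let k : ModuleCat.of Rᵐᵒᵖ (LinearMap.ker (onSrc p).hom) ⟶
      ModuleCat.of Rᵐᵒᵖ (LinearMap.ker (onTgt p).hom) :=
    ModuleCat.ofHom (β.arr.hom.restrict fun x (hx : onSrc p x = 0) => by
      change onTgt p (β.arr x) = 0
      rw [← w_apply, hx, map_zero])
  refine ⟨mkObj k (isCM_left hR (isSES_ker _ h₁) β.property.1 γ.property.1)
    (isCM_left hR (isSES_ker _ h₂) β.property.2.1 γ.property.2.1) ?_,
    mkHom (ModuleCat.ofHom (LinearMap.ker (onSrc p).hom).subtype)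
      (ModuleCat.ofHom (LinearMap.ker (onTgt p).hom).subtype) rfl,
    IsConflation.mk' (isSES_ker _ h₁) (isSES_ker _ h₂)⟩
  rintro ⟨t, ht⟩
  obtain ⟨x, hx, hx'⟩ := h₃ t ht
  exact ⟨⟨x, hx'⟩, Subtype.ext hx⟩

/-- The cokernel of an admissible monomorphism. -/
lemma exists_cokernel (hR : IsIwanagaGorenstein R) {α β : MorE R} (i : α ⟶ β)
    (h₁ : Function.Injective (onSrc i)) (h₂ : Function.Injective (onTgt i))
    (h₃ : ∀ u : α.src ⟶ rightRegular R, ∃ v : β.src ⟶ rightRegular R, onSrc i ≫ v = u)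
    (h₄ : ∀ u : α.tgt ⟶ rightRegular R, ∃ v : β.tgt ⟶ rightRegular R, onTgt i ≫ v = u) :
    ∃ (γ : MorE R) (p : β ⟶ γ), IsConflation i p := by
  obtain ⟨k, hk⟩ := (isSES_coker _ h₁).exists_desc
    (β.arr ≫ ModuleCat.ofHom (LinearMap.range (onTgt i).hom).mkQ) (by
      rw [reassoc_of% (w i), (isSES_coker _ h₂).zero, comp_zero])
  refine ⟨mkObj k (isCM_right hR (isSES_coker _ h₁) α.property.1 β.property.1 h₃)
    (isCM_right hR (isSES_coker _ h₂) α.property.2.1 β.property.2.1 h₄) ?_,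
    mkHom (ModuleCat.ofHom (LinearMap.range (onSrc i).hom).mkQ)
      (ModuleCat.ofHom (LinearMap.range (onTgt i).hom).mkQ) hk,
    IsConflation.mk' (isSES_coker _ h₁) (isSES_coker _ h₂)⟩
  intro t
  obtain ⟨y, rfl⟩ := (isSES_coker _ h₂).surj t
  obtain ⟨x, rfl⟩ := β.arr_surj y
  exact ⟨_, congrArg (fun g : β.src ⟶ _ => g x) hk⟩

lemma isFGProj_prod {P Q : RMod R} (hP : isFGProj R P) (hQ : isFGProj R Q) :
    isFGProj R (ModuleCat.of Rᵐᵒᵖ (P × Q)) :=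
  isFGProj_of_iso R (ModuleCat.biprodIsoProd P Q) (isFGProj_biprod R hP hQ)

/-- The second factor P' covers Ker α. Without it the map between the kernels of the two components
need not be surjective, and the kernel would leave the category. -/
lemma exists_standard_cover (hR : IsIwanagaGorenstein R) (α : MorE R) :
    ∃ (γ q : MorE R) (i : γ ⟶ q) (p : q ⟶ α), IsConflation i p ∧ IsStandard q := by
  have := α.property.1.finite
  have := hR.finite_ker α.arr
  obtain ⟨P, a, hP, ha⟩ := exists_cover α.src
  obtain ⟨P', b, hP', hb⟩ := exists_cover (ModuleCat.of Rᵐᵒᵖ (LinearMap.ker α.arr.hom))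
  let q : MorE R := mkObj (ModuleCat.ofHom (LinearMap.fst Rᵐᵒᵖ P P'))
    (isCM_of_isFGProj (isFGProj_prod hP hP')) (isCM_of_isFGProj hP) fun x => ⟨(x, 0), rfl⟩
  let p : q ⟶ α := mkHom
    (ModuleCat.ofHom (LinearMap.coprod a.hom ((LinearMap.ker α.arr.hom).subtype ∘ₗ b.hom)))
    (a ≫ α.arr) (by
      ext x : 2
      change P × P' at x
      change α.arr (a x.1 + (b x.2).1) = α.arr (a x.1)
      have : α.arr (b x.2).1 = 0 := (b x.2).2
      rw [map_add, this, add_zero])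
  have hp (x : P) (y : P') : onSrc p (x, y) = a x + (b y).1 := rfl
  obtain ⟨γ, i, hi⟩ := exists_kernel hR p
    (fun x => by
      obtain ⟨y, rfl⟩ := ha x
      exact ⟨(y, 0), by rw [hp, map_zero]; exact add_zero _⟩)
    (α.arr_surj.comp ha)
    (fun t ht => by
      obtain ⟨y, hy⟩ := hb ⟨-a t, by
        change α.arr (-a t) = 0
        rw [map_neg, show α.arr (a t) = 0 from ht, neg_zero]⟩
      exact ⟨(t, y), rfl, by rw [hp, hy, add_neg_cancel]⟩)
  exact ⟨γ, q, i, p, hi, isFGProj_prod hP hP', hP⟩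

/-- X is embedded into I × J by its own hull and by the hull of T composed with α, which makes the
square with the projection to J commute. -/
lemma exists_standard_hull (hR : IsIwanagaGorenstein R) (α : MorE R) :
    ∃ (q γ : MorE R) (i : α ⟶ q) (p : q ⟶ γ), IsConflation i p ∧ IsStandard q := by
  obtain ⟨I, Y, a, a', hI, hY, ha⟩ := exists_cosyzygy hR α.src α.property.1
  obtain ⟨J, Z, b, b', hJ, hZ, hb⟩ := exists_cosyzygy hR α.tgt α.property.2.1
  let q : MorE R := mkObj (ModuleCat.ofHom (LinearMap.snd Rᵐᵒᵖ I J))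
    (isCM_of_isFGProj (isFGProj_prod hI hJ)) (isCM_of_isFGProj hJ) fun x => ⟨(0, x), rfl⟩
  let i : α ⟶ q := mkHom (ModuleCat.ofHom (a.hom.prod (α.arr ≫ b).hom)) b rfl
  obtain ⟨γ, p, hp⟩ := exists_cokernel hR i
    (fun x y h => ha.inj (congrArg (fun z : I × J => z.1) h)) hb.inj
    (fun u => by
      obtain ⟨v, rfl⟩ := ha.exists_extension (hY.2 1 one_pos) u
      exact ⟨ModuleCat.ofHom (LinearMap.fst Rᵐᵒᵖ I J) ≫ v, rfl⟩)
    (fun u => hb.exists_extension (hZ.2 1 one_pos) u)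
  exact ⟨q, γ, i, p, hp, isFGProj_prod hI hJ, hJ⟩

/-- A projective object splits off its standard cover, and retracts of standard objects are
standard. -/
lemma isProj_iff_isStandard (hR : IsIwanagaGorenstein R) (q : MorE R) :
    IsProj q ↔ IsStandard q := by
  refine ⟨fun h => ?_, IsStandard.isProj⟩
  obtain ⟨γ, r, i, p, hip, hr⟩ := exists_standard_cover hR q
  obtain ⟨s, hs⟩ := h i p hip (𝟙 q)
  exact hr.of_retract s p hs

lemma isInj_iff_isStandard (hR : IsIwanagaGorenstein R) (q : MorE R) :
    IsInj q ↔ IsStandard q := by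
  refine ⟨fun h => ?_, IsStandard.isInj⟩
  obtain ⟨r, γ, i, p, hip, hr⟩ := exists_standard_hull hR q
  obtain ⟨s, hs⟩ := h i p hip (𝟙 q)
  exact hr.of_retract i s hs

lemma isFrobenius (hR : IsIwanagaGorenstein R) : IsFrobenius R where
  proj_iff_inj q := (isProj_iff_isStandard hR q).trans (isInj_iff_isStandard hR q).symm
  enough_proj α := by
    obtain ⟨γ, q, i, p, h, hq⟩ := exists_standard_cover hR α
    exact ⟨γ, q, i, p, h, hq.isProj⟩
  enough_inj α := by
    obtain ⟨q, γ, i, p, h, hq⟩ := exists_standard_hull hR α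
    exact ⟨q, γ, i, p, h, hq.isInj⟩

lemma nonempty_cosyzygies (hR : IsIwanagaGorenstein R) : Nonempty (Cosyzygies R) := by
  choose q γ i p h hq using exists_standard_hull hR
  exact ⟨⟨q, γ, i, p, h, fun α => (hq α).isProj, fun α => (hq α).isInj⟩⟩

end Frobenius

end MorE

/-! ### Exactness expressed by cohomology -/

section Homology

variable {R : Type u} [Ring R]

lemma exactAt_iff_isZero_homology (K : CochainComplex (ProjCat R) ℤ) (i : ℤ) :
    ExactAt K i ↔ IsZero ((KProj.homology R i).obj ((HomotopyCategory.quotient _ _).obj K)) := by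
  let K' := ((isFGProj R).ι.mapHomologicalComplex (ComplexShape.up ℤ)).obj K
  have e : (KProj.homology R i).obj ((HomotopyCategory.quotient _ _).obj K) ≅ K'.homology i :=
    (HomotopyCategory.homologyFunctorFactors (RMod R) (ComplexShape.up ℤ) i).app K'
  rw [Iso.isZero_iff e, ← HomologicalComplex.exactAt_iff_isZero_homology,
    HomologicalComplex.exactAt_iff' K' (i - 1) i (i + 1) (by simp) (by simp),
    ShortComplex.ShortExact.moduleCat_exact_iff_function_exact]
  rfl

end Homology

namespace MorE

open CochainComplex.HomComplex

/-! ### The gluing functor into the homotopy category: fullness and kernel -/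

section Functor

variable {R : Type u} [Ring R]

lemma Gluing.hasBoundedHomology {α : MorE R} (A : Gluing α) :
    hasBoundedHomology R ((HomotopyCategory.quotient _ _).obj A.cplx) :=
  ⟨0, fun i hi => (exactAt_iff_isZero_homology _ _).1 (A.exactAt i (by rintro rfl; simp at hi))⟩

/-- The object of `K^{∞,b}(proj R)` given by a gluing. -/
abbrev Gluing.toK {α : MorE R} (A : Gluing α) : KInfB R := ⟨_, A.hasBoundedHomology⟩

/-- The morphism in `K^{∞,b}(proj R)` induced by a morphism of `Mor^e(CM R)`. -/
def Gluing.toKMap (hR : IsIwanagaGorenstein R) {α β : MorE R} (A : Gluing α) (B : Gluing β)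
    (f : α ⟶ β) : A.toK ⟶ B.toK :=
  ObjectProperty.homMk ((HomotopyCategory.quotient _ _).map (A.exists_isLift B hR f).choose)

lemma Gluing.IsLift.toKMap_eq (hR : IsIwanagaGorenstein R) {α β : MorE R} {A : Gluing α}
    {B : Gluing β} {f : α ⟶ β} {φ : A.cplx ⟶ B.cplx} (h : A.IsLift B f φ) :
    A.toKMap hR B f = ObjectProperty.homMk ((HomotopyCategory.quotient _ _).map φ) := by
  ext1
  exact (A.exists_isLift B hR f).choose_spec.quotient_map_eq hR h

lemma Gluing.toKMap_comp (hR : IsIwanagaGorenstein R) {α β γ : MorE R} (A : Gluing α)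
    (B : Gluing β) (C : Gluing γ) (f : α ⟶ β) (g : β ⟶ γ) :
    A.toKMap hR C (f ≫ g) = A.toKMap hR B f ≫ B.toKMap hR C g := by
  obtain ⟨φ, hφ⟩ := A.exists_isLift B hR f
  obtain ⟨ψ, hψ⟩ := B.exists_isLift C hR g
  rw [hφ.toKMap_eq, hψ.toKMap_eq, (hφ.comp A B hψ).toKMap_eq]
  ext1
  exact (HomotopyCategory.quotient (ProjCat R) (.up ℤ)).map_comp φ ψ

lemma Gluing.toKMap_id (hR : IsIwanagaGorenstein R) {α : MorE R} (A : Gluing α) :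
    A.toKMap hR A (𝟙 α) = 𝟙 _ := by
  rw [A.isLift_id.toKMap_eq]
  ext1
  exact (HomotopyCategory.quotient (ProjCat R) (.up ℤ)).map_id _

lemma Gluing.toKMap_sub (hR : IsIwanagaGorenstein R) {α β : MorE R} (A : Gluing α) (B : Gluing β)
    (f g : α ⟶ β) : A.toKMap hR B (f - g) = A.toKMap hR B f - A.toKMap hR B g := by
  obtain ⟨φ, hφ⟩ := A.exists_isLift B hR f
  obtain ⟨ψ, hψ⟩ := A.exists_isLift B hR g
  rw [hφ.toKMap_eq, hψ.toKMap_eq, (hφ.sub A B hψ).toKMap_eq]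
  ext1
  exact (HomotopyCategory.quotient (ProjCat R) (.up ℤ)).map_sub

/-- The gluing functor. -/
def gluingFunctor (hR : IsIwanagaGorenstein R) (G : ∀ α : MorE R, Gluing α) : MorE R ⥤ KInfB R where
  obj α := (G α).toK
  map f := (G _).toKMap hR (G _) f
  map_id α := (G α).toKMap_id hR
  map_comp f g := (G _).toKMap_comp hR _ _ f g

lemma isGluingFunctor (hR : IsIwanagaGorenstein R) (G : ∀ α : MorE R, Gluing α) :
    IsGluingFunctor G (gluingFunctor hR G) := by
  refine ⟨fun α => Iso.refl _, fun α β f => ⟨(G α).exists_isLift (G β) hR f, fun φ hφ => ?_⟩⟩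
  have : ((gluingFunctor hR G).map f).hom = _ := congrArg (fun f => f.hom) (hφ.toKMap_eq hR)
  rw [this]
  exact (Category.comp_id _).trans (Category.id_comp _).symm

/-- Two gluings of the same object are homotopy equivalent. -/
def Gluing.toKIso (hR : IsIwanagaGorenstein R) {α : MorE R} (A B : Gluing α) : A.toK ≅ B.toK where
  hom := A.toKMap hR B (𝟙 α)
  inv := B.toKMap hR A (𝟙 α)
  hom_inv_id := by rw [← Gluing.toKMap_comp, Category.comp_id, Gluing.toKMap_id]
  inv_hom_id := by rw [← Gluing.toKMap_comp, Category.comp_id, Gluing.toKMap_id]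

lemma exists_lift_module {A B C D : RMod R} (i : A ⟶ B) (p : B ⟶ C) (h : Function.Exact i p)
    (hi : Function.Injective i) (u : D ⟶ B) (hu : u ≫ p = 0) : ∃ v : D ⟶ A, v ≫ i = u := by
  let S : ShortComplex (RMod R) := ShortComplex.mk i p (by ext x; exact h.apply_apply_eq_zero x)
  have hS : S.Exact := (ShortComplex.ShortExact.moduleCat_exact_iff_function_exact S).2 h
  have : Mono S.f := (ModuleCat.mono_iff_injective _).2 hi
  exact ⟨hS.lift u hu, hS.lift_f u hu⟩

variable {α β : MorE R} (A : Gluing α) (B : Gluing β)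

instance : Epi A.ρ := (ModuleCat.epi_iff_surjective _).2 A.ρ_surj

instance : Mono A.ε := (ModuleCat.mono_iff_injective _).2 A.ε_inj

instance : Epi α.arr := (ModuleCat.epi_iff_surjective _).2 α.arr_surj

/-- Every chain map between gluings is a lift. -/
lemma Gluing.exists_of_chainMap (φ : A.cplx ⟶ B.cplx) : ∃ f : α ⟶ β, A.IsLift B f φ := by
  have h₀ : (A.cplx.d (-1) 0).hom ≫ (φ.f 0).hom = (φ.f (-1)).hom ≫ (B.cplx.d (-1) 0).hom :=
    congrArg (fun f => f.hom) (φ.comm (-1) 0).symm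
  have h₁ : (A.cplx.d 0 1).hom ≫ (φ.f 1).hom = (φ.f 0).hom ≫ (B.cplx.d 0 1).hom :=
    congrArg (fun f => f.hom) (φ.comm 0 1).symm
  have h₂ : (A.cplx.d 1 2).hom ≫ (φ.f 2).hom = (φ.f 1).hom ≫ (B.cplx.d 1 2).hom :=
    congrArg (fun f => f.hom) (φ.comm 1 2).symm
  -- X is the cokernel of d⁻¹ and T is the kernel of d¹, so the chain map induces maps on both;
  -- commutation with d⁰ gives the square after cancelling `ρ` and `ε`.
  obtain ⟨a, ha⟩ := exists_desc_module _ _ A.exact_zero A.ρ_surj ((φ.f 0).hom ≫ B.ρ) (by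
    rw [reassoc_of% h₀, B.d_comp_ρ, comp_zero])
  obtain ⟨b, hb⟩ := exists_lift_module _ _ B.exact_one B.ε_inj (A.ε ≫ (φ.f 1).hom) (by
    rw [Category.assoc, ← h₂, reassoc_of% A.ε_comp_d, zero_comp])
  refine ⟨mkHom a b ?_, ha.symm, hb.symm⟩
  rw [← cancel_epi A.ρ, ← cancel_mono B.ε]
  simp only [Category.assoc]
  rw [hb, reassoc_of% ha, ← B.d_zero_one, ← h₁, A.d_zero_one]
  simp only [Category.assoc]

/-- Fullness before passing to the quotient: a homotopy class has a chain map as representative, and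
that chain map lifts some f. -/
lemma Gluing.toKMap_surjective (hR : IsIwanagaGorenstein R) (φ : A.toK ⟶ B.toK) :
    ∃ f : α ⟶ β, A.toKMap hR B f = φ := by
  obtain ⟨ψ, hψ⟩ := (HomotopyCategory.quotient (ProjCat R) (.up ℤ)).map_surjective φ.hom
  obtain ⟨f, hf⟩ := A.exists_of_chainMap B ψ
  refine ⟨f, ?_⟩
  rw [hf.toKMap_eq hR]
  ext1
  exact hψ

/-- The object `P = P` of `Mor^e(CM R)`. -/
def idObj (P : ProjCat R) : MorE R :=
  mkObj (𝟙 P.obj) (isCM_of_isFGProj P.property) (isCM_of_isFGProj P.property) fun x => ⟨x, rfl⟩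

lemma isStandard_idObj (P : ProjCat R) : IsStandard (idObj P) := ⟨P.property, P.property⟩

variable (R) in
lemma isFGProj_punit : isFGProj R (ModuleCat.of Rᵐᵒᵖ PUnit) :=
  ⟨by dsimp; infer_instance, by dsimp; infer_instance⟩

/-- The object `P ⟶ 0` of `Mor^e(CM R)`. -/
def zeroObj (P : ProjCat R) : MorE R :=
  mkObj (0 : P.obj ⟶ ModuleCat.of Rᵐᵒᵖ PUnit) (isCM_of_isFGProj P.property)
    (isCM_of_isFGProj (isFGProj_punit R)) fun _ => ⟨0, rfl⟩

lemma isStandard_zeroObj (P : ProjCat R) : IsStandard (zeroObj P) :=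
  ⟨P.property, isFGProj_punit R⟩

/-- A morphism whose lifts are homotopic to zero factors through an object `P = P`. -/
lemma Gluing.exists_factorization (hR : IsIwanagaGorenstein R) (f : α ⟶ β)
    (hf : A.toKMap hR B f = 0) :
    ∃ (P : ProjCat R) (a : α ⟶ idObj P) (b : idObj P ⟶ β), f = a ≫ b := by
  obtain ⟨φ, hφ⟩ := A.exists_isLift B hR f
  rw [hφ.toKMap_eq] at hf
  have hf' : (HomotopyCategory.quotient (ProjCat R) (.up ℤ)).map φ =
      (HomotopyCategory.quotient (ProjCat R) (.up ℤ)).map 0 := by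
    rw [Functor.map_zero]
    exact congrArg (fun f => f.hom) hf
  obtain ⟨z, hz⟩ := Cochain.equivHomotopy _ _ (HomotopyCategory.homotopyOfEq _ _ hf')
  have hz₀ := Cochain.congr_v hz 0 0 rfl
  rw [Cochain.ofHom_v, Cochain.add_v, Cochain.ofHom_v,
    δ_v (-1) 0 rfl z 0 0 rfl (-1) 1 rfl rfl, Int.negOnePow_zero, one_smul] at hz₀
  have hz₁ : (φ.f 0).hom = (z.v 0 (-1) rfl).hom ≫ (B.cplx.d (-1) 0).hom +
      (A.cplx.d 0 1).hom ≫ (z.v 1 0 rfl).hom := by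
    rw [hz₀]
    exact add_zero _
  -- Composition with `ρ` kills the summand of the homotopy that ends in d⁻¹. What remains passes
  -- through d⁰ and hence through F¹ of A, which is the projective P. The target component follows
  -- because `α` is epi.
  have hsrc : onSrc f = α.arr ≫ A.ε ≫ (z.v 1 0 rfl).hom ≫ B.ρ := by
    rw [← cancel_epi A.ρ, ← hφ.src, hz₁, Preadditive.add_comp, Category.assoc, B.d_comp_ρ,
      comp_zero, zero_add, A.d_zero_one]
    simp only [Category.assoc]
  refine ⟨A.cplx.X 1, mkHom (α.arr ≫ A.ε) A.ε (Category.comp_id _),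
    mkHom ((z.v 1 0 rfl).hom ≫ B.ρ) ((z.v 1 0 rfl).hom ≫ B.ρ ≫ β.arr) ?_, hom_ext ?_ ?_⟩
  · exact (Category.assoc _ _ _).trans (Category.id_comp _).symm
  · exact hsrc.trans (Category.assoc _ _ _).symm
  · rw [← cancel_epi α.arr, ← w f, hsrc]
    simp only [Category.assoc]
    rfl

end Functor

end MorE

/-! ### Brutal truncations -/

section Truncation

universe v w

variable {C : Type w} [Category.{v} C] [Preadditive C] [HasZeroObject C]
  (K : CochainComplex C ℤ) (S : ℤ → Prop)

open Classical in
/-- The components of `K` in degrees satisfying `S`, and zero elsewhere. -/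
def partX (i : ℤ) : C := if S i then K.X i else 0

open Classical in
/-- The inclusion of `partX K S i` in `K.X i`. -/
def partι (i : ℤ) : partX K S i ⟶ K.X i := 
  if h : S i then eqToHom (show partX K S i = K.X i from if_pos h) else 0

open Classical in
/-- The projection of `K.X i` onto `partX K S i`. -/
def partπ (i : ℤ) : K.X i ⟶ partX K S i := 
  if h : S i then eqToHom (show K.X i = partX K S i from (if_pos h).symm) else 0

variable {S} {i : ℤ}

lemma isZero_partX (h : ¬ S i) : IsZero (partX K S i) := by
  rw [partX, if_neg h]
  exact isZero_zero C

lemma partι_eq_zero (h : ¬ S i) : partι K S i = 0 := dif_neg h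

lemma partπ_eq_zero (h : ¬ S i) : partπ K S i = 0 := dif_neg h

lemma partι_comp_partπ : partι K S i ≫ partπ K S i = 𝟙 _ := by
  by_cases h : S i
  · rw [partι, partπ, dif_pos h, dif_pos h, eqToHom_trans, eqToHom_refl]
  · exact (isZero_partX K h).eq_of_src _ _

lemma partπ_comp_partι (h : S i) : partπ K S i ≫ partι K S i = 𝟙 _ := by
  rw [partι, partπ, dif_pos h, dif_pos h, eqToHom_trans, eqToHom_refl]

lemma isZero_partX_of_isZero (h : IsZero (K.X i)) : IsZero (partX K S i) := by
  rw [IsZero.iff_id_eq_zero, ← partι_comp_partπ, h.eq_of_tgt (partι K S i) 0, zero_comp]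

variable (S) in
/-- The brutal truncation of `K` to the degrees satisfying `S`. -/
def part : CochainComplex C ℤ where
  X := partX K S
  d i j := partι K S i ≫ K.d i j ≫ partπ K S j
  shape i j h := by rw [K.shape i j h, zero_comp, comp_zero]
  d_comp_d' i j k _ _ := by
    by_cases h : S j
    · simp only [Category.assoc]
      rw [reassoc_of% (partπ_comp_partι K h), K.d_comp_d_assoc, zero_comp, comp_zero]
    · rw [partπ_eq_zero K h, comp_zero, comp_zero, zero_comp]

/-- The inclusion of a truncation to an up-closed set of degrees. -/
def partIncl (hS : ∀ i, S i → S (i + 1)) : part K S ⟶ K where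
  f i := partι K S i
  comm' i j hij := by
    obtain rfl : i + 1 = j := hij
    by_cases h : S i
    · change _ = (partι K S i ≫ K.d i (i + 1) ≫ partπ K S (i + 1)) ≫ partι K S (i + 1)
      simp only [Category.assoc]
      rw [partπ_comp_partι K (hS i h), Category.comp_id]
      rfl
    · exact (isZero_partX K h).eq_of_src _ _

/-- The projection onto a truncation to a down-closed set of degrees. -/
def partProj (hS : ∀ i, S (i + 1) → S i) : K ⟶ part K S where
  f i := partπ K S i
  comm' i j hij := by
    obtain rfl : i + 1 = j := hij
    by_cases h : S (i + 1)
    · change partπ K S i ≫ partι K S i ≫ K.d i (i + 1) ≫ partπ K S (i + 1) = _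
      rw [reassoc_of% (partπ_comp_partι K (hS i h))]
      rfl
    · exact (isZero_partX K h).eq_of_tgt _ _

/-- The brutal truncation triangle. -/
lemma exists_truncation_triangle [HasBinaryBiproducts C] (n : ℤ) :
    ∃ (L M : CochainComplex C ℤ) (i : L ⟶ K) (p : K ⟶ M)
      (h : (HomotopyCategory.quotient C (.up ℤ)).obj M ⟶
        ((HomotopyCategory.quotient C (.up ℤ)).obj L)⟦(1 : ℤ)⟧),
      Triangle.mk ((HomotopyCategory.quotient C (.up ℤ)).map i)
        ((HomotopyCategory.quotient C (.up ℤ)).map p) h ∈ distTriang _ ∧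
      (∀ j < n, IsZero (L.X j)) ∧ (∀ j, n ≤ j → IsZero (M.X j)) ∧
      (∀ j, IsZero (K.X j) → IsZero (L.X j)) ∧ ∀ j, IsZero (K.X j) → IsZero (M.X j) := by
  let i := partIncl K (S := fun j => n ≤ j) fun j hj => by lia
  let p := partProj K (S := fun j => ¬ n ≤ j) fun j hj => by lia
  let T : ShortComplex (CochainComplex C ℤ) := ShortComplex.mk i p (by
    ext j
    change partι K (fun j => n ≤ j) j ≫ partπ K (fun j => ¬ n ≤ j) j = 0
    by_cases h : n ≤ j
    · rw [partπ_eq_zero K (not_not.2 h), comp_zero]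
    · rw [partι_eq_zero K h, zero_comp])
  -- In each degree one truncation is all of `K` and the other is zero, so the sequence is
  -- degreewise split and yields a triangle.
  let σ (j : ℤ) : (T.map (HomologicalComplex.eval C _ j)).Splitting :=
    { r := partπ K (fun j => n ≤ j) j
      s := partι K (fun j => ¬ n ≤ j) j
      f_r := partι_comp_partπ K
      s_g := partι_comp_partπ K
      id := by
        change partπ K (fun j => n ≤ j) j ≫ partι K (fun j => n ≤ j) j +
          partπ K (fun j => ¬ n ≤ j) j ≫ partι K (fun j => ¬ n ≤ j) j = 𝟙 (K.X j)
        by_cases h : n ≤ j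
        · rw [partπ_comp_partι K (S := fun j => n ≤ j) h, partπ_eq_zero K (not_not.2 h), zero_comp,
            add_zero]
        · rw [partπ_comp_partι K (S := fun j => ¬ n ≤ j) h, partπ_eq_zero K h, zero_comp, zero_add] }
  exact ⟨_, _, i, p, _, (HomotopyCategory.distinguished_iff_iso_trianglehOfDegreewiseSplit
    (CochainComplex.trianglehOfDegreewiseSplit T σ)).2 ⟨T, σ, ⟨Iso.refl _⟩⟩,
    fun j hj => isZero_partX K (S := fun j => n ≤ j) (by lia),
    fun j hj => isZero_partX K (S := fun j => ¬ n ≤ j) (by lia),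
    fun j hj => isZero_partX_of_isZero K (S := fun j => n ≤ j) hj,
    fun j hj => isZero_partX_of_isZero K (S := fun j => ¬ n ≤ j) hj⟩

end Truncation

open CochainComplex.HomComplex

section DistTriang

variable {D : Type*} [Category D] [HasZeroObject D] [HasShift D ℤ] [Preadditive D]
  [∀ n : ℤ, (shiftFunctor D n).Additive] [Pretriangulated D] {X Y Z V : D} {f : X ⟶ Y} {g : Y ⟶ Z}
  {h : Z ⟶ X⟦(1 : ℤ)⟧}

lemma exists_lift₁_of_distTriang (hT : Triangle.mk f g h ∈ distTriang D) (x : V ⟶ Y)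
    (hx : x ≫ g = 0) : ∃ y : V ⟶ X, x = y ≫ f :=
  Triangle.coyoneda_exact₂ _ hT x hx

lemma exists_lift₂_of_distTriang (hT : Triangle.mk f g h ∈ distTriang D) (x : V ⟶ Z)
    (hx : x ≫ h = 0) : ∃ y : V ⟶ Y, x = y ≫ g :=
  Triangle.coyoneda_exact₃ _ hT x hx

lemma exists_desc₃_of_distTriang (hT : Triangle.mk f g h ∈ distTriang D) (x : Y ⟶ V)
    (hx : f ≫ x = 0) : ∃ y : Z ⟶ V, x = g ≫ y :=
  Triangle.yoneda_exact₂ _ hT x hx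

end DistTriang

/-! ### Vanishing of morphisms between bounded complexes and gluings -/

section Vanishing

variable {R : Type u} [Ring R]

lemma quotient_map_eq_zero_of_δ_eq {K L : CochainComplex (ProjCat R) ℤ} (φ : K ⟶ L)
    (u : Cochain K L (-1)) (hu : δ (-1) 0 u = Cochain.ofHom φ) :
    (HomotopyCategory.quotient (ProjCat R) (.up ℤ)).map φ = 0 := by
  rw [← (HomotopyCategory.quotient (ProjCat R) (.up ℤ)).map_zero]
  exact HomotopyCategory.eq_of_homotopy _ _
    ((Cochain.equivHomotopy φ 0).symm ⟨u, by simp [hu]⟩)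

/-- Morphisms from a complex `K` to a bounded complex `L` are homotopic to zero if `K` is coexact
in every degree in which `L` does not vanish. -/
lemma eq_zero_of_coexactAt {K L : CochainComplex (ProjCat R) ℤ} (hL : isBoundedComplex R L)
    (h : ∀ i, IsZero (L.X i) ∨ CoexactAt K i)
    (φ : (HomotopyCategory.quotient _ _).obj K ⟶ (HomotopyCategory.quotient _ _).obj L) :
    φ = 0 := by
  obtain ⟨φ, rfl⟩ := (HomotopyCategory.quotient (ProjCat R) (.up ℤ)).map_surjective φ
  obtain ⟨N, hN⟩ := hL
  have hN' (i : ℤ) (hi : i < -N) : IsZero (L.X i) := hN i (by rw [abs_of_neg (by lia)]; lia)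
  -- Below degree -N the target vanishes, so the zero homotopy is a solution there, and coexactness
  -- of K extends it upwards.
  obtain ⟨u, -, hu⟩ := exists_δ_eq (neg_add_cancel 1) (Cochain.ofHom φ) (by simp) 0
    (-N - 1) (-N - 1) le_rfl (fun p q hpq hp hp' => (hN' q (by lia)).eq_of_tgt _ _)
    (fun p q hp hpq f hf => by
      obtain rfl : p = q := by lia
      rcases h p with h | h
      · exact ⟨0, h.eq_of_tgt _ _⟩
      · exact h f hf)
    (fun p q hp hpq f _ => ⟨0, (hN' q (by lia)).eq_of_tgt _ _⟩)
  exact quotient_map_eq_zero_of_δ_eq φ u hu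

/-- Morphisms from a bounded complex `K` to a complex `L` are homotopic to zero if `L` is exact
in every degree in which `K` does not vanish. -/
lemma eq_zero_of_exactAt {K L : CochainComplex (ProjCat R) ℤ} (hK : isBoundedComplex R K)
    (h : ∀ i, IsZero (K.X i) ∨ ExactAt L i)
    (φ : (HomotopyCategory.quotient _ _).obj K ⟶ (HomotopyCategory.quotient _ _).obj L) :
    φ = 0 := by
  obtain ⟨φ, rfl⟩ := (HomotopyCategory.quotient (ProjCat R) (.up ℤ)).map_surjective φ
  obtain ⟨N, hN⟩ := hK
  have hN' (i : ℤ) (hi : N < i) : IsZero (K.X i) := hN i (by rw [abs_of_pos (by lia)]; lia)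
  obtain ⟨u, -, hu⟩ := exists_δ_eq (neg_add_cancel 1) (Cochain.ofHom φ) (by simp) 0
    (N + 1) (N + 1) le_rfl (fun p q hpq hp hp' => (hN' p (by lia)).eq_of_src _ _)
    (fun p q hp hpq f _ => ⟨0, (hN' p (by lia)).eq_of_src _ _⟩)
    (fun p q hp hpq f hf => by
      obtain rfl : p = q := by lia
      rcases h p with h | h
      · exact ⟨0, h.eq_of_src _ _⟩
      · exact h.exists_lift (by lia) rfl f hf)
  exact quotient_map_eq_zero_of_δ_eq φ u hu

/-- Morphisms between complexes without common degrees vanish. -/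
lemma eq_zero_of_disjoint {K L : CochainComplex (ProjCat R) ℤ}
    (h : ∀ i, IsZero (K.X i) ∨ IsZero (L.X i))
    (φ : (HomotopyCategory.quotient _ _).obj K ⟶ (HomotopyCategory.quotient _ _).obj L) :
    φ = 0 := by
  obtain ⟨φ, rfl⟩ := (HomotopyCategory.quotient (ProjCat R) (.up ℤ)).map_surjective φ
  have : φ = 0 := by
    ext1 i
    rcases h i with h | h
    · exact h.eq_of_src _ _
    · exact h.eq_of_tgt _ _
  rw [this, Functor.map_zero]

lemma eq_zero_of_disjoint_shift_right {K L : CochainComplex (ProjCat R) ℤ} (n : ℤ)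
    (h : ∀ i, IsZero (K.X i) ∨ IsZero (L.X (i + n)))
    (φ : (HomotopyCategory.quotient _ _).obj K ⟶ ((HomotopyCategory.quotient _ _).obj L)⟦n⟧) :
    φ = 0 := by
  let e := ((HomotopyCategory.quotient (ProjCat R) (.up ℤ)).commShiftIso n).app L
  rw [← cancel_mono e.inv, eq_zero_of_disjoint (L := L⟦n⟧) h (φ ≫ e.inv), zero_comp]

lemma eq_zero_of_disjoint_shift_left {K L : CochainComplex (ProjCat R) ℤ} (n : ℤ)
    (h : ∀ i, IsZero (K.X (i + n)) ∨ IsZero (L.X i))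
    (φ : ((HomotopyCategory.quotient _ _).obj K)⟦n⟧ ⟶ (HomotopyCategory.quotient _ _).obj L) :
    φ = 0 := by
  let e := ((HomotopyCategory.quotient (ProjCat R) (.up ℤ)).commShiftIso n).app K
  rw [← cancel_epi e.hom, eq_zero_of_disjoint (K := K⟦n⟧) h (e.hom ≫ φ), comp_zero]

lemma ExactAt.shift {K : CochainComplex (ProjCat R) ℤ} {i : ℤ} (h : ExactAt K (i + 1)) :
    ExactAt (K⟦(1 : ℤ)⟧) i := by
  intro x
  have e₁ : ((K⟦(1 : ℤ)⟧).d i (i + 1)).hom x = -(K.d (i + 1) (i + 1 + 1)).hom x := by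
    have : (K⟦(1 : ℤ)⟧).d i (i + 1) = -K.d (i + 1) (i + 1 + 1) := by
      simp
    rw [this]
    rfl
  have e₂ (y : (K.X (i - 1 + 1)).obj) :
      ((K⟦(1 : ℤ)⟧).d (i - 1) i).hom y = -(K.d (i - 1 + 1) (i + 1)).hom y := by
    have : (K⟦(1 : ℤ)⟧).d (i - 1) i = -K.d (i - 1 + 1) (i + 1) := by
      simp
    rw [this]
    rfl
  have h' := h.exact (i := i - 1 + 1) (by lia) rfl x
  constructor
  · intro hx
    obtain ⟨y, hy⟩ := h'.1 (neg_eq_zero.1 (e₁.symm.trans hx))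
    exact ⟨-y, (e₂ (-y)).trans (by rw [map_neg, neg_neg, hy])⟩
  · rintro ⟨y, hy⟩
    exact e₁.trans (neg_eq_zero.2 (h'.2 ⟨-y, ((K.d (i - 1 + 1) (i + 1)).hom.hom.map_neg y).trans
      ((e₂ y).symm.trans hy)⟩))

lemma eq_zero_of_exactAt_shift {K L : CochainComplex (ProjCat R) ℤ} (hK : isBoundedComplex R K)
    (h : ∀ i, IsZero (K.X i) ∨ ExactAt L (i + 1))
    (φ : (HomotopyCategory.quotient _ _).obj K ⟶ ((HomotopyCategory.quotient _ _).obj L)⟦(1 : ℤ)⟧) :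
    φ = 0 := by
  let e := ((HomotopyCategory.quotient (ProjCat R) (.up ℤ)).commShiftIso (1 : ℤ)).app L
  have := eq_zero_of_exactAt (L := L⟦(1 : ℤ)⟧) hK (fun i => (h i).imp id ExactAt.shift)
    (φ ≫ e.inv)
  rw [← cancel_mono e.inv, this, zero_comp]

lemma subsingleton_of_isZero {P : ProjCat R} (h : IsZero P) : Subsingleton P.obj := by
  have h' : (𝟙 P : P ⟶ P) = 0 := h.eq_of_src _ _
  have h'' : ∀ x : P.obj, x = 0 := fun x => congrArg (fun f : P ⟶ P => f.hom x) h'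
  exact ⟨fun x y => (h'' x).trans (h'' y).symm⟩

lemma exactAt_of_isZero {K : CochainComplex (ProjCat R) ℤ} {i : ℤ} (h : IsZero (K.X i)) :
    ExactAt K i := by
  have := subsingleton_of_isZero h
  exact fun x => ⟨fun _ => ⟨0, Subsingleton.elim _ _⟩,
    fun _ => by rw [Subsingleton.elim x 0, map_zero]⟩

lemma isBoundedComplex.hasBoundedHomology {K : CochainComplex (ProjCat R) ℤ}
    (h : isBoundedComplex R K) :
    hasBoundedHomology R ((HomotopyCategory.quotient _ _).obj K) := by
  obtain ⟨N, hN⟩ := h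
  exact ⟨N, fun i hi => (exactAt_iff_isZero_homology _ _).1 (exactAt_of_isZero (hN i hi))⟩

lemma isBoundedComplex.isPerfect {K : CochainComplex (ProjCat R) ℤ}
    (h : isBoundedComplex R K) : isPerfect R ((HomotopyCategory.quotient _ _).obj K) :=
  ⟨K, h, ⟨Iso.refl _⟩⟩

/-- The cone of 0 ⟶ X is X, so the quotient functor inverts this map. -/
lemma isZero_Q_obj {X : KInfB R} (hX : kB R X) : IsZero ((KQuot.Q R).obj X) := by
  have h := ObjectProperty.trW.mk (kB R) (contractible_distinguished₁ X) hX
  have : IsIso ((KQuot.Q R).map (0 : 0 ⟶ X)) := Localization.inverts (KQuot.Q R) (kB R).trW _ h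
  exact (Functor.map_isZero (KQuot.Q R) (isZero_zero _)).of_iso
    (asIso ((KQuot.Q R).map (0 : 0 ⟶ X))).symm

end Vanishing

namespace MorE

/-! ### Full faithfulness in the Verdier quotient -/

section FullyFaithful

variable {R : Type u} [Ring R]

/-- A complex concentrated in degree `0` is a gluing of `P ⟶ 0`. -/
def gluingOfIsZero (K : CochainComplex (ProjCat R) ℤ) (h : ∀ i, i ≠ 0 → IsZero (K.X i)) :
    Gluing (zeroObj (K.X 0)) where
  cplx := K
  ρ := 𝟙 (K.X 0).obj
  ε := 0
  d_zero_one := by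
    rw [(h 1 one_ne_zero).eq_of_tgt (K.d 0 1) 0]
    rfl
  ρ_surj x := ⟨x, rfl⟩
  exact_zero x := by
    rw [(h (-1) (by lia)).eq_of_src (K.d (-1) 0) 0]
    exact ⟨fun hx => ⟨0, hx.symm⟩, fun ⟨y, hy⟩ => hy.symm⟩
  exact_neg i hi := exactAt_of_isZero (h i (by lia))
  ε_inj x y _ := rfl
  exact_one := by
    have := subsingleton_of_isZero (h 1 one_ne_zero)
    exact fun x => ⟨fun _ => ⟨0, Subsingleton.elim _ _⟩,
      fun _ => by rw [Subsingleton.elim x 0, map_zero]⟩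
  exact_pos i hi := exactAt_of_isZero (h i (by lia))

variable {α β : MorE R} (A : Gluing α) (B : Gluing β)

/-- A morphism between gluings that factors through a perfect complex comes from a morphism that
factors through an object `P ⟶ 0`. -/
lemma Gluing.exists_of_factors_perfect (hR : IsIwanagaGorenstein R) {X : KInfB R} (hX : kB R X)
    (a : A.toK ⟶ X) (b : X ⟶ B.toK) :
    ∃ (P : ProjCat R) (s : α ⟶ zeroObj P) (t : zeroObj P ⟶ β),
      A.toKMap hR B (s ≫ t) = a ≫ b := by
  obtain ⟨C, ⟨N, hN⟩, ⟨e⟩⟩ := hX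
  -- Maps from `A` into the part of C in degrees < 0 vanish because `A` is coexact there, so the
  -- first map lands in the part L in degrees ≥ 0.
  obtain ⟨L, M, i, p, h, hT, hL, hM, hL', hM'⟩ := exists_truncation_triangle C 0
  obtain ⟨a', ha'⟩ := exists_lift₁_of_distTriang hT (a.hom ≫ e.hom)
    (eq_zero_of_coexactAt ⟨N, fun i hi => hM' i (hN i hi)⟩
      (fun i => (le_or_gt 0 i).imp (hM i) fun hi => A.coexactAt hR i hi.ne) _)
  -- Maps from the part of L in degrees ≥ 1 to `B` vanish because `B` is exact there, so the second
  -- map descends to D, which lives in degree 0 only.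
  obtain ⟨L₁, D, i', p', h', hT', hL₁, hD, hL₁', hD'⟩ := exists_truncation_triangle L 1
  obtain ⟨b', hb'⟩ := exists_desc₃_of_distTriang hT'
    ((HomotopyCategory.quotient _ _).map i ≫ e.inv ≫ b.hom)
    (eq_zero_of_exactAt ⟨N, fun i hi => hL₁' i (hL' i (hN i hi))⟩
      (fun i => (lt_or_ge i 1).imp (hL₁ i) fun hi => B.exactAt i (by lia)) _)
  let E := gluingOfIsZero D fun i hi => by
    rcases hi.lt_or_gt with hi | hi
    · exact hD' i (hL i hi)
    · exact hD i hi
  let c : A.toK ⟶ E.toK := ObjectProperty.homMk (a' ≫ (HomotopyCategory.quotient _ _).map p')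
  let d : E.toK ⟶ B.toK := ObjectProperty.homMk b'
  obtain ⟨s, hs⟩ := A.toKMap_surjective E hR c
  obtain ⟨t, ht⟩ := E.toKMap_surjective B hR d
  refine ⟨D.X 0, s, t, ?_⟩
  rw [A.toKMap_comp hR E B, hs, ht]
  ext1
  change (a' ≫ (HomotopyCategory.quotient _ _).map p') ≫ b' = a.hom ≫ b.hom
  rw [Category.assoc, ← hb', ← reassoc_of% ha', e.hom_inv_id_assoc]

/-- Morphisms of the Verdier quotient between gluings come from `Mor^e(CM R)`. -/
lemma Gluing.exists_Q_map_eq (hR : IsIwanagaGorenstein R)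
    (φ : (KQuot.Q R).obj A.toK ⟶ (KQuot.Q R).obj B.toK) :
    ∃ f : α ⟶ β, (KQuot.Q R).map (A.toKMap hR B f) = φ := by
  obtain ⟨⟨u, s, hs⟩, rfl⟩ := Localization.exists_leftFraction (KQuot.Q R) (kB R).trW φ
  rename_i Y
  have := Localization.inverts (KQuot.Q R) (kB R).trW s hs
  obtain ⟨Z, g, h, hT, C, ⟨N, hN⟩, ⟨e⟩⟩ := hs
  obtain ⟨L, M, i, p, k, hT', hL, hM, hL', hM'⟩ := exists_truncation_triangle C 0
  have hLb : isBoundedComplex R L := ⟨N, fun i hi => hL' i (hN i hi)⟩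
  -- The numerator u, followed by the map g to the perfect cone Z of s, factors through the part L
  -- of that cone in degrees ≥ 0.
  obtain ⟨a, ha⟩ := exists_lift₁_of_distTriang hT' ((u ≫ g).hom ≫ e.hom)
    (eq_zero_of_coexactAt ⟨N, fun i hi => hM' i (hN i hi)⟩
      (fun i => (le_or_gt 0 i).imp (hM i) fun hi => A.coexactAt hR i hi.ne) _)
  let L' : KInfB R := ⟨_, hLb.hasBoundedHomology⟩
  have hL'' : kB R L' := hLb.isPerfect
  let a' : A.toK ⟶ L' := ObjectProperty.homMk a
  let j : L' ⟶ Z := ObjectProperty.homMk ((HomotopyCategory.quotient _ _).map i ≫ e.inv)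
  have haj : u ≫ g = a' ≫ j := by
    ext1
    change _ = a ≫ (HomotopyCategory.quotient _ _).map i ≫ e.inv
    rw [← reassoc_of% ha, e.hom_inv_id]
    exact (Category.comp_id _).symm
  -- L lives in degrees ≥ 0, and there the shift of `B` is exact because `B` is exact in degrees ≥
  -- 1.
  have hjh : j ≫ h = 0 := by
    ext1
    have := eq_zero_of_exactAt_shift hLb
      (fun i => (lt_or_ge i 0).imp (hL i) fun hi => B.exactAt (i + 1) (by lia))
      ((j ≫ h).hom ≫ ((IwanagaGorenstein.hasBoundedHomology R).ι.commShiftIso (1 : ℤ)).hom.app B.toK)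
    rw [← cancel_mono
      (((IwanagaGorenstein.hasBoundedHomology R).ι.commShiftIso (1 : ℤ)).hom.app B.toK)]
    exact this.trans zero_comp.symm
  obtain ⟨v, hv⟩ := exists_lift₂_of_distTriang hT j hjh
  -- Subtracting a map through the perfect complex L, which is zero in the quotient, makes the
  -- numerator divisible by s.
  obtain ⟨u', hu'⟩ := exists_lift₁_of_distTriang hT (u - a' ≫ v) (by
    change (u - a' ≫ v) ≫ g = 0
    rw [Preadditive.sub_comp, haj, hv, Category.assoc, sub_self])
  obtain ⟨f, hf⟩ := A.toKMap_surjective B hR u'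
  refine ⟨f, ?_⟩
  rw [hf, MorphismProperty.LeftFraction.map, ← cancel_mono ((KQuot.Q R).map s),
    Category.assoc, IsIso.inv_hom_id, Category.comp_id, ← Functor.map_comp, ← hu', Functor.map_sub,
    Functor.map_comp, (isZero_Q_obj hL'').eq_of_src ((KQuot.Q R).map v) 0, comp_zero, sub_zero]

lemma IsStandard.stableRel {q : MorE R} (hq : IsStandard q) {f g : α ⟶ β} (a : α ⟶ q) (b : q ⟶ β)
    (h : f - g = a ≫ b) : stableRel R f g :=
  ⟨q, a, b, hq.isProj, hq.isInj, h⟩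

/-- Morphisms of `Mor^e(CM R)` identified in the Verdier quotient are stably equal. -/
lemma Gluing.toStable_map_eq (hR : IsIwanagaGorenstein R) (f g : α ⟶ β)
    (h : (KQuot.Q R).map (A.toKMap hR B f) = (KQuot.Q R).map (A.toKMap hR B g)) :
    (toStable R).map f = (toStable R).map g := by
  obtain ⟨Z, s, hs, hs'⟩ := (MorphismProperty.map_eq_iff_postcomp (KQuot.Q R) (kB R).trW _ _).1 h
  -- The class of f - g factors through a perfect complex, hence agrees with that of a morphism
  -- through some P ⟶ 0. The remaining difference is null-homotopic and factors through some P' =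
  -- P'; both objects are projective-injective.
  obtain ⟨X, b, k, hT, hX⟩ := ((kB R).trW_iff' s).1 hs
  obtain ⟨a, ha⟩ := exists_lift₁_of_distTriang hT (A.toKMap hR B (f - g)) (by
    change A.toKMap hR B (f - g) ≫ s = 0
    rw [Gluing.toKMap_sub, Preadditive.sub_comp, hs', sub_self])
  obtain ⟨P, x, y, hxy⟩ := A.exists_of_factors_perfect B hR hX a b
  obtain ⟨P', x', y', hxy'⟩ := A.exists_factorization B hR (f - g - x ≫ y) (by
    rw [Gluing.toKMap_sub, hxy, ha]
    exact sub_self _)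
  trans (toStable R).map (g + x ≫ y)
  · exact CategoryTheory.Quotient.sound _ ((isStandard_idObj P').stableRel x' y' (by
      rw [← hxy']; abel))
  · exact CategoryTheory.Quotient.sound _ ((isStandard_zeroObj P).stableRel x y (by abel))

end FullyFaithful

end MorE

open CochainComplex.HomComplex

/-! ### Complexes concentrated in one degree -/

section Single

variable {R : Type u} [Ring R]

/-- The complex with `P` in degree `i`. -/
abbrev stalk (i : ℤ) (P : ProjCat R) : CochainComplex (ProjCat R) ℤ :=
  (HomologicalComplex.single (ProjCat R) (ComplexShape.up ℤ) i).obj P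

lemma isZero_stalk_X {i j : ℤ} (h : j ≠ i) (P : ProjCat R) : IsZero ((stalk i P).X j) :=
  HomologicalComplex.isZero_single_obj_X _ _ _ _ h

lemma isBoundedComplex_stalk (i : ℤ) (P : ProjCat R) : isBoundedComplex R (stalk i P) :=
  ⟨i.natAbs, fun j hj => isZero_stalk_X (by rintro rfl; simp at hj) P⟩

variable (K : CochainComplex (ProjCat R) ℤ) (i : ℤ)

lemma d_comp_eq_zero_of_rel {P : ProjCat R} (g : K.X i ⟶ P) (hg : K.d (i - 1) i ≫ g = 0) (j : ℤ)
    (hj : (ComplexShape.up ℤ).Rel j i) : K.d j i ≫ g = 0 := by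
  obtain rfl : j = i - 1 := by
    have : j + 1 = i := hj
    lia
  exact hg

lemma comp_d_eq_zero_of_rel {P : ProjCat R} (g : P ⟶ K.X i) (hg : g ≫ K.d i (i + 1) = 0) (j : ℤ)
    (hj : (ComplexShape.up ℤ).Rel i j) : g ≫ K.d i j = 0 := by
  obtain rfl : i + 1 = j := hj
  exact hg

/-- The morphism from a stalk complex given by a cocycle. -/
def fromStalk {P : ProjCat R} (g : P ⟶ K.X i) (hg : g ≫ K.d i (i + 1) = 0) : stalk i P ⟶ K :=
  HomologicalComplex.mkHomFromSingle g (comp_d_eq_zero_of_rel K i g hg)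

/-- The morphism to a stalk complex given by a cocycle. -/
def toStalk {P : ProjCat R} (g : K.X i ⟶ P) (hg : K.d (i - 1) i ≫ g = 0) : K ⟶ stalk i P :=
  HomologicalComplex.mkHomToSingle g (d_comp_eq_zero_of_rel K i g hg)

lemma exists_eq_fromStalk {P : ProjCat R} (φ : stalk i P ⟶ K) :
    ∃ (g : P ⟶ K.X i) (hg : g ≫ K.d i (i + 1) = 0), φ = fromStalk K i g hg := by
  refine ⟨(HomologicalComplex.singleObjXSelf _ i P).inv ≫ φ.f i, ?_, ?_⟩
  · rw [Category.assoc, φ.comm, (isZero_stalk_X (by lia) P).eq_of_tgt ((stalk i P).d i (i + 1)) 0,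
      zero_comp, comp_zero]
  · refine HomologicalComplex.from_single_hom_ext ?_
    rw [fromStalk, HomologicalComplex.mkHomFromSingle_f, Iso.hom_inv_id_assoc]

lemma exists_eq_toStalk {P : ProjCat R} (φ : K ⟶ stalk i P) :
    ∃ (g : K.X i ⟶ P) (hg : K.d (i - 1) i ≫ g = 0), φ = toStalk K i g hg := by
  refine ⟨φ.f i ≫ (HomologicalComplex.singleObjXSelf _ i P).hom, ?_, ?_⟩
  · rw [← Category.assoc, ← φ.comm,
      (isZero_stalk_X (by lia) P).eq_of_src ((stalk i P).d (i - 1) i) 0, comp_zero, zero_comp]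
  · refine HomologicalComplex.to_single_hom_ext ?_
    rw [toStalk, HomologicalComplex.mkHomToSingle_f, Category.assoc, Iso.hom_inv_id,
      Category.comp_id]

variable {K i}

lemma exists_δ_of_quotient_map_eq_zero {K L : CochainComplex (ProjCat R) ℤ} (φ : K ⟶ L)
    (h : (HomotopyCategory.quotient (ProjCat R) (.up ℤ)).map φ = 0) :
    ∃ z : Cochain K L (-1), Cochain.ofHom φ = δ (-1) 0 z := by
  rw [← (HomotopyCategory.quotient (ProjCat R) (.up ℤ)).map_zero] at h
  obtain ⟨z, hz⟩ := Cochain.equivHomotopy _ _ (HomotopyCategory.homotopyOfEq _ _ h)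
  exact ⟨z, by simpa using hz⟩

/-- A cycle x is a chain map from the stalk of R in degree i, and a null-homotopy evaluated at 1
gives a preimage of x. Exactness thus becomes a vanishing of morphisms that can be read off
triangles. -/
lemma exactAt_of_forall_eq_zero
    (h : ∀ (P : ProjCat R) (φ : (HomotopyCategory.quotient _ _).obj (stalk i P) ⟶
      (HomotopyCategory.quotient _ _).obj K), φ = 0) : ExactAt K i := by
  intro x
  refine ⟨fun hx => ?_, ?_⟩
  · let P : ProjCat R := ⟨rightRegular R, isFGProj_rightRegular R⟩
    let g : P ⟶ K.X i := ObjectProperty.homMk (ModuleCat.ofHom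
      ((LinearMap.toSpanSingleton Rᵐᵒᵖ (K.X i).obj x).comp (opEquivSelf R).symm.toLinearMap))
    have hg (r : R) : g.hom r = MulOpposite.op r • x := rfl
    have hgd : g ≫ K.d i (i + 1) = 0 := by
      ext1
      refine ModuleCat.hom_ext (LinearMap.ext fun (r : R) => ?_)
      change (K.d i (i + 1)).hom (g.hom r) = 0
      rw [hg, map_smul, hx, smul_zero]
    obtain ⟨z, hz⟩ := exists_δ_of_quotient_map_eq_zero (fromStalk K i g hgd) (h P _)
    have hz' := Cochain.congr_v hz i i (add_zero i)
    rw [Cochain.ofHom_v, δ_v (-1) 0 rfl z i i (add_zero i) (i - 1) (i + 1) rfl rfl,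
      (isZero_stalk_X (by lia) P).eq_of_tgt ((stalk i P).d i (i + 1)) 0, zero_comp, smul_zero,
      add_zero, fromStalk, HomologicalComplex.mkHomFromSingle_f, ← Iso.eq_inv_comp,
      ← Category.assoc] at hz'
    refine ⟨((HomologicalComplex.singleObjXSelf _ i P).inv ≫ z.v i (i - 1) rfl).hom (1 : R), ?_⟩
    have h₁ : g.hom (1 : R) = x := by rw [hg]; simp
    rw [← h₁, hz']
    rfl
  · rintro ⟨y, rfl⟩
    exact congrArg (fun f : (K.X (i - 1)).obj ⟶ (K.X (i + 1)).obj => f y)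
      (d_hom_comp_d_hom K (i - 1) i (i + 1))

/-- A map f with d ≫ f = 0 is a chain map to a stalk complex, and a null-homotopy is a factorisation
of f through the next differential. -/
lemma coexactAt_of_forall_eq_zero
    (h : ∀ (P : ProjCat R) (φ : (HomotopyCategory.quotient _ _).obj K ⟶
      (HomotopyCategory.quotient _ _).obj (stalk i P)), φ = 0) : CoexactAt K i := by
  intro P f hf
  obtain ⟨z, hz⟩ := exists_δ_of_quotient_map_eq_zero (toStalk K i f hf) (h P _)
  have hz' := Cochain.congr_v hz i i (add_zero i)
  rw [Cochain.ofHom_v, δ_v (-1) 0 rfl z i i (add_zero i) (i - 1) (i + 1) rfl rfl,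
    (isZero_stalk_X (by lia) P).eq_of_src ((stalk i P).d (i - 1) i) 0, comp_zero,
    Int.negOnePow_zero, one_smul, zero_add, toStalk, HomologicalComplex.mkHomToSingle_f,
    Iso.comp_inv_eq, Category.assoc] at hz'
  exact ⟨_, hz'.symm⟩

end Single

/-! ### Modifying complexes by perfect complexes -/

section Reduction

variable {R : Type u} [Ring R]

/-- A complex that is exact in degrees `> m` can be made exact in degree `m`. -/
lemma exists_exactAt_of_exactAt (hR : IsIwanagaGorenstein R) (K : CochainComplex (ProjCat R) ℤ)
    (c m : ℤ) (hcm : c < m) (h₁ : ∀ i, m < i → ExactAt K i) (h₂ : ∀ i < c, CoexactAt K i) :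
    ∃ (L : CochainComplex (ProjCat R) ℤ) (f : (HomotopyCategory.quotient _ _).obj K ⟶
      (HomotopyCategory.quotient _ _).obj L), (isPerfect R).trW f ∧
      (∀ i, m ≤ i → ExactAt L i) ∧ ∀ i < c, CoexactAt L i := by
  have := (K.X m).property.1
  have := hR.finite_ker (K.d m (m + 1)).hom
  obtain ⟨P₀, p, hP, hp⟩ := exists_cover (ModuleCat.of Rᵐᵒᵖ (LinearMap.ker (K.d m (m + 1)).hom.hom))
  let P : ProjCat R := ⟨P₀, hP⟩
  let ι := ModuleCat.ofHom (LinearMap.ker (K.d m (m + 1)).hom.hom).subtype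
  let g : P ⟶ K.X m := ObjectProperty.homMk (p ≫ ι)
  have hg : g ≫ K.d m (m + 1) = 0 := by
    ext1
    exact ModuleCat.hom_ext (LinearMap.ext fun x => (p x).2)
  have hg' {P' : ProjCat R} (f : P' ⟶ K.X m) (hf : f ≫ K.d m (m + 1) = 0) :
      ∃ f' : P' ⟶ P, f = f' ≫ g := by
    have hf₁ : f.hom ≫ (K.d m (m + 1)).hom = 0 := congrArg (fun f => f.hom) hf
    obtain ⟨k, hk⟩ : ∃ k : P'.obj ⟶ ModuleCat.of Rᵐᵒᵖ (LinearMap.ker (K.d m (m + 1)).hom.hom),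
        k ≫ ι = f.hom :=
      ⟨ModuleCat.ofHom (f.hom.hom.codRestrict _ fun x =>
        congrArg (fun f : P'.obj ⟶ (K.X (m + 1)).obj => f x) hf₁), rfl⟩
    obtain ⟨l, hl⟩ := exists_lift_of_surjective P'.property p hp k
    refine ⟨ObjectProperty.homMk l, ?_⟩
    ext1
    change f.hom = l ≫ p ≫ ι
    rw [reassoc_of% hl, hk]
  -- Coning off the stalk that covers Ker dᵐ kills the cohomology in degree m. The shifted stalk
  -- lives in degree m - 1, hence receives no maps from stalks in degrees ≥ m.
  obtain ⟨X, a, b, hT⟩ := distinguished_cocone_triangle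
    ((HomotopyCategory.quotient _ _).map (fromStalk K m g hg))
  obtain ⟨L, rfl⟩ := HomotopyCategory.quotient_obj_surjective X
  have hab := comp_distTriang_mor_zero₁₂ _ hT
  refine ⟨L, a, ObjectProperty.trW.mk' _ hT (isBoundedComplex_stalk m P).isPerfect, ?_, ?_⟩
  · intro i hi
    refine exactAt_of_forall_eq_zero fun P' φ => ?_
    obtain ⟨ψ, rfl⟩ := exists_lift₂_of_distTriang hT φ (eq_zero_of_disjoint_shift_right 1
      (fun j => or_iff_not_imp_left.2 fun hj => isZero_stalk_X (fun hj' =>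
        hj (isZero_stalk_X (by lia) P')) P) _)
    rcases hi.eq_or_lt with rfl | hi
    · obtain ⟨ψ, rfl⟩ := (HomotopyCategory.quotient (ProjCat R) (.up ℤ)).map_surjective ψ
      obtain ⟨f, hf, rfl⟩ := exists_eq_fromStalk K m ψ
      obtain ⟨f', rfl⟩ := hg' f hf
      have : fromStalk K m (f' ≫ g) hf =
          (HomologicalComplex.single (ProjCat R) (ComplexShape.up ℤ) m).map f' ≫
            fromStalk K m g hg := by
        refine HomologicalComplex.from_single_hom_ext ?_
        rw [HomologicalComplex.comp_f, fromStalk, HomologicalComplex.mkHomFromSingle_f, fromStalk,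
          HomologicalComplex.mkHomFromSingle_f, HomologicalComplex.single_map_f_self]
        simp
      rw [this, Functor.map_comp, Category.assoc]
      exact (congrArg _ hab).trans comp_zero
    · rw [eq_zero_of_exactAt (isBoundedComplex_stalk i P') (fun j => or_iff_not_imp_left.2 fun hj =>
        h₁ j (by
          by_contra hj'
          exact hj (isZero_stalk_X (by lia) P'))) ψ, zero_comp]
  · intro i hi
    refine coexactAt_of_forall_eq_zero fun P' φ => ?_
    -- A map from L to a stalk in degree i < c vanishes on K, so it comes from the shifted stalk in
    -- degree m - 1. Since c < m, that degree differs from i.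
    obtain ⟨ψ, rfl⟩ := exists_desc₃_of_distTriang (rot_of_distTriang _ hT) φ
      (eq_zero_of_coexactAt (isBoundedComplex_stalk i P') (fun j => or_iff_not_imp_left.2 fun hj =>
        h₂ j (by
          by_contra hj'
          exact hj (isZero_stalk_X (by lia) P'))) _)
    have : ψ = 0 := eq_zero_of_disjoint_shift_left 1
      (fun j => or_iff_not_imp_left.2 fun hj => isZero_stalk_X (fun hj' =>
        hj (isZero_stalk_X (by lia) P)) P') ψ
    rw [this, comp_zero]
    rfl

/-- A complex that is coexact in degrees `< m` can be made coexact in degree `m`. -/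
lemma exists_coexactAt_of_coexactAt (hR : IsIwanagaGorenstein R)
    (K : CochainComplex (ProjCat R) ℤ)
    (c m : ℤ) (hcm : m < c) (h₁ : ∀ i, c < i → ExactAt K i) (h₂ : ∀ i < m, CoexactAt K i) :
    ∃ (L : CochainComplex (ProjCat R) ℤ) (f : (HomotopyCategory.quotient _ _).obj L ⟶
      (HomotopyCategory.quotient _ _).obj K), (isPerfect R).trW f ∧
      (∀ i, c < i → ExactAt L i) ∧ ∀ i ≤ m, CoexactAt L i := by
  have := (K.X m).property.1
  have := hR.left_noetherian
  obtain ⟨P₀, p, hP, hp⟩ := exists_left_approximation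
    (ModuleCat.of Rᵐᵒᵖ ((K.X m).obj ⧸ LinearMap.range (K.d (m - 1) m).hom.hom))
  let P : ProjCat R := ⟨P₀, hP⟩
  let π := ModuleCat.ofHom (LinearMap.range (K.d (m - 1) m).hom.hom).mkQ
  let g : K.X m ⟶ P := ObjectProperty.homMk (π ≫ p)
  have hπ : (K.d (m - 1) m).hom ≫ π = 0 :=
    ModuleCat.hom_ext (LinearMap.ext fun x => (Submodule.Quotient.mk_eq_zero _).2 ⟨x, rfl⟩)
  have hg : K.d (m - 1) m ≫ g = 0 := by
    ext1
    change (K.d (m - 1) m).hom ≫ π ≫ p = 0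
    rw [reassoc_of% hπ, zero_comp]
  have hg' {P' : ProjCat R} (f : K.X m ⟶ P') (hf : K.d (m - 1) m ≫ f = 0) :
      ∃ f' : P ⟶ P', f = g ≫ f' := by
    have hf₁ : (K.d (m - 1) m).hom ≫ f.hom = 0 := congrArg (fun f => f.hom) hf
    obtain ⟨k, hk⟩ : ∃ k : ModuleCat.of Rᵐᵒᵖ
        ((K.X m).obj ⧸ LinearMap.range (K.d (m - 1) m).hom.hom) ⟶ P'.obj, π ≫ k = f.hom :=
      ⟨ModuleCat.ofHom (Submodule.liftQ _ f.hom.hom (by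
        rintro _ ⟨x, rfl⟩
        exact congrArg (fun f : (K.X (m - 1)).obj ⟶ P'.obj => f x) hf₁)), rfl⟩
    obtain ⟨l, hl⟩ := hp P'.obj P'.property k
    refine ⟨ObjectProperty.homMk l, ?_⟩
    ext1
    change f.hom = (π ≫ p) ≫ l
    rw [Category.assoc, hl, hk]
  -- Dually, the cocone of the approximation of Coker d^{m-1} is taken: every map from K to a stalk
  -- in degree m factors through it. The stalk moves to degree m + 1, and m < c keeps it away from
  -- degrees > c.
  obtain ⟨X, a, b, hT⟩ := distinguished_cocone_triangle₁
    ((HomotopyCategory.quotient _ _).map (toStalk K m g hg))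
  obtain ⟨L, rfl⟩ := HomotopyCategory.quotient_obj_surjective X
  have hab := comp_distTriang_mor_zero₁₂ _ hT
  refine ⟨L, a, ObjectProperty.trW.mk _ hT (isBoundedComplex_stalk m P).isPerfect, ?_, ?_⟩
  · intro i hi
    refine exactAt_of_forall_eq_zero fun P' φ => ?_
    obtain ⟨ψ, rfl⟩ := exists_lift₁_of_distTriang (inv_rot_of_distTriang _ hT) φ
      (eq_zero_of_exactAt (isBoundedComplex_stalk i P') (fun j => or_iff_not_imp_left.2 fun hj =>
        h₁ j (by
          by_contra hj'
          exact hj (isZero_stalk_X (by lia) P'))) _)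
    have : ψ = 0 := eq_zero_of_disjoint_shift_right (-1)
      (fun j => or_iff_not_imp_left.2 fun hj => isZero_stalk_X (fun hj' =>
        hj (isZero_stalk_X (by lia) P')) P) ψ
    rw [this, zero_comp]
    rfl
  · intro i hi
    refine coexactAt_of_forall_eq_zero fun P' φ => ?_
    obtain ⟨ψ, rfl⟩ := exists_desc₃_of_distTriang (inv_rot_of_distTriang _ hT) φ
      (eq_zero_of_disjoint_shift_left (-1)
      (fun j => or_iff_not_imp_left.2 fun hj => isZero_stalk_X (fun hj' =>
        hj (isZero_stalk_X (by lia) P)) P') _)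
    rcases hi.eq_or_lt with rfl | hi
    · obtain ⟨ψ, rfl⟩ := (HomotopyCategory.quotient (ProjCat R) (.up ℤ)).map_surjective ψ
      obtain ⟨f, hf, rfl⟩ := exists_eq_toStalk K i ψ
      obtain ⟨f', rfl⟩ := hg' f hf
      have : toStalk K i (g ≫ f') hf = toStalk K i g hg ≫
          (HomologicalComplex.single (ProjCat R) (ComplexShape.up ℤ) i).map f' := by
        refine HomologicalComplex.to_single_hom_ext ?_
        rw [HomologicalComplex.comp_f, toStalk, HomologicalComplex.mkHomToSingle_f, toStalk,
          HomologicalComplex.mkHomToSingle_f, HomologicalComplex.single_map_f_self]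
        simp
      rw [this, Functor.map_comp]
      change a ≫ _ ≫ _ = 0
      exact (reassoc_of% hab) _ |>.trans zero_comp
    · have : ψ = 0 := eq_zero_of_coexactAt (isBoundedComplex_stalk i P')
        (fun j => or_iff_not_imp_left.2 fun hj => h₂ j (by
          by_contra hj'
          exact hj (isZero_stalk_X (by lia) P'))) ψ
      exact (congrArg (a ≫ ·) this).trans comp_zero

end Reduction

/-! ### Essential surjectivity -/

section EssSurj

variable {R : Type u} [Ring R]

/-- Keeps the modified complexes in K^{∞,b}: coexactness in all sufficiently negative degrees gives
exactness there, by finite left injective dimension. -/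
lemma hasBoundedHomology_of_exactAt (hR : IsIwanagaGorenstein R)
    {K : CochainComplex (ProjCat R) ℤ} (c m : ℤ) (h₁ : ∀ i, m < i → ExactAt K i)
    (h₂ : ∀ i < c, CoexactAt K i) :
    hasBoundedHomology R ((HomotopyCategory.quotient _ _).obj K) := by
  obtain ⟨e, _⟩ := hR.left_idim
  refine ⟨c.natAbs + m.natAbs, fun i hi => (exactAt_iff_isZero_homology _ _).1 ?_⟩
  rcases abs_cases i with h | h
  · exact h₁ i (by lia)
  · exact exactAt_of_coexactAt (e := e) i fun j hj => h₂ j (by lia)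

lemma nonempty_iso_of_trW {X Y : KInfB R} (f : X.obj ⟶ Y.obj) (hf : (isPerfect R).trW f) :
    Nonempty ((KQuot.Q R).obj X ≅ (KQuot.Q R).obj Y) := by
  let g : X ⟶ Y := ObjectProperty.homMk f
  have hg : (kB R).trW g := by
    rw [ObjectProperty.inverseImage_trW_iff]
    exact hf
  have := Localization.inverts (KQuot.Q R) (kB R).trW g hg
  exact ⟨asIso ((KQuot.Q R).map g)⟩

lemma exists_iso_of_exactAt (hR : IsIwanagaGorenstein R) (c : ℤ) (hc : c ≤ 0) (n : ℕ) :
    ∀ (K : CochainComplex (ProjCat R) ℤ)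
      (hK : hasBoundedHomology R ((HomotopyCategory.quotient _ _).obj K)),
      (∀ i : ℤ, n < i → ExactAt K i) → (∀ i < c, CoexactAt K i) →
      ∃ (L : CochainComplex (ProjCat R) ℤ)
        (hL : hasBoundedHomology R ((HomotopyCategory.quotient _ _).obj L)),
        (∀ i : ℤ, 0 < i → ExactAt L i) ∧ (∀ i < c, CoexactAt L i) ∧
        Nonempty ((KQuot.Q R).obj ⟨_, hK⟩ ≅ (KQuot.Q R).obj ⟨_, hL⟩) := by
  induction n with
  | zero => exact fun K hK h₁ h₂ => ⟨K, hK, h₁, h₂, ⟨Iso.refl _⟩⟩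
  | succ n ih =>
    intro K hK h₁ h₂
    obtain ⟨L, f, hf, h₁', h₂'⟩ := exists_exactAt_of_exactAt hR K c (n + 1 : ℕ) (by lia) h₁ h₂
    have hL := hasBoundedHomology_of_exactAt hR c n (fun i hi => h₁' i (by lia)) h₂'
    obtain ⟨M, hM, h₁'', h₂'', ⟨e⟩⟩ := ih L hL (fun i hi => h₁' i (by lia)) h₂'
    obtain ⟨e'⟩ := nonempty_iso_of_trW (X := ⟨_, hK⟩) (Y := ⟨_, hL⟩) f hf
    exact ⟨M, hM, h₁'', h₂'', ⟨e' ≪≫ e⟩⟩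

lemma exists_iso_of_coexactAt (hR : IsIwanagaGorenstein R) (n : ℕ) :
    ∀ (K : CochainComplex (ProjCat R) ℤ)
      (hK : hasBoundedHomology R ((HomotopyCategory.quotient _ _).obj K)),
      (∀ i : ℤ, 0 < i → ExactAt K i) → (∀ i : ℤ, i < -n → CoexactAt K i) →
      ∃ (L : CochainComplex (ProjCat R) ℤ)
        (hL : hasBoundedHomology R ((HomotopyCategory.quotient _ _).obj L)),
        (∀ i : ℤ, 0 < i → ExactAt L i) ∧ (∀ i : ℤ, i < 0 → CoexactAt L i) ∧
        Nonempty ((KQuot.Q R).obj ⟨_, hK⟩ ≅ (KQuot.Q R).obj ⟨_, hL⟩) := by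
  induction n with
  | zero => exact fun K hK h₁ h₂ => ⟨K, hK, h₁, by simpa using h₂, ⟨Iso.refl _⟩⟩
  | succ n ih =>
    intro K hK h₁ h₂
    obtain ⟨L, f, hf, h₁', h₂'⟩ := exists_coexactAt_of_coexactAt hR K 0 (-(n + 1 : ℕ)) (by lia) h₁ h₂
    have hL := hasBoundedHomology_of_exactAt hR (-n) 0 h₁' (fun i hi => h₂' i (by lia))
    obtain ⟨M, hM, h₁'', h₂'', ⟨e⟩⟩ := ih L hL h₁' (fun i hi => h₂' i (by lia))
    obtain ⟨e'⟩ := nonempty_iso_of_trW (X := ⟨_, hL⟩) (Y := ⟨_, hK⟩) f hf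
    exact ⟨M, hM, h₁'', h₂'', ⟨e'.symm ≪≫ e⟩⟩

/-- Every object of the Verdier quotient is represented by a complex that is exact in positive
degrees and coexact in negative degrees. -/
lemma exists_iso_exactAt_coexactAt (hR : IsIwanagaGorenstein R) (K : CochainComplex (ProjCat R) ℤ)
    (hK : hasBoundedHomology R ((HomotopyCategory.quotient _ _).obj K)) :
    ∃ (L : CochainComplex (ProjCat R) ℤ)
      (hL : hasBoundedHomology R ((HomotopyCategory.quotient _ _).obj L)),
      (∀ i : ℤ, 0 < i → ExactAt L i) ∧ (∀ i : ℤ, i < 0 → CoexactAt L i) ∧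
      Nonempty ((KQuot.Q R).obj ⟨_, hK⟩ ≅ (KQuot.Q R).obj ⟨_, hL⟩) := by
  obtain ⟨N, hN⟩ := id hK
  have hN' (i : ℤ) (hi : N < |i|) : ExactAt K i := (exactAt_iff_isZero_homology _ _).2 (hN i hi)
  obtain ⟨e, _⟩ := hR.right_idim
  -- Coexactness in degree i needs exactness in degrees i, …, i + e + 2, and these stay below -N
  -- when i < -(N + e + 3).
  obtain ⟨L, hL, h₁, h₂, ⟨f⟩⟩ := exists_iso_of_exactAt hR (-(N + e + 3 : ℕ)) (by lia) N K hK
    (fun i hi => hN' i (by rwa [abs_of_pos (by lia)]))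
    (fun i hi => coexactAt_of_exactAt (e := e) i fun j hj hj' =>
      hN' j (by rw [abs_of_neg (by push_cast at hi; lia)]; push_cast at hi; lia))
  obtain ⟨M, hM, h₁', h₂', ⟨g⟩⟩ := exists_iso_of_coexactAt hR (N + e + 3) L hL h₁ h₂
  exact ⟨M, hM, h₁', h₂', ⟨f ≪≫ g⟩⟩

/-- The modules resolved by a complex that is exact and coexact have no extensions by `R`. -/
lemma subsingleton_ext_of_coexactAt (K : CochainComplex (ProjCat R) ℤ) (n : ℕ) :
    ∀ (j : ℤ) (X : RMod R) (ρ : (K.X j).obj ⟶ X), Function.Surjective ρ →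
      Function.Exact (K.d (j - 1) j).hom ρ → (∀ i < j, ExactAt K i) → (∀ i < j, CoexactAt K i) →
      Subsingleton (Abelian.Ext X (rightRegular R) (n + 1)) := by
  induction n with
  | zero =>
    intro j X ρ hρ h h₁ h₂
    -- It suffices to extend maps `u` from Ker ρ to R. Pulled back to degree j - 1, such a map kills
    -- the incoming differential, and coexactness extends it to degree j. Higher extension groups
    -- follow by shifting to the syzygy Ker ρ.
    refine (isSES_ker ρ hρ).subsingleton_ext_one
      (extVanishes_of_isFGProj (K.X j).property _ 1 one_pos) fun u => ?_
    let g : (K.X (j - 1)).obj ⟶ ModuleCat.of Rᵐᵒᵖ (LinearMap.ker ρ.hom) :=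
      ModuleCat.ofHom ((K.d (j - 1) j).hom.hom.codRestrict _ fun x => h.apply_apply_eq_zero x)
    have hg : Function.Surjective g := by
      rintro ⟨y, hy⟩
      obtain ⟨x, rfl⟩ := (h y).1 hy
      exact ⟨x, rfl⟩
    have := (ModuleCat.epi_iff_surjective _).2 hg
    obtain ⟨v, hv⟩ := (h₂ (j - 1) (by lia)).exists_factor (i := j - 1 - 1) (k := j) (by lia)
      (by lia) (P := ⟨rightRegular R, isFGProj_rightRegular R⟩) (ObjectProperty.homMk (g ≫ u)) (by
        ext1
        refine ModuleCat.hom_ext (LinearMap.ext fun x => ?_)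
        change u (g ((K.d (j - 1 - 1) (j - 1)).hom x)) = 0
        have : g ((K.d (j - 1 - 1) (j - 1)).hom x) = 0 := Subtype.ext (congrArg
          (fun f : (K.X (j - 1 - 1)).obj ⟶ (K.X j).obj => f x)
          (d_hom_comp_d_hom K (j - 1 - 1) (j - 1) j))
        rw [this, map_zero])
    refine ⟨v.hom, ?_⟩
    rw [← cancel_epi g]
    exact congrArg (fun f => f.hom) hv
  | succ n ih =>
    intro j X ρ hρ h h₁ h₂
    refine (isSES_ker ρ hρ).subsingleton_ext_right _ _ ?_
      (extVanishes_of_isFGProj (K.X j).property _ _ (by lia))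
    refine ih (j - 1) _ (ModuleCat.ofHom ((K.d (j - 1) j).hom.hom.codRestrict _
      fun x => h.apply_apply_eq_zero x)) ?_ ?_ (fun i hi => h₁ i (by lia))
      (fun i hi => h₂ i (by lia))
    · rintro ⟨y, hy⟩
      obtain ⟨x, rfl⟩ := (h y).1 hy
      exact ⟨x, rfl⟩
    · intro x
      refine Iff.trans ?_ ((h₁ (j - 1) (by lia)).exact (i := j - 1 - 1) (by lia) (k := j)
        (by lia) x)
      exact ⟨fun hx => congrArg Subtype.val hx, fun hx => Subtype.ext hx⟩

namespace MorE

/-- A complex that is exact in positive degrees and coexact in negative degrees is a gluing. -/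
lemma exists_gluing_of_exactAt (hR : IsIwanagaGorenstein R) (K : CochainComplex (ProjCat R) ℤ)
    (h₁ : ∀ i : ℤ, 0 < i → ExactAt K i) (h₂ : ∀ i : ℤ, i < 0 → CoexactAt K i) :
    ∃ (α : MorE R) (A : Gluing α), A.cplx = K := by
  obtain ⟨e, _⟩ := hR.left_idim
  obtain ⟨e', _⟩ := hR.right_idim
  have h₃ (i : ℤ) (hi : i < 0) : ExactAt K i :=
    exactAt_of_coexactAt (e := e) i fun j hj => h₂ j (by lia)
  have := (K.X 0).property.1
  have := (K.X 1).property.1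
  have := hR.finite_ker (K.d 1 2).hom
  -- X = Coker d⁻¹ has no extensions by R because K is coexact to the left, T = Ker d¹ because K is
  -- exact to the right. Surjectivity of X ⟶ T is exactness in degree 1.
  let X : RMod R := ModuleCat.of Rᵐᵒᵖ ((K.X 0).obj ⧸ LinearMap.range (K.d (-1) 0).hom.hom)
  let T : RMod R := ModuleCat.of Rᵐᵒᵖ (LinearMap.ker (K.d 1 2).hom.hom)
  let ρ : (K.X 0).obj ⟶ X := ModuleCat.ofHom (LinearMap.range (K.d (-1) 0).hom.hom).mkQ
  let ε : T ⟶ (K.X 1).obj := ModuleCat.ofHom (LinearMap.ker (K.d 1 2).hom.hom).subtype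
  let a : X ⟶ T := ModuleCat.ofHom (Submodule.liftQ _ ((K.d 0 1).hom.hom.codRestrict _ fun x =>
    congrArg (fun f : (K.X 0).obj ⟶ (K.X 2).obj => f x) (d_hom_comp_d_hom K 0 1 2)) (by
      rintro _ ⟨x, rfl⟩
      exact Subtype.ext (congrArg (fun f : (K.X (-1)).obj ⟶ (K.X 1).obj => f x)
        (d_hom_comp_d_hom K (-1) 0 1))))
  have hρ : Function.Surjective ρ := Submodule.mkQ_surjective _
  have hρ' : Function.Exact (K.d (-1) 0).hom ρ := fun x => Submodule.Quotient.mk_eq_zero _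
  have haε : (K.d 0 1).hom = ρ ≫ a ≫ ε := rfl
  have hX : isCM R X := by
    refine ⟨hR.finitePresentation _, fun k hk => ?_⟩
    obtain ⟨k, rfl⟩ := Nat.exists_eq_add_of_lt hk
    rw [zero_add]
    exact subsingleton_ext_of_coexactAt K k 0 X ρ hρ hρ' h₃ h₂
  have hT : isCM R T := by
    refine ⟨hR.finitePresentation _, ?_⟩
    exact extVanishes_ker_of_exact (e := e') (fun n => (K.X (1 + n)).obj)
      (fun n => (K.d (1 + n) (1 + (n + 1 : ℕ))).hom)
      (fun n => extVanishes_of_isFGProj (K.X (1 + n)).property _)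
      (fun n => (h₁ (1 + (n + 1 : ℕ)) (by lia)).exact (by push_cast; ring) (by push_cast; ring))
      (Y := rightRegular R) 0
  have ha : Function.Surjective a := by
    rintro ⟨y, hy⟩
    obtain ⟨x, rfl⟩ := ((h₁ 1 one_pos).exact (i := 0) (k := 2) rfl rfl y).1 hy
    exact ⟨ρ x, rfl⟩
  exact ⟨mkObj a hX hT ha,
    { cplx := K
      ρ := ρ
      ε := ε
      d_zero_one := haε
      ρ_surj := hρ
      exact_zero := hρ'
      exact_neg i hi := h₃ i hi
      ε_inj := Subtype.val_injective
      exact_one x := ⟨fun hx => ⟨⟨x, hx⟩, rfl⟩, fun ⟨y, hy⟩ => hy ▸ y.2⟩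
      exact_pos i hi := h₁ i (by lia) }, rfl⟩

/-- Every object of the Verdier quotient is represented by a gluing. -/
lemma exists_gluing_iso (hR : IsIwanagaGorenstein R) (X : KQuot R) :
    ∃ (α : MorE R) (A : Gluing α), Nonempty ((KQuot.Q R).obj A.toK ≅ X) := by
  have : (KQuot.Q R).EssSurj := Localization.essSurj (KQuot.Q R) (kB R).trW
  obtain ⟨Y, hY⟩ : ∃ Y, Nonempty ((KQuot.Q R).obj Y ≅ X) := ⟨_, ⟨(KQuot.Q R).objObjPreimageIso X⟩⟩
  obtain ⟨e⟩ := hY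
  obtain ⟨Y, hY⟩ := Y
  obtain ⟨K, rfl⟩ := HomotopyCategory.quotient_obj_surjective Y
  obtain ⟨L, hL, h₁, h₂, ⟨e'⟩⟩ := exists_iso_exactAt_coexactAt hR K hY
  obtain ⟨α, A, rfl⟩ := exists_gluing_of_exactAt hR L h₁ h₂
  exact ⟨α, A, ⟨e'.symm ≪≫ e⟩⟩

end MorE

end EssSurj

namespace MorE

open CochainComplex.HomComplex

/-! ### The induced functor on the stable category -/

section Induced

variable {R : Type u} [Ring R]

/-- Lifts of morphisms that factor as `X ⟶ T ⟶ F^0 ⟶ X' ⟶ T'` are homotopic to zero. -/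
lemma Gluing.toKMap_eq_zero (hR : IsIwanagaGorenstein R) {α β : MorE R} (A : Gluing α)
    (B : Gluing β) (f : α ⟶ β) (s : α.tgt ⟶ (B.cplx.X 0).obj) (h₁ : onSrc f = α.arr ≫ s ≫ B.ρ)
    (h₂ : onTgt f = s ≫ B.ρ ≫ β.arr) : A.toKMap hR B f = 0 := by
  -- The homotopy starts with one component F¹ ⟶ F⁰, extending s along `ε`. It accounts for φ modulo
  -- Ker ρ in degree 0 and on the image of `ε` in degree 1, the two edge conditions.
  obtain ⟨t, ht⟩ := A.exists_extension_ε hR (P := B.cplx.X 0) s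
  obtain ⟨φ, hφ⟩ := A.exists_isLift B hR f
  let u : Cochain A.cplx B.cplx (-1) := Cochain.single t (-1)
  have hu : u.v 1 0 rfl = t := Cochain.single_v _ _ _
  have hu' (p q : ℤ) (hpq : p + (-1) = q) (hp : p ≠ 1) : u.v p q hpq = 0 :=
    Cochain.single_v_eq_zero _ _ _ _ _ hp
  have e₀ : (δ (-1) 0 u).v 0 0 rfl = A.cplx.d 0 1 ≫ t := by
    rw [δ_v (-1) 0 rfl u 0 0 rfl (-1) 1 rfl rfl, hu, hu' 0 _ _ zero_ne_one, zero_comp, zero_add,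
      Int.negOnePow_zero, one_smul]
  have e₁ : (δ (-1) 0 u).v 1 1 rfl = t ≫ B.cplx.d 0 1 := by
    rw [δ_v (-1) 0 rfl u 1 1 rfl 0 2 rfl rfl, hu, hu' 2 _ _ (by norm_num), comp_zero, smul_zero,
      add_zero]
  obtain ⟨u', -, hu'⟩ := A.exists_δ_eq hR B (neg_add_cancel 1) le_rfl (Cochain.ofHom φ)
    (by simp) u (by intro p q _ _ _; omega) (by
      change ((φ.f 0).hom - ((δ (-1) 0 u).v 0 0 rfl).hom) ≫ B.ρ = 0
      rw [e₀]
      change ((φ.f 0).hom - (A.cplx.d 0 1).hom ≫ t.hom) ≫ B.ρ = 0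
      rw [Preadditive.sub_comp, hφ.src, h₁, A.d_zero_one]
      simp only [Category.assoc]
      rw [reassoc_of% ht, sub_self]) (by
      change A.ε ≫ ((φ.f 1).hom - ((δ (-1) 0 u).v 1 1 rfl).hom) = 0
      rw [e₁]
      change A.ε ≫ ((φ.f 1).hom - t.hom ≫ (B.cplx.d 0 1).hom) = 0
      rw [Preadditive.comp_sub, hφ.tgt, h₂, reassoc_of% ht, B.d_zero_one]
      simp only [Category.assoc]
      rw [sub_self])
  rw [hφ.toKMap_eq hR]
  ext1
  exact quotient_map_eq_zero_of_δ_eq _ u' hu'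

/-- Gluings of objects `P = P` are contractible. -/
lemma Gluing.toKMap_id_eq_zero (hR : IsIwanagaGorenstein R) {P : ProjCat R}
    (A : Gluing (idObj P)) : A.toKMap hR A (𝟙 _) = 0 := by
  obtain ⟨s, hs⟩ := A.exists_lift_ρ (P := P) (𝟙 P.obj)
  refine A.toKMap_eq_zero hR A (𝟙 _) s.hom ?_ ?_
  · exact ((Category.id_comp _).trans hs).symm
  · exact ((Category.assoc _ _ _).symm.trans ((Category.comp_id _).trans hs)).symm

/-- Gluings of projective-injective objects vanish in the Verdier quotient. -/
lemma Gluing.isZero_Q_obj (hR : IsIwanagaGorenstein R) {q : MorE R} (hq : IsStandard q)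
    (B : Gluing q) : IsZero ((KQuot.Q R).obj B.toK) := by
  obtain ⟨t, ht⟩ := exists_lift_of_surjective hq.2 q.arr q.arr_surj (𝟙 q.tgt)
  let T : ProjCat R := ⟨q.tgt, hq.2⟩
  let X : ProjCat R := ⟨q.src, hq.1⟩
  obtain ⟨A⟩ := exists_gluing hR (idObj T)
  let e : (stalk 0 X).X 0 ≅ X := HomologicalComplex.singleObjXSelf _ 0 X
  let E := gluingOfIsZero (stalk 0 X) fun i hi => isZero_stalk_X hi X
  let a : q ⟶ idObj T := mkHom q.arr (𝟙 _) rfl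
  let b : idObj T ⟶ q := mkHom t (𝟙 _) (ht.trans (Category.comp_id _).symm)
  let c : q ⟶ zeroObj ((stalk 0 X).X 0) := mkHom e.inv.hom 0 rfl
  let d : zeroObj ((stalk 0 X).X 0) ⟶ q := mkHom (e.hom.hom ≫ (𝟙 _ - q.arr ≫ t)) 0 (by
    change (e.hom.hom ≫ (𝟙 _ - q.arr ≫ t)) ≫ q.arr = _
    rw [Category.assoc, Preadditive.sub_comp, Category.assoc, ht, Category.comp_id,
      Category.id_comp, sub_self, comp_zero, comp_zero]
    rfl)
  have hE : IsZero ((KQuot.Q R).obj E.toK) :=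
    IwanagaGorenstein.isZero_Q_obj (isBoundedComplex_stalk 0 X).isPerfect
  -- The identity of q is a sum of maps through T = T, whose gluing is contractible, and through an
  -- object P ⟶ 0, glued by a stalk complex.
  have hab : 𝟙 q - a ≫ b = c ≫ d := by
    refine hom_ext ?_ ?_
    · change 𝟙 _ - q.arr ≫ t = e.inv.hom ≫ e.hom.hom ≫ (𝟙 _ - q.arr ≫ t)
      have : e.inv.hom ≫ e.hom.hom = 𝟙 X.obj := congrArg (fun f => f.hom) e.inv_hom_id
      rw [reassoc_of% this]
    · change 𝟙 _ - 𝟙 _ ≫ 𝟙 _ = 0 ≫ 0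
      rw [Category.comp_id, sub_self, comp_zero]
  have h := B.toKMap_sub hR B (𝟙 q) (a ≫ b)
  rw [hab, B.toKMap_comp hR E B, B.toKMap_comp hR A B, B.toKMap_id] at h
  have hA : B.toKMap hR A a = 0 := by
    rw [← Category.comp_id a, B.toKMap_comp hR A A, A.toKMap_id_eq_zero, comp_zero]
  rw [hA, zero_comp, sub_zero] at h
  rw [IsZero.iff_id_eq_zero, ← (KQuot.Q R).map_id, ← h, Functor.map_comp,
    hE.eq_of_tgt ((KQuot.Q R).map (B.toKMap hR E c)) 0, zero_comp]

lemma map_eq_of_stableRel (hR : IsIwanagaGorenstein R) (G : ∀ α : MorE R, Gluing α)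
    {α β : MorE R} (f g : α ⟶ β) (h : stableRel R f g) :
    (gluingFunctor hR G ⋙ KQuot.Q R).map f = (gluingFunctor hR G ⋙ KQuot.Q R).map g := by
  obtain ⟨q, a, b, hq, -, hab⟩ := h
  change (KQuot.Q R).map ((G α).toKMap hR (G β) f) = (KQuot.Q R).map ((G α).toKMap hR (G β) g)
  rw [← sub_eq_zero, ← Functor.map_sub, ← Gluing.toKMap_sub, hab, (G α).toKMap_comp hR (G q) (G β),
    Functor.map_comp, ((G q).isZero_Q_obj hR ((isProj_iff_isStandard hR q).1 hq)).eq_of_tgt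
      ((KQuot.Q R).map ((G α).toKMap hR (G q) a)) 0, zero_comp]

/-- The functor from the stable category to the Verdier quotient induced by the gluing functor. -/
def stableFunctor (hR : IsIwanagaGorenstein R) (G : ∀ α : MorE R, Gluing α) :
    Stable R ⥤ KQuot R :=
  CategoryTheory.Quotient.lift (stableRel R) (gluingFunctor hR G ⋙ KQuot.Q R)
    fun _ _ f g h => map_eq_of_stableRel hR G f g h

lemma isEquivalence_stableFunctor (hR : IsIwanagaGorenstein R) (G : ∀ α : MorE R, Gluing α) :
    (stableFunctor hR G).IsEquivalence where
  full := ⟨by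
    intro a b φ
    obtain ⟨f, hf⟩ := (G a.as).exists_Q_map_eq (G b.as) hR φ
    exact ⟨(toStable R).map f, hf⟩⟩
  faithful := ⟨by
    intro a b f g h
    obtain ⟨f, rfl⟩ := (toStable R).map_surjective (X := a.as) (Y := b.as) f
    obtain ⟨g, rfl⟩ := (toStable R).map_surjective (X := a.as) (Y := b.as) g
    exact (G a.as).toStable_map_eq (G b.as) hR f g h⟩
  essSurj := ⟨by
    intro X
    obtain ⟨α, A, ⟨e⟩⟩ := exists_gluing_iso hR X
    exact ⟨(toStable R).obj α, ⟨(KQuot.Q R).mapIso ((G α).toKIso hR A) ≪≫ e⟩⟩⟩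

end Induced

end MorE

/-! ### Extensions of complexes given by cocycles -/

section Twist

universe v w

open CochainComplex.HomComplex

variable {C : Type w} [Category.{v} C] [Preadditive C] {K L : CochainComplex C ℤ}

/-- The morphism `K ⟶ L⟦1⟧` in the homotopy category given by a cocycle of degree `1`. -/
def cocycleClass (z : Cocycle K L 1) : (HomotopyCategory.quotient C (.up ℤ)).obj K ⟶
    ((HomotopyCategory.quotient C (.up ℤ)).obj L)⟦(1 : ℤ)⟧ :=
  (HomotopyCategory.quotient C (.up ℤ)).map (Cocycle.equivHomShift.symm z) ≫
    ((HomotopyCategory.quotient C (.up ℤ)).commShiftIso (1 : ℤ)).hom.app L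

lemma cocycleClass_eq {z z' : Cocycle K L 1} (u : Cochain K L 0) (hu : δ 0 1 u = z.1 - z'.1) :
    cocycleClass z = cocycleClass z' := by
  have h : CohomologyClass.toHom (CohomologyClass.mk (z - z')) = 0 :=
    (CohomologyClass.toHom_mk_eq_zero_iff _).2 ((mem_coboundaries_iff _ 0 rfl).2 ⟨u, hu⟩)
  rw [CohomologyClass.mk_sub, map_sub, sub_eq_zero, CohomologyClass.toHom_mk,
    CohomologyClass.toHom_mk] at h
  rw [cocycleClass, h, cocycleClass]

lemma cocycleClass_precomp {K' : CochainComplex C ℤ} (z : Cocycle K L 1) (f : K' ⟶ K) :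
    cocycleClass (z.precomp f) =
      (HomotopyCategory.quotient C (.up ℤ)).map f ≫ cocycleClass z := by
  rw [cocycleClass, Cocycle.equivHomShift_symm_precomp, Functor.map_comp, Category.assoc]
  rfl

lemma cocycleClass_postcomp {L' : CochainComplex C ℤ} (z : Cocycle K L 1) (f : L ⟶ L') :
    cocycleClass (z.postcomp f) =
      cocycleClass z ≫ ((HomotopyCategory.quotient C (.up ℤ)).map f)⟦(1 : ℤ)⟧' := by
  rw [cocycleClass, Cocycle.equivHomShift_symm_postcomp, Functor.map_comp, Category.assoc,
    Functor.commShiftIso_hom_naturality, cocycleClass, Category.assoc]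

variable [HasBinaryBiproducts C] (z : Cocycle K L 1)

/-- The extension of `K` by `L` given by a cocycle of degree `1`. -/
def twist : CochainComplex C ℤ where
  X i := L.X i ⊞ K.X i
  d i j := if h : i + 1 = j then
      biprod.fst ≫ L.d i j ≫ biprod.inl + biprod.snd ≫ K.d i j ≫ biprod.inr +
        biprod.snd ≫ z.1.v i j h ≫ biprod.inl
    else 0
  shape i j h := dif_neg h
  d_comp_d' i j k hij hjk := by
    obtain rfl : i + 1 = j := hij
    obtain rfl : i + 1 + 1 = k := hjk
    -- The off-diagonal entry of d² is δz.
    have hz := Cochain.congr_v (z.δ_eq_zero 2) i (i + 1 + 1) (by lia)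
    rw [δ_v 1 2 rfl z.1 i (i + 1 + 1) (by lia) (i + 1) (i + 1) (by lia) rfl, Cochain.zero_v,
      show Int.negOnePow 2 = 1 from rfl, one_smul] at hz
    rw [dif_pos rfl, dif_pos rfl]
    simp only [Preadditive.add_comp, Preadditive.comp_add, Category.assoc, biprod.inl_fst_assoc,
      biprod.inl_snd_assoc, biprod.inr_fst_assoc, biprod.inr_snd_assoc, zero_comp, comp_zero,
      HomologicalComplex.d_comp_d_assoc, add_zero, zero_add]
    rw [← Preadditive.comp_add, ← Category.assoc (K.d i (i + 1)), ← Category.assoc (z.1.v _ _ _),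
      ← Preadditive.add_comp]
    exact (congrArg (fun f => biprod.snd ≫ f ≫ biprod.inl) hz).trans (by simp)

variable (i : ℤ)

/-- The inclusion of the first summand of an extension. -/
def twistι₁ : L.X i ⟶ (twist z).X i := biprod.inl (C := C)

/-- The inclusion of the second summand of an extension. -/
def twistι₂ : K.X i ⟶ (twist z).X i := biprod.inr (C := C)

/-- The projection onto the first summand of an extension. -/
def twistπ₁ : (twist z).X i ⟶ L.X i := biprod.fst (C := C)

/-- The projection onto the second summand of an extension. -/
def twistπ₂ : (twist z).X i ⟶ K.X i := biprod.snd (C := C)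

lemma twistι₁_π₁ : twistι₁ z i ≫ twistπ₁ z i = 𝟙 _ := biprod.inl_fst

lemma twistι₁_π₂ : twistι₁ z i ≫ twistπ₂ z i = 0 := biprod.inl_snd

lemma twistι₂_π₁ : twistι₂ z i ≫ twistπ₁ z i = 0 := biprod.inr_fst

lemma twistι₂_π₂ : twistι₂ z i ≫ twistπ₂ z i = 𝟙 _ := biprod.inr_snd

lemma twist_total : twistπ₁ z i ≫ twistι₁ z i + twistπ₂ z i ≫ twistι₂ z i = 𝟙 _ := biprod.total

lemma twist_d (i j : ℤ) (h : i + 1 = j) : (twist z).d i j =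
    twistπ₁ z i ≫ L.d i j ≫ twistι₁ z j + twistπ₂ z i ≫ K.d i j ≫ twistι₂ z j +
      twistπ₂ z i ≫ z.1.v i j h ≫ twistι₁ z j := dif_pos h

/-- The inclusion of the subcomplex of an extension. -/
def twistInl : L ⟶ twist z where
  f i := twistι₁ z i
  comm' i j h := by
    rw [twist_d z i j h, Preadditive.comp_add, Preadditive.comp_add, reassoc_of% (twistι₁_π₁ z i),
      reassoc_of% (twistι₁_π₂ z i), reassoc_of% (twistι₁_π₂ z i), zero_comp, zero_comp,
      add_zero, add_zero]

/-- The projection onto the quotient of an extension. -/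
def twistSnd : twist z ⟶ K where
  f i := twistπ₂ z i
  comm' i j h := by
    rw [twist_d z i j h]
    simp only [Preadditive.add_comp, Category.assoc, twistι₁_π₂, twistι₂_π₂, comp_zero,
      Category.comp_id, add_zero, zero_add]

/-- The extension is degreewise split, and the cocycle attached to its tautological splitting is z
itself. -/
lemma twist_distinguished [HasZeroObject C] :
    Triangle.mk ((HomotopyCategory.quotient C (.up ℤ)).map (twistInl z))
      ((HomotopyCategory.quotient C (.up ℤ)).map (twistSnd z)) (cocycleClass z) ∈ distTriang _ := by
  let S : ShortComplex (CochainComplex C ℤ) := ShortComplex.mk (twistInl z) (twistSnd z) (by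
    ext i
    exact twistι₁_π₂ z i)
  let σ (i : ℤ) : (S.map (HomologicalComplex.eval C _ i)).Splitting :=
    { r := twistπ₁ z i
      s := twistι₂ z i
      f_r := twistι₁_π₁ z i
      s_g := twistι₂_π₂ z i
      id := twist_total z i }
  have hσ : CochainComplex.cocycleOfDegreewiseSplit S σ = z := by
    ext p q hpq
    change twistι₂ z p ≫ (twist z).d p q ≫ twistπ₁ z q = _
    rw [twist_d z p q hpq]
    simp only [Preadditive.add_comp, Preadditive.comp_add, Category.assoc, twistι₁_π₁, twistι₂_π₁,
      reassoc_of% (twistι₂_π₁ z p), reassoc_of% (twistι₂_π₂ z p), comp_zero, zero_comp,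
      Category.comp_id, zero_add]
  have h := (HomotopyCategory.distinguished_iff_iso_trianglehOfDegreewiseSplit
    (CochainComplex.trianglehOfDegreewiseSplit S σ)).2 ⟨S, σ, ⟨Iso.refl _⟩⟩
  have hσ' : CochainComplex.homOfDegreewiseSplit S σ = Cocycle.equivHomShift.symm z := by
    rw [← hσ]
    rfl
  have hσ'' : (HomotopyCategory.quotient C (.up ℤ)).map (CochainComplex.homOfDegreewiseSplit S σ) ≫
      ((HomotopyCategory.quotient C (.up ℤ)).commShiftIso (1 : ℤ)).hom.app L = cocycleClass z := by
    rw [hσ']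
    rfl
  rw [← hσ'']
  exact h

end Twist

namespace MorE

open CochainComplex.HomComplex

/-! ### Connecting morphisms -/

section Connection

variable {R : Type u} [Ring R]

/-- A cocycle that realizes a gluing of the middle term of a sequence `α ⟶ β ⟶ γ` as an extension
of gluings of the outer terms. -/
structure Connection {α β γ : MorE R} (i : α ⟶ β) (p : β ⟶ γ) (A : Gluing α) (C : Gluing γ) where
  z : Cocycle C.cplx A.cplx 1
  σ : (C.cplx.X 0).obj ⟶ β.src
  τ : β.tgt ⟶ (A.cplx.X 1).obj
  σ_p : σ ≫ onSrc p = C.ρ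
  i_τ : onTgt i ≫ τ = A.ε
  z_zero : (z.1.v 0 1 rfl).hom = σ ≫ β.arr ≫ τ
  z_neg : (z.1.v (-1) 0 rfl).hom ≫ A.ρ ≫ onSrc i = -((C.cplx.d (-1) 0).hom ≫ σ)
  z_one : onTgt p ≫ C.ε ≫ (z.1.v 1 2 rfl).hom = -(τ ≫ (A.cplx.d 1 2).hom)

lemma exists_connection (hR : IsIwanagaGorenstein R) {α β γ : MorE R} {i : α ⟶ β} {p : β ⟶ γ}
    (h : IsConflation i p) (A : Gluing α) (C : Gluing γ) : Nonempty (Connection i p A C) := by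
  have : Mono (onSrc i) := (ModuleCat.mono_iff_injective _).2 h.src_inj
  have : Epi (onTgt p) := (ModuleCat.epi_iff_surjective _).2 h.tgt_surj
  -- The maps σ and τ will be the new parts of the augmentation and coaugmentation of the extension.
  -- They determine z in degree 0. The composite d⁻¹ ≫ σ lands in X_α and τ ≫ d¹ factors through
  -- T_γ; their negatives, lifted along `A.ρ` and extended along `C.ε`, give z in degrees -1 and 1.
  obtain ⟨σ, hσ⟩ := exists_lift_of_surjective (C.cplx.X 0).property (onSrc p) h.src_surj C.ρ
  obtain ⟨τ, hτ⟩ := exists_extension_of_isCM h.tgt_isSES γ.property.2.1 (A.cplx.X 1).property A.ε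
  obtain ⟨s, hs⟩ := h.src_isSES.exists_lift ((C.cplx.d (-1) 0).hom ≫ σ) (by
    rw [Category.assoc, hσ, C.d_comp_ρ])
  obtain ⟨t, ht⟩ := h.tgt_isSES.exists_desc (τ ≫ (A.cplx.d 1 2).hom) (by
    rw [reassoc_of% hτ, A.ε_comp_d])
  obtain ⟨a, ha⟩ := A.exists_lift_ρ (P := C.cplx.X (-1)) (-s)
  obtain ⟨b, hb⟩ := C.exists_extension_ε hR (P := A.cplx.X 2) (-t)
  let c : C.cplx.X 0 ⟶ A.cplx.X 1 := ObjectProperty.homMk (σ ≫ β.arr ≫ τ)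
  let u : Cochain C.cplx A.cplx 1 := Cochain.single a 1 + Cochain.single c 1 + Cochain.single b 1
  have ua : u.v (-1) 0 rfl = a := by
    dsimp only [u]
    rw [Cochain.add_v, Cochain.add_v, Cochain.single_v,
      Cochain.single_v_eq_zero c _ _ _ _ (by norm_num),
      Cochain.single_v_eq_zero b _ _ _ _ (by norm_num), add_zero, add_zero]
  have uc : u.v 0 1 rfl = c := by
    dsimp only [u]
    rw [Cochain.add_v, Cochain.add_v, Cochain.single_v,
      Cochain.single_v_eq_zero a _ _ _ _ (by norm_num),
      Cochain.single_v_eq_zero b _ _ _ _ (by norm_num), add_zero, zero_add]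
  have ub : u.v 1 2 rfl = b := by
    dsimp only [u]
    rw [Cochain.add_v, Cochain.add_v, Cochain.single_v,
      Cochain.single_v_eq_zero c _ _ _ _ (by norm_num),
      Cochain.single_v_eq_zero a _ _ _ _ (by norm_num), add_zero, zero_add]
  have u₀ (k l : ℤ) (hkl : k + 1 = l) (h₁ : k ≠ -1) (h₂ : k ≠ 0) (h₃ : k ≠ 1) :
      u.v k l hkl = 0 := by
    dsimp only [u]
    rw [Cochain.add_v, Cochain.add_v, Cochain.single_v_eq_zero a _ _ _ _ h₁,
      Cochain.single_v_eq_zero c _ _ _ _ h₂,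
      Cochain.single_v_eq_zero b _ _ _ _ h₃, add_zero, add_zero]
  have hneg : Int.negOnePow 2 = 1 := rfl
  clear_value u
  -- Solving δz = 0 with m = 2: the cocycle identity must be checked in degrees -1 and 0, and the
  -- edge conditions in degrees -2 and 1.
  obtain ⟨z, hz, hz'⟩ := C.exists_δ_eq hR A (n := 1) (m := 2) rfl zero_le_two 0 (by simp) u (by
    intro k l hkl hk hk'
    obtain rfl | rfl : k = -1 ∨ k = 0 := by omega
    · obtain rfl : l = 1 := by omega
      rw [δ_v 1 2 rfl u (-1) 1 rfl 0 0 rfl rfl, ua, uc, hneg, one_smul, Cochain.zero_v]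
      ext1
      change a.hom ≫ (A.cplx.d 0 1).hom + (C.cplx.d (-1) 0).hom ≫ σ ≫ β.arr ≫ τ = 0
      rw [A.d_zero_one, reassoc_of% ha, ← reassoc_of% hs, reassoc_of% (w i), hτ]
      simp
    · obtain rfl : l = 2 := by omega
      rw [δ_v 1 2 rfl u 0 2 rfl 1 1 rfl rfl, ub, uc, hneg, one_smul, Cochain.zero_v]
      ext1
      change (σ ≫ β.arr ≫ τ) ≫ (A.cplx.d 1 2).hom + (C.cplx.d 0 1).hom ≫ b.hom = 0
      rw [C.d_zero_one]
      simp only [Category.assoc]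
      rw [hb, ← ht, ← reassoc_of% (w p), reassoc_of% hσ]
      simp) (by
    rw [zero_sub, Cochain.neg_v]
    change (-((δ 1 2 u).v (-2) 0 rfl).hom) ≫ A.ρ = 0
    rw [δ_v 1 2 rfl u (-2) 0 rfl (-1) (-1) rfl rfl, ua, hneg, one_smul,
      u₀ _ _ _ (by norm_num) (by norm_num) (by norm_num), zero_comp, zero_add,
      Preadditive.neg_comp, neg_eq_zero, ← cancel_mono (onSrc i), zero_comp]
    change (((C.cplx.d (-2) (-1)).hom ≫ a.hom) ≫ A.ρ) ≫ onSrc i = 0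
    simp only [Category.assoc]
    rw [reassoc_of% ha, Preadditive.neg_comp, hs, Preadditive.comp_neg,
      reassoc_of% (d_hom_comp_d_hom C.cplx (-2) (-1) 0), zero_comp, neg_zero]) (by
    rw [zero_sub, Cochain.neg_v]
    change C.ε ≫ (-((δ 1 2 u).v 1 3 rfl).hom) = 0
    rw [δ_v 1 2 rfl u 1 3 rfl 2 2 rfl rfl, ub, u₀ 2 _ _ (by norm_num) (by norm_num) (by norm_num),
      comp_zero, smul_zero, add_zero, Preadditive.comp_neg, neg_eq_zero, ← cancel_epi (onTgt p),
      comp_zero]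
    change onTgt p ≫ C.ε ≫ b.hom ≫ (A.cplx.d 2 3).hom = 0
    rw [reassoc_of% hb, Preadditive.neg_comp, Preadditive.comp_neg, reassoc_of% ht,
      d_hom_comp_d_hom A.cplx 1 2 3, comp_zero, neg_zero])
  have za : z.v (-1) 0 rfl = a := (hz _ _ _ (by norm_num) (by norm_num)).trans ua
  have zc : z.v 0 1 rfl = c := (hz _ _ _ (by norm_num) (by norm_num)).trans uc
  have zb : z.v 1 2 rfl = b := (hz _ _ _ (by norm_num) (by norm_num)).trans ub
  refine ⟨⟨Cocycle.mk z 2 rfl hz', σ, τ, hσ, hτ, ?_, ?_, ?_⟩⟩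
  · exact congrArg (fun f => f.hom) zc
  · change (z.v (-1) 0 rfl).hom ≫ A.ρ ≫ onSrc i = -((C.cplx.d (-1) 0).hom ≫ σ)
    rw [za, reassoc_of% ha, Preadditive.neg_comp, hs]
  · change onTgt p ≫ C.ε ≫ (z.v 1 2 rfl).hom = -(τ ≫ (A.cplx.d 1 2).hom)
    rw [zb, hb, Preadditive.comp_neg, ht]

end Connection

end MorE

section Exact

variable {R : Type u} [Ring R]

/-- An extension of exact sequences is exact. -/
lemma exact_of_extension {A₀ A₁ A₂ E₀ E₁ E₂ C₀ C₁ C₂ : RMod R} {f₀ : A₀ ⟶ A₁} {f₁ : A₁ ⟶ A₂}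
    {h₀ : E₀ ⟶ E₁} {h₁ : E₁ ⟶ E₂} {g₀ : C₀ ⟶ C₁} {g₁ : C₁ ⟶ C₂} (ι₀ : A₀ ⟶ E₀) (ι₁ : A₁ ⟶ E₁)
    (ι₂ : A₂ ⟶ E₂) (π₀ : E₀ ⟶ C₀) (π₁ : E₁ ⟶ C₁) (π₂ : E₂ ⟶ C₂) (hf : Function.Exact f₀ f₁)
    (hg : Function.Exact g₀ g₁) (hι₀ : ι₀ ≫ h₀ = f₀ ≫ ι₁) (hι₁ : ι₁ ≫ h₁ = f₁ ≫ ι₂)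
    (hπ₀ : h₀ ≫ π₁ = π₀ ≫ g₀) (hπ₁ : h₁ ≫ π₂ = π₁ ≫ g₁) (hh : h₀ ≫ h₁ = 0)
    (hs : Function.Surjective π₀) (he : Function.Exact ι₁ π₁) (hi : Function.Injective ι₂) :
    Function.Exact h₀ h₁ := by
  have hι₀' (x) : h₀ (ι₀ x) = ι₁ (f₀ x) := congrArg (fun f : A₀ ⟶ E₁ => f x) hι₀
  have hι₁' (x) : h₁ (ι₁ x) = ι₂ (f₁ x) := congrArg (fun f : A₁ ⟶ E₂ => f x) hι₁
  have hπ₀' (x) : π₁ (h₀ x) = g₀ (π₀ x) := congrArg (fun f : E₀ ⟶ C₁ => f x) hπ₀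
  have hπ₁' (x) : π₂ (h₁ x) = g₁ (π₁ x) := congrArg (fun f : E₁ ⟶ C₂ => f x) hπ₁
  have hh' (x) : h₁ (h₀ x) = 0 := congrArg (fun f : E₀ ⟶ E₂ => f x) hh
  intro y
  constructor
  · intro hy
    obtain ⟨c, hc⟩ := (hg (π₁ y)).1 (by rw [← hπ₁', hy, map_zero])
    obtain ⟨e, rfl⟩ := hs c
    obtain ⟨a, ha⟩ := (he (y - h₀ e)).1 (by rw [map_sub, hπ₀', hc, sub_self])
    obtain ⟨b, rfl⟩ := (hf a).1 (hi (by rw [← hι₁', ha, map_sub, hy, hh', sub_zero, map_zero]))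
    exact ⟨ι₀ b + e, by rw [map_add, hι₀', ha, sub_add_cancel]⟩
  · rintro ⟨x, rfl⟩
    exact hh' x

end Exact

namespace MorE

open CochainComplex.HomComplex

namespace Connection

/-! ### The extension by a connection is a gluing of the middle term -/

section Extension

variable {R : Type u} [Ring R] {α β γ : MorE R} {i : α ⟶ β} {p : β ⟶ γ} {A : Gluing α}
  {C : Gluing γ} (c : Connection i p A C)

lemma ι₁_π₁ (j : ℤ) : (twistι₁ c.z j).hom ≫ (twistπ₁ c.z j).hom = 𝟙 _ :=
  congrArg (fun f => f.hom) (twistι₁_π₁ c.z j)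

lemma ι₁_π₂ (j : ℤ) : (twistι₁ c.z j).hom ≫ (twistπ₂ c.z j).hom = 0 :=
  congrArg (fun f => f.hom) (twistι₁_π₂ c.z j)

lemma ι₂_π₁ (j : ℤ) : (twistι₂ c.z j).hom ≫ (twistπ₁ c.z j).hom = 0 :=
  congrArg (fun f => f.hom) (twistι₂_π₁ c.z j)

lemma ι₂_π₂ (j : ℤ) : (twistι₂ c.z j).hom ≫ (twistπ₂ c.z j).hom = 𝟙 _ :=
  congrArg (fun f => f.hom) (twistι₂_π₂ c.z j)

lemma total (j : ℤ) : (twistπ₁ c.z j).hom ≫ (twistι₁ c.z j).hom +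
    (twistπ₂ c.z j).hom ≫ (twistι₂ c.z j).hom = 𝟙 _ :=
  congrArg (fun f => f.hom) (twist_total c.z j)

lemma ι₁_injective (j : ℤ) : Function.Injective (twistι₁ c.z j).hom := fun x y h => by
  have h' (x) : (twistπ₁ c.z j).hom ((twistι₁ c.z j).hom x) = x :=
    congrArg (fun f : (A.cplx.X j).obj ⟶ (A.cplx.X j).obj => f x) (c.ι₁_π₁ j)
  rw [← h' x, h, h']

lemma π₂_surjective (j : ℤ) : Function.Surjective (twistπ₂ c.z j).hom := fun x =>
  ⟨(twistι₂ c.z j).hom x,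
    congrArg (fun f : (C.cplx.X j).obj ⟶ (C.cplx.X j).obj => f x) (c.ι₂_π₂ j)⟩

lemma ι₁_π₂_exact (j : ℤ) : Function.Exact (twistι₁ c.z j).hom (twistπ₂ c.z j).hom := by
  intro x
  constructor
  · intro hx
    refine ⟨(twistπ₁ c.z j).hom x, ?_⟩
    have h : (twistι₁ c.z j).hom ((twistπ₁ c.z j).hom x) +
        (twistι₂ c.z j).hom ((twistπ₂ c.z j).hom x) = x :=
      congrArg (fun f : ((twist c.z).X j).obj ⟶ ((twist c.z).X j).obj => f x) (c.total j)
    rwa [hx, map_zero, add_zero] at h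
  · rintro ⟨y, rfl⟩
    exact congrArg (fun f : (A.cplx.X j).obj ⟶ (C.cplx.X j).obj => f y) (c.ι₁_π₂ j)

lemma ι₁_d (j k : ℤ) : (twistι₁ c.z j).hom ≫ ((twist c.z).d j k).hom =
    (A.cplx.d j k).hom ≫ (twistι₁ c.z k).hom :=
  congrArg (fun f => f.hom) ((twistInl c.z).comm j k)

lemma d_π₂ (j k : ℤ) : ((twist c.z).d j k).hom ≫ (twistπ₂ c.z k).hom =
    (twistπ₂ c.z j).hom ≫ (C.cplx.d j k).hom :=
  congrArg (fun f => f.hom) ((twistSnd c.z).comm j k).symm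

lemma d_hom (j k : ℤ) (h : j + 1 = k) : ((twist c.z).d j k).hom =
    (twistπ₁ c.z j).hom ≫ (A.cplx.d j k).hom ≫ (twistι₁ c.z k).hom +
      (twistπ₂ c.z j).hom ≫ (C.cplx.d j k).hom ≫ (twistι₂ c.z k).hom +
      (twistπ₂ c.z j).hom ≫ (c.z.1.v j k h).hom ≫ (twistι₁ c.z k).hom :=
  congrArg (fun f => f.hom) (twist_d c.z j k h)

lemma exact_twist {j k l : ℤ} (hA : Function.Exact (A.cplx.d j k).hom (A.cplx.d k l).hom)
    (hC : Function.Exact (C.cplx.d j k).hom (C.cplx.d k l).hom) :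
    Function.Exact ((twist c.z).d j k).hom ((twist c.z).d k l).hom :=
  exact_of_extension _ _ _ _ _ _ hA hC (c.ι₁_d j k) (c.ι₁_d k l) (c.d_π₂ j k) (c.d_π₂ k l)
    (d_hom_comp_d_hom _ _ _ _) (c.π₂_surjective j) (c.ι₁_π₂_exact k) (c.ι₁_injective l)

/-- The augmentation of the extension. -/
def ρ : ((twist c.z).X 0).obj ⟶ β.src :=
  (twistπ₁ c.z 0).hom ≫ A.ρ ≫ onSrc i + (twistπ₂ c.z 0).hom ≫ c.σ

/-- The coaugmentation of the extension. -/
def ε : β.tgt ⟶ ((twist c.z).X 1).obj :=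
  c.τ ≫ (twistι₁ c.z 1).hom + onTgt p ≫ C.ε ≫ (twistι₂ c.z 1).hom

lemma ι₁_ρ : (twistι₁ c.z 0).hom ≫ c.ρ = A.ρ ≫ onSrc i := by
  rw [ρ, Preadditive.comp_add, reassoc_of% (c.ι₁_π₁ 0), reassoc_of% (c.ι₁_π₂ 0), zero_comp,
    add_zero]

lemma ι₂_ρ : (twistι₂ c.z 0).hom ≫ c.ρ = c.σ := by
  rw [ρ, Preadditive.comp_add, reassoc_of% (c.ι₂_π₁ 0), reassoc_of% (c.ι₂_π₂ 0), zero_comp,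
    zero_add]

lemma ε_π₂ : c.ε ≫ (twistπ₂ c.z 1).hom = onTgt p ≫ C.ε := by
  rw [ε, Preadditive.add_comp, Category.assoc, Category.assoc, Category.assoc, c.ι₁_π₂ 1,
    c.ι₂_π₂ 1, comp_zero, Category.comp_id, zero_add]

lemma ρ_p (h : IsConflation i p) : c.ρ ≫ onSrc p = (twistπ₂ c.z 0).hom ≫ C.ρ := by
  rw [ρ, Preadditive.add_comp, Category.assoc, Category.assoc, Category.assoc, h.src_isSES.zero,
    comp_zero, comp_zero, zero_add, c.σ_p]

lemma i_ε (h : IsConflation i p) : onTgt i ≫ c.ε = A.ε ≫ (twistι₁ c.z 1).hom := by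
  rw [ε, Preadditive.comp_add, reassoc_of% c.i_τ, reassoc_of% h.tgt_isSES.zero, zero_comp,
    add_zero]

/-- `z_neg` is the condition that makes the component of z in degree -1 cancel d⁻¹ ≫ σ. Likewise
`z_one` gives `ε_d`, and `z_zero` gives the factorisation of d⁰. -/
lemma d_ρ : ((twist c.z).d (-1) 0).hom ≫ c.ρ = 0 := by
  rw [c.d_hom (-1) 0 rfl]
  simp only [Preadditive.add_comp, Category.assoc]
  rw [c.ι₁_ρ, c.ι₂_ρ, c.z_neg, reassoc_of% A.d_comp_ρ, zero_comp, comp_zero, zero_add,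
    Preadditive.comp_neg, add_neg_cancel]

lemma ε_d : c.ε ≫ ((twist c.z).d 1 2).hom = 0 := by
  rw [ε, Preadditive.add_comp, Category.assoc, c.ι₁_d, c.d_hom 1 2 rfl]
  simp only [Preadditive.comp_add, Category.assoc]
  rw [reassoc_of% (c.ι₂_π₁ 1), reassoc_of% (c.ι₂_π₂ 1), reassoc_of% (c.ι₂_π₂ 1),
    reassoc_of% c.z_one, reassoc_of% C.ε_comp_d]
  simp

/-- The extension given by a connection, as a gluing of the middle term. -/
def gluing (h : IsConflation i p) : Gluing β where
  cplx := twist c.z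
  ρ := c.ρ
  ε := c.ε
  d_zero_one := by
    have e₁ : A.ρ ≫ onSrc i ≫ β.arr ≫ c.ε = (A.cplx.d 0 1).hom ≫ (twistι₁ c.z 1).hom := by
      rw [reassoc_of% (w i), c.i_ε h, A.d_zero_one]
      simp only [Category.assoc]
    have e₂ : c.σ ≫ β.arr ≫ c.ε = (C.cplx.d 0 1).hom ≫ (twistι₂ c.z 1).hom +
        (c.z.1.v 0 1 rfl).hom ≫ (twistι₁ c.z 1).hom := by
      rw [ε, C.d_zero_one, c.z_zero, ← c.σ_p]
      simp only [Category.assoc, Preadditive.comp_add]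
      rw [reassoc_of% (w p), add_comm]
    rw [c.d_hom 0 1 rfl, ρ, Preadditive.add_comp, Category.assoc, Category.assoc, Category.assoc,
      e₁, e₂, Preadditive.comp_add, add_assoc]
  ρ_surj x := by
    obtain ⟨y, hy⟩ := C.ρ_surj (onSrc p x)
    have hσ : onSrc p (c.σ y) = C.ρ y :=
      congrArg (fun f : (C.cplx.X 0).obj ⟶ γ.src => f y) c.σ_p
    obtain ⟨a, ha⟩ := (h.src_exact (x - c.σ y)).1 (by rw [map_sub, hσ, hy, sub_self])
    obtain ⟨b, rfl⟩ := A.ρ_surj a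
    refine ⟨(twistι₁ c.z 0).hom b + (twistι₂ c.z 0).hom y, ?_⟩
    have e₁ : c.ρ ((twistι₁ c.z 0).hom b) = onSrc i (A.ρ b) :=
      congrArg (fun f : (A.cplx.X 0).obj ⟶ β.src => f b) c.ι₁_ρ
    have e₂ : c.ρ ((twistι₂ c.z 0).hom y) = c.σ y :=
      congrArg (fun f : (C.cplx.X 0).obj ⟶ β.src => f y) c.ι₂_ρ
    rw [map_add, e₁, e₂, ha, sub_add_cancel]
  exact_zero := exact_of_extension _ _ (onSrc i) _ _ (onSrc p) A.exact_zero C.exact_zero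
    (c.ι₁_d _ _) c.ι₁_ρ (c.d_π₂ _ _) (c.ρ_p h) c.d_ρ (c.π₂_surjective _) (c.ι₁_π₂_exact _)
    h.src_inj
  exact_neg j hj := c.exact_twist (A.exact_neg j hj) (C.exact_neg j hj)
  ε_inj := by
    rw [injective_iff_map_eq_zero]
    intro t ht
    have e₁ : (twistπ₂ c.z 1).hom (c.ε t) = C.ε (onTgt p t) :=
      congrArg (fun f : β.tgt ⟶ (C.cplx.X 1).obj => f t) c.ε_π₂
    obtain ⟨s, rfl⟩ := (h.tgt_exact t).1 (C.ε_inj (by rw [← e₁, ht, map_zero, map_zero]))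
    have e₂ : c.ε (onTgt i s) = (twistι₁ c.z 1).hom (A.ε s) :=
      congrArg (fun f : α.tgt ⟶ ((twist c.z).X 1).obj => f s) (c.i_ε h)
    have hs : s = 0 := A.ε_inj (c.ι₁_injective 1 (by rw [← e₂, ht, map_zero, map_zero]))
    rw [hs, map_zero]
  exact_one := exact_of_extension (onTgt i) _ _ (onTgt p) _ _ A.exact_one C.exact_one
    (c.i_ε h) (c.ι₁_d _ _) c.ε_π₂ (c.d_π₂ _ _) c.ε_d h.tgt_surj (c.ι₁_π₂_exact _)
    (c.ι₁_injective _)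
  exact_pos j hj := c.exact_twist (A.exact_pos j hj) (C.exact_pos j hj)

lemma isLift_inl (h : IsConflation i p) : A.IsLift (c.gluing h) i (twistInl c.z) where
  src := c.ι₁_ρ
  tgt := (c.i_ε h).symm

lemma isLift_snd (h : IsConflation i p) : (c.gluing h).IsLift C p (twistSnd c.z) where
  src := (c.ρ_p h).symm
  tgt := c.ε_π₂

end Extension

/-! ### Naturality of connecting morphisms -/

section Naturality

variable {R : Type u} [Ring R] {α β γ α' β' γ' : MorE R} {i : α ⟶ β} {p : β ⟶ γ} {i' : α' ⟶ β'}
  {p' : β' ⟶ γ'} {A : Gluing α} {C : Gluing γ} {A' : Gluing α'} {C' : Gluing γ'}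
  (c : Connection i p A C)

/-- The connecting morphisms are natural. -/
lemma naturality (c' : Connection i' p' A' C') (hR : IsIwanagaGorenstein R)
    (h : IsConflation i p) (h' : IsConflation i' p')
    (f : α ⟶ α') (g : β ⟶ β') (k : γ ⟶ γ') (hf : i ≫ g = f ≫ i') (hk : p ≫ k = g ≫ p')
    {φ : A.cplx ⟶ A'.cplx} {ψ : C.cplx ⟶ C'.cplx} (hφ : A.IsLift A' f φ) (hψ : C.IsLift C' k ψ) :
    (HomotopyCategory.quotient (ProjCat R) (.up ℤ)).map ψ ≫ cocycleClass c'.z =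
      cocycleClass c.z ≫ ((HomotopyCategory.quotient (ProjCat R) (.up ℤ)).map φ)⟦(1 : ℤ)⟧' := by
  have : Mono (onSrc i') := (ModuleCat.mono_iff_injective _).2 h'.src_inj
  have : Epi (onTgt p) := (ModuleCat.epi_iff_surjective _).2 h.tgt_surj
  have hfs : onSrc i ≫ onSrc g = onSrc f ≫ onSrc i' := congrArg onSrc hf
  have hft : onTgt i ≫ onTgt g = onTgt f ≫ onTgt i' := congrArg onTgt hf
  have hks : onSrc p ≫ onSrc k = onSrc g ≫ onSrc p' := congrArg onSrc hk
  have hkt : onTgt p ≫ onTgt k = onTgt g ≫ onTgt p' := congrArg onTgt hk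
  have φd (a b : ℤ) : (φ.f a).hom ≫ (A'.cplx.d a b).hom = (A.cplx.d a b).hom ≫ (φ.f b).hom :=
    congrArg (fun f => f.hom) (φ.comm a b)
  have ψd (a b : ℤ) : (ψ.f a).hom ≫ (C'.cplx.d a b).hom = (C.cplx.d a b).hom ≫ (ψ.f b).hom :=
    congrArg (fun f => f.hom) (ψ.comm a b)
  -- The two cocycles to be compared differ by a coboundary δu. The component u⁰ measures how far σ
  -- fails to commute with the given maps, a difference that lands in X_α'; the component u¹ does
  -- the same for τ, whose difference factors through T_γ.
  obtain ⟨s, hs⟩ := h'.src_isSES.exists_lift ((ψ.f 0).hom ≫ c'.σ - c.σ ≫ onSrc g) (by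
    rw [Preadditive.sub_comp, Category.assoc, Category.assoc, c'.σ_p, ← hks, reassoc_of% c.σ_p,
      hψ.src, sub_self])
  obtain ⟨t, ht⟩ := h.tgt_isSES.exists_desc (c.τ ≫ (φ.f 1).hom - onTgt g ≫ c'.τ) (by
    rw [Preadditive.comp_sub, reassoc_of% c.i_τ, reassoc_of% hft, c'.i_τ, hφ.tgt, sub_self])
  obtain ⟨a, ha⟩ := A'.exists_lift_ρ (P := C.cplx.X 0) s
  obtain ⟨b, hb⟩ := C.exists_extension_ε hR (P := A'.cplx.X 1) t
  let u : Cochain C.cplx A'.cplx 0 := Cochain.single a 0 + Cochain.single b 0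
  have ua : u.v 0 0 rfl = a := by
    dsimp only [u]
    rw [Cochain.add_v, Cochain.single_v, Cochain.single_v_eq_zero b _ _ _ _ (by norm_num),
      add_zero]
  have ub : u.v 1 1 rfl = b := by
    dsimp only [u]
    rw [Cochain.add_v, Cochain.single_v, Cochain.single_v_eq_zero a _ _ _ _ (by norm_num),
      zero_add]
  have u₀ (k l : ℤ) (hkl : k + 0 = l) (h₁ : k ≠ 0) (h₂ : k ≠ 1) : u.v k l hkl = 0 := by
    dsimp only [u]
    rw [Cochain.add_v, Cochain.single_v_eq_zero a _ _ _ _ h₁,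
      Cochain.single_v_eq_zero b _ _ _ _ h₂, add_zero]
  clear_value u
  let z := c'.z.precomp ψ - c.z.postcomp φ
  have hz (a b : ℤ) (hab : a + 1 = b) : z.1.v a b hab =
      ψ.f a ≫ c'.z.1.v a b hab - c.z.1.v a b hab ≫ φ.f b := by
    change ((Cochain.ofHom ψ).comp c'.z.1 (zero_add 1)).v a b hab -
      (c.z.1.comp (Cochain.ofHom φ) (add_zero 1)).v a b hab = _
    rw [Cochain.zero_cochain_comp_v, Cochain.comp_zero_cochain_v, Cochain.ofHom_v, Cochain.ofHom_v]
  have hz' (a b : ℤ) (hab : a + 1 = b) : (z.1.v a b hab).hom =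
      (ψ.f a).hom ≫ (c'.z.1.v a b hab).hom - (c.z.1.v a b hab).hom ≫ (φ.f b).hom :=
    congrArg (fun f => f.hom) (hz a b hab)
  have hz₂ : z.1 = (c'.z.precomp ψ).1 - (c.z.postcomp φ).1 := rfl
  clear_value z
  have hneg : Int.negOnePow 1 = -1 := rfl
  have eρ (f : (C.cplx.X (-1)).obj ⟶ α'.src) (hf : f ≫ onSrc i' = 0) : f = 0 := by
    rwa [← cancel_mono (onSrc i'), zero_comp]
  have eε (f : γ.tgt ⟶ (A'.cplx.X 2).obj) (hf : onTgt p ≫ f = 0) : f = 0 := by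
    rwa [← cancel_epi (onTgt p), comp_zero]
  have w₁ := c'.z_neg
  have w₂ := c.z_neg
  have w₃ := c'.z_one
  have w₄ := c.z_one
  obtain ⟨u', -, hu'⟩ := C.exists_δ_eq hR A' (zero_add 1) zero_le_one z.1 (z.δ_eq_zero _) u (by
    intro k l hkl hk hk'
    obtain rfl : k = 0 := by omega
    obtain rfl : l = 1 := by omega
    rw [δ_v 0 1 rfl u 0 1 rfl 0 1 rfl rfl, ua, ub, hneg]
    ext1
    rw [hz', c'.z_zero, c.z_zero]
    change a.hom ≫ (A'.cplx.d 0 1).hom + (-1 : ℤˣ) • ((C.cplx.d 0 1).hom ≫ b.hom) = _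
    rw [A'.d_zero_one, C.d_zero_one, reassoc_of% ha, ← c'.i_τ, ← reassoc_of% (w i'),
      reassoc_of% hs, ← c.σ_p]
    simp only [Category.assoc]
    rw [hb, reassoc_of% (w p), ht, Units.neg_smul, one_smul, Preadditive.sub_comp,
      Preadditive.comp_sub, Preadditive.comp_sub]
    simp only [Category.assoc]
    rw [reassoc_of% (w g)]
    abel) (by
    apply eρ
    rw [Cochain.sub_v, δ_v 0 1 rfl u (-1) 0 rfl (-1) 0 rfl rfl, ua,
      u₀ _ _ _ (by norm_num) (by norm_num), hneg, zero_comp, zero_add, Units.neg_smul, one_smul,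
      sub_neg_eq_add]
    change (((z.1.v (-1) 0 rfl).hom + (C.cplx.d (-1) 0).hom ≫ a.hom) ≫ A'.ρ) ≫ onSrc i' = 0
    rw [hz', Category.assoc, Preadditive.add_comp, Preadditive.sub_comp]
    simp only [Category.assoc]
    rw [w₁, reassoc_of% ha, hs, Preadditive.comp_neg, reassoc_of% (ψd (-1) 0),
      reassoc_of% hφ.src, ← hfs]
    have w₂' := congrArg (· ≫ onSrc g) w₂
    simp only [Category.assoc, Preadditive.neg_comp] at w₂'
    rw [w₂', Preadditive.comp_sub]
    abel) (by
    apply eε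
    change onTgt p ≫ C.ε ≫ ((z.1 - δ 0 1 u).v 1 2 rfl).hom = 0
    rw [Cochain.sub_v, δ_v 0 1 rfl u 1 2 rfl 1 2 rfl rfl, ub,
      u₀ _ _ _ (by norm_num) (by norm_num), comp_zero, smul_zero, add_zero]
    change onTgt p ≫ C.ε ≫ ((z.1.v 1 2 rfl).hom - b.hom ≫ (A'.cplx.d 1 2).hom) = 0
    rw [hz', Preadditive.comp_sub, Preadditive.comp_sub, Preadditive.comp_sub,
      Preadditive.comp_sub, reassoc_of% hψ.tgt, reassoc_of% hkt, w₃, reassoc_of% hb,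
      reassoc_of% ht, reassoc_of% w₄, Preadditive.sub_comp, Preadditive.neg_comp,
      Preadditive.comp_neg]
    simp only [Category.assoc]
    rw [φd 1 2]
    abel)
  rw [← cocycleClass_precomp, ← cocycleClass_postcomp]
  exact cocycleClass_eq u' (hu'.trans hz₂)

end Naturality

end Connection

end MorE

namespace MorE

/-! ### Connecting morphisms in K^{∞,b}(proj R) and in the Verdier quotient -/

section Connecting

variable {R : Type u} [Ring R]

/-- The connecting morphism in `K^{∞,b}(proj R)` of an exact sequence in `Mor^e(CM R)`. -/
def connectingK (hR : IsIwanagaGorenstein R) {α β γ : MorE R} {i : α ⟶ β} {p : β ⟶ γ}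
    (h : IsConflation i p) (A : Gluing α) (C : Gluing γ) : C.toK ⟶ A.toK⟦(1 : ℤ)⟧ :=
  ObjectProperty.homMk (cocycleClass (exists_connection hR h A C).some.z ≫
    ((hasBoundedHomology R).ι.commShiftIso (1 : ℤ)).inv.app A.toK)

lemma ι_map_connectingK (hR : IsIwanagaGorenstein R) {α β γ : MorE R} {i : α ⟶ β} {p : β ⟶ γ}
    (h : IsConflation i p) (A : Gluing α) (C : Gluing γ) :
    (hasBoundedHomology R).ι.map (connectingK hR h A C) ≫
      ((hasBoundedHomology R).ι.commShiftIso (1 : ℤ)).hom.app A.toK =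
      cocycleClass (exists_connection hR h A C).some.z := by
  change (cocycleClass (exists_connection hR h A C).some.z ≫
    ((hasBoundedHomology R).ι.commShiftIso (1 : ℤ)).inv.app A.toK) ≫ _ = _
  rw [Category.assoc]
  erw [Iso.inv_hom_id_app]
  exact Category.comp_id _

lemma connectingK_naturality (hR : IsIwanagaGorenstein R) {α β γ α' β' γ' : MorE R} {i : α ⟶ β}
    {p : β ⟶ γ} {i' : α' ⟶ β'} {p' : β' ⟶ γ'} (h : IsConflation i p) (h' : IsConflation i' p')
    (A : Gluing α) (C : Gluing γ) (A' : Gluing α') (C' : Gluing γ')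
    (f : α ⟶ α') (g : β ⟶ β') (k : γ ⟶ γ') (hf : i ≫ g = f ≫ i') (hk : p ≫ k = g ≫ p') :
    C.toKMap hR C' k ≫ connectingK hR h' A' C' =
      connectingK hR h A C ≫ (A.toKMap hR A' f)⟦(1 : ℤ)⟧' := by
  obtain ⟨φ, hφ⟩ := A.exists_isLift A' hR f
  obtain ⟨ψ, hψ⟩ := C.exists_isLift C' hR k
  apply (hasBoundedHomology R).ι.map_injective
  rw [← cancel_mono (((hasBoundedHomology R).ι.commShiftIso (1 : ℤ)).hom.app A'.toK),
    Functor.map_comp, Functor.map_comp, Category.assoc, Category.assoc, ι_map_connectingK,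
    Functor.commShiftIso_hom_naturality, reassoc_of% (ι_map_connectingK hR h A C),
    hφ.toKMap_eq, hψ.toKMap_eq]
  exact Connection.naturality _ _ hR h h' f g k hf hk hφ hψ

/-- Exact sequences in `Mor^e(CM R)` give rise to distinguished triangles. -/
lemma connectingK_distinguished (hR : IsIwanagaGorenstein R) {α β γ : MorE R} {i : α ⟶ β}
    {p : β ⟶ γ} (h : IsConflation i p) (A : Gluing α) (B : Gluing β) (C : Gluing γ) :
    Triangle.mk (A.toKMap hR B i) (B.toKMap hR C p) (connectingK hR h A C) ∈
      distTriang (KInfB R) := by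
  obtain ⟨c, hc⟩ : ∃ c, c = (exists_connection hR h A C).some := ⟨_, rfl⟩
  -- For the gluing of the middle term built from the connection, this is the triangle of the
  -- extension. An arbitrary gluing `B` of β is homotopy equivalent to it.
  have h' : Triangle.mk (A.toKMap hR (c.gluing h) i) ((c.gluing h).toKMap hR C p)
      (connectingK hR h A C) ∈ distTriang (KInfB R) := by
    rw [← (hasBoundedHomology R).ι.map_distinguished_iff]
    refine isomorphic_distinguished _ (twist_distinguished c.z) _
      (Triangle.isoMk _ _ (Iso.refl _) (Iso.refl _) (Iso.refl _) ?_ ?_ ?_)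
    · refine (Category.comp_id _).trans (Eq.trans ?_ (Category.id_comp _).symm)
      exact congrArg (fun f => f.hom) ((c.isLift_inl h).toKMap_eq hR)
    · refine (Category.comp_id _).trans (Eq.trans ?_ (Category.id_comp _).symm)
      exact congrArg (fun f => f.hom) ((c.isLift_snd h).toKMap_eq hR)
    · refine (congrArg (_ ≫ ·) ((shiftFunctor (KProj R) (1 : ℤ)).map_id _)).trans
        ((Category.comp_id _).trans (Eq.trans ?_ (Category.id_comp _).symm))
      rw [hc]
      exact ι_map_connectingK hR h A C
  refine isomorphic_distinguished _ h' _ (Triangle.isoMk _ _ (Iso.refl _)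
    (B.toKIso hR (c.gluing h)) (Iso.refl _) ?_ ?_ ?_)
  · change A.toKMap hR B i ≫ B.toKMap hR (c.gluing h) (𝟙 β) = 𝟙 _ ≫ A.toKMap hR (c.gluing h) i
    rw [← Gluing.toKMap_comp, Category.comp_id, Category.id_comp]
  · change B.toKMap hR C p ≫ 𝟙 _ = B.toKMap hR (c.gluing h) (𝟙 β) ≫ (c.gluing h).toKMap hR C p
    rw [← Gluing.toKMap_comp, Category.comp_id, Category.id_comp]
  · change connectingK hR h A C ≫ (𝟙 A.toK)⟦(1 : ℤ)⟧' = 𝟙 _ ≫ connectingK hR h A C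
    rw [CategoryTheory.Functor.map_id, Category.comp_id, Category.id_comp]

/-- The connecting morphism in the Verdier quotient. -/
def connecting (hR : IsIwanagaGorenstein R) {α β γ : MorE R} {i : α ⟶ β} {p : β ⟶ γ}
    (h : IsConflation i p) (A : Gluing α) (C : Gluing γ) :
    (KQuot.Q R).obj C.toK ⟶ ((KQuot.Q R).obj A.toK)⟦(1 : ℤ)⟧ :=
  (KQuot.Q R).map (connectingK hR h A C) ≫ ((KQuot.Q R).commShiftIso (1 : ℤ)).hom.app A.toK

lemma connecting_naturality (hR : IsIwanagaGorenstein R) {α β γ α' β' γ' : MorE R} {i : α ⟶ β}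
    {p : β ⟶ γ} {i' : α' ⟶ β'} {p' : β' ⟶ γ'} (h : IsConflation i p) (h' : IsConflation i' p')
    (A : Gluing α) (C : Gluing γ) (A' : Gluing α') (C' : Gluing γ')
    (f : α ⟶ α') (g : β ⟶ β') (k : γ ⟶ γ') (hf : i ≫ g = f ≫ i') (hk : p ≫ k = g ≫ p') :
    (KQuot.Q R).map (C.toKMap hR C' k) ≫ connecting hR h' A' C' =
      connecting hR h A C ≫ ((KQuot.Q R).map (A.toKMap hR A' f))⟦(1 : ℤ)⟧' := by
  rw [connecting, connecting, ← Functor.map_comp_assoc,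
    connectingK_naturality hR h h' A C A' C' f g k hf hk, Functor.map_comp, Category.assoc,
    Category.assoc, Functor.commShiftIso_hom_naturality]

lemma connecting_distinguished (hR : IsIwanagaGorenstein R) {α β γ : MorE R} {i : α ⟶ β}
    {p : β ⟶ γ} (h : IsConflation i p) (A : Gluing α) (B : Gluing β) (C : Gluing γ) :
    Triangle.mk ((KQuot.Q R).map (A.toKMap hR B i)) ((KQuot.Q R).map (B.toKMap hR C p))
      (connecting hR h A C) ∈ distTriang (KQuot R) :=
  (KQuot.Q R).map_distinguished _ (connectingK_distinguished hR h A B C)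

/-- The middle term of the triangle is zero in the quotient. -/
lemma isIso_connecting (hR : IsIwanagaGorenstein R) {α β γ : MorE R} {i : α ⟶ β} {p : β ⟶ γ}
    (h : IsConflation i p) (hβ : IsProj β) (A : Gluing α) (C : Gluing γ) :
    IsIso (connecting hR h A C) := by
  obtain ⟨B⟩ := exists_gluing hR β
  exact (Triangle.isZero₂_iff_isIso₃ _ (connecting_distinguished hR h A B C)).1
    (B.isZero_Q_obj hR ((isProj_iff_isStandard hR β).1 hβ))

end Connecting

end MorE

/-! ### Pushouts of exact sequences -/

section Pushout

variable {A : Type u} [Ring A]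

/-- The pushout of a short exact sequence. -/
lemma IsSES.pushout {M N P M' : ModuleCat.{u} A} {i : M ⟶ N} {p : N ⟶ P} (h : IsSES i p)
    (f : M ⟶ M') : IsSES (pushout.inr i f) (pushout.desc p 0 (by rw [h.zero, comp_zero])) := by
  have hm : Mono i := (ModuleCat.mono_iff_injective _).2 h.inj
  have he : Epi p := (ModuleCat.epi_iff_surjective _).2 h.surj
  have hk : Epi (pushout.desc p (0 : M' ⟶ P) (f := i) (g := f) (by rw [h.zero, comp_zero])) := by
    have : Epi (pushout.inl i f ≫ pushout.desc p (0 : M' ⟶ P) (by rw [h.zero, comp_zero])) := by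
      rwa [pushout.inl_desc]
    exact epi_of_epi (pushout.inl i f) _
  let S := ShortComplex.mk (pushout.inr i f)
    (pushout.desc p (0 : M' ⟶ P) (by rw [h.zero, comp_zero])) (pushout.inr_desc _ _ _)
  have hS : S.Exact := by
    refine S.exact_of_g_is_cokernel (CokernelCofork.IsColimit.ofπ' _ _ fun {Z} u hu => ?_)
    have hv := h.exists_desc (pushout.inl i f ≫ u) (by
      rw [pushout.condition_assoc, hu, comp_zero])
    refine ⟨hv.choose, ?_⟩
    apply pushout.hom_ext
    · rw [pushout.inl_desc_assoc, hv.choose_spec]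
    · rw [pushout.inr_desc_assoc, zero_comp, hu]
  exact ⟨(ModuleCat.mono_iff_injective _).1 inferInstance,
    (ShortComplex.ShortExact.moduleCat_exact_iff_function_exact S).1 hS,
    (ModuleCat.epi_iff_surjective _).1 hk⟩

end Pushout

namespace MorE

section Pushout

variable {R : Type u} [Ring R]

/-- Sources and targets are pushed out separately. The results are Cohen-Macaulay as extensions, and
the induced map is epi because β and α' are. -/
lemma IsConflation.exists_pushout (hR : IsIwanagaGorenstein R) {α β γ α' : MorE R} {i : α ⟶ β}
    {p : β ⟶ γ} (h : IsConflation i p) (f : α ⟶ α') :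
    ∃ (β' : MorE R) (g : α' ⟶ β') (k : β' ⟶ γ) (v : β ⟶ β'),
      IsConflation g k ∧ i ≫ v = f ≫ g ∧ v ≫ k = p := by
  have hs := h.src_isSES.pushout (onSrc f)
  have ht := h.tgt_isSES.pushout (onTgt f)
  let m : pushout (onSrc i) (onSrc f) ⟶ pushout (onTgt i) (onTgt f) :=
    pushout.desc (β.arr ≫ pushout.inl _ _) (α'.arr ≫ pushout.inr _ _) (by
      rw [reassoc_of% (w i), reassoc_of% (w f), pushout.condition])
  have hβ : Epi β.arr := (ModuleCat.epi_iff_surjective _).2 β.arr_surj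
  have hα' : Epi α'.arr := (ModuleCat.epi_iff_surjective _).2 α'.arr_surj
  have hm₁ : pushout.inl _ _ ≫ m = β.arr ≫ pushout.inl _ _ := pushout.inl_desc _ _ _
  have hm₂ : pushout.inr _ _ ≫ m = α'.arr ≫ pushout.inr _ _ := pushout.inr_desc _ _ _
  have hm : Epi m := ⟨fun a b hab => by
    apply pushout.hom_ext
    · rw [← cancel_epi β.arr, ← reassoc_of% hm₁, hab, reassoc_of% hm₁]
    · rw [← cancel_epi α'.arr, ← reassoc_of% hm₂, hab, reassoc_of% hm₂]⟩
  let β' : MorE R := mkObj m (isCM_middle hR hs α'.property.1 γ.property.1)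
    (isCM_middle hR ht α'.property.2.1 γ.property.2.1) ((ModuleCat.epi_iff_surjective _).1 hm)
  let g : α' ⟶ β' := mkHom (pushout.inr _ _) (pushout.inr _ _) hm₂
  let k : β' ⟶ γ := mkHom (pushout.desc (onSrc p) 0 (by rw [h.src_isSES.zero, comp_zero]))
    (pushout.desc (onTgt p) 0 (by rw [h.tgt_isSES.zero, comp_zero])) (by
      change _ ≫ γ.arr = m ≫ _
      apply pushout.hom_ext
      · rw [pushout.inl_desc_assoc, reassoc_of% hm₁, pushout.inl_desc, w p]
      · rw [pushout.inr_desc_assoc, reassoc_of% hm₂, pushout.inr_desc, comp_zero, zero_comp])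
  let v : β ⟶ β' := mkHom (pushout.inl _ _) (pushout.inl _ _) hm₁
  exact ⟨β', g, k, v, IsConflation.mk' hs ht, hom_ext pushout.condition pushout.condition,
    hom_ext (pushout.inl_desc _ _ _) (pushout.inl_desc _ _ _)⟩

end Pushout

/-! ### Compatibility with the triangulated structures -/

section Triangles

variable {R : Type u} [Ring R]

/-- The isomorphism of the cosyzygy with the suspension in the Verdier quotient. -/
def connectingIso (hR : IsIwanagaGorenstein R) {α β γ : MorE R} {i : α ⟶ β} {p : β ⟶ γ}
    (h : IsConflation i p) (hβ : IsProj β) (A : Gluing α) (C : Gluing γ) :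
    (KQuot.Q R).obj C.toK ≅ ((KQuot.Q R).obj A.toK)⟦(1 : ℤ)⟧ :=
  have := isIso_connecting hR h hβ A C
  -- The sign absorbs the one produced when a triangle is rotated.
  { hom := -connecting hR h A C
    inv := -inv (connecting hR h A C)
    hom_inv_id := by rw [Preadditive.neg_comp_neg, IsIso.hom_inv_id]
    inv_hom_id := by rw [Preadditive.neg_comp_neg, IsIso.inv_hom_id] }

/-- The triangle of α' ⟶ β' ⟶ γ is the rotation of the desired one: by naturality its connecting map
is that of α ⟶ β ⟶ γ followed by f[1]. -/
lemma connectingIso_distinguished (hR : IsIwanagaGorenstein R) {α β γ α' β' : MorE R} {i : α ⟶ β}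
    {p : β ⟶ γ} (h : IsConflation i p) (hβ : IsProj β) (A : Gluing α) (C : Gluing γ)
    (A' : Gluing α') (B' : Gluing β') (f : α ⟶ α') (v : β ⟶ β') {g : α' ⟶ β'} {k : β' ⟶ γ}
    (hgk : IsConflation g k) (h₁ : i ≫ v = f ≫ g) (h₂ : v ≫ k = p) :
    Triangle.mk ((KQuot.Q R).map (A.toKMap hR A' f)) ((KQuot.Q R).map (A'.toKMap hR B' g))
      ((KQuot.Q R).map (B'.toKMap hR C k) ≫ (connectingIso hR h hβ A C).hom) ∈
        distTriang (KQuot R) := by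
  rw [rotate_distinguished_triangle]
  refine isomorphic_distinguished _ (connecting_distinguished hR hgk A' B' C) _
    (Triangle.isoMk _ _ (Iso.refl _) (Iso.refl _) (connectingIso hR h hβ A C).symm ?_ ?_ ?_)
  · exact (Category.comp_id _).trans (Category.id_comp _).symm
  · change ((KQuot.Q R).map (B'.toKMap hR C k) ≫ (connectingIso hR h hβ A C).hom) ≫
      (connectingIso hR h hβ A C).inv = 𝟙 _ ≫ (KQuot.Q R).map (B'.toKMap hR C k)
    rw [Category.assoc, Iso.hom_inv_id, Category.comp_id, Category.id_comp]
  · have := connecting_naturality hR h hgk A C A' C f v (𝟙 _) h₁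
      ((Category.comp_id _).trans h₂.symm)
    rw [Gluing.toKMap_id, CategoryTheory.Functor.map_id, Category.id_comp] at this
    change (-((KQuot.Q R).map (A.toKMap hR A' f))⟦(1 : ℤ)⟧') ≫ (𝟙 _)⟦(1 : ℤ)⟧' =
      (connectingIso hR h hβ A C).inv ≫ connecting hR hgk A' C
    rw [CategoryTheory.Functor.map_id, Category.comp_id, Iso.eq_inv_comp, this]
    exact Preadditive.neg_comp_neg _ _

/-- The induced functor commutes with the suspensions. -/
def suspensionIso (hR : IsIwanagaGorenstein R) (G : ∀ α : MorE R, Gluing α) (S : Cosyzygies R) :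
    S.suspension ⋙ stableFunctor hR G ≅ stableFunctor hR G ⋙ shiftFunctor (KQuot R) (1 : ℤ) :=
  NatIso.ofComponents
    (fun a => connectingIso hR (S.conf a.as) (S.proj a.as) (G a.as) (G (S.sus a.as))) (by
    intro a b x
    obtain ⟨f, rfl⟩ := (toStable R).map_surjective (X := a.as) (Y := b.as) x
    obtain ⟨e, he, hs⟩ := (S.exists_induces f).choose_spec
    have := connecting_naturality hR (S.conf a.as) (S.conf b.as) (G a.as) (G (S.sus a.as))
      (G b.as) (G (S.sus b.as)) f e _ he hs
    exact (Preadditive.comp_neg _ _).trans ((congrArg _ this).trans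
      (Preadditive.neg_comp _ _).symm))

lemma distinguished_of_isConflation (hR : IsIwanagaGorenstein R) (G : ∀ α : MorE R, Gluing α)
    (S : Cosyzygies R) {α β γ : MorE R} (f : α ⟶ β) {g : β ⟶ γ} {h : γ ⟶ S.sus α}
    (v : S.q α ⟶ γ) (hgh : IsConflation g h) (h₁ : S.i α ≫ v = f ≫ g) (h₂ : v ≫ h = S.p α) :
    Triangle.mk ((stableFunctor hR G).map ((toStable R).map f))
      ((stableFunctor hR G).map ((toStable R).map g))
      ((stableFunctor hR G).map ((toStable R).map h) ≫
        (suspensionIso hR G S).hom.app ((toStable R).obj α)) ∈ distTriang (KQuot R) :=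
  connectingIso_distinguished hR (S.conf α) (S.proj α) (G α) (G (S.sus α)) (G β) (G γ) f v hgh
    h₁ h₂

/-- Standard triangles go to distinguished ones by the previous lemma. Conversely, the first map of
a triangle with distinguished image completes to a standard triangle by a pushout. The two images
are isomorphic because they share the first map, and the isomorphism of third terms is pulled back
by full faithfulness. -/
lemma respectsTriangles (hR : IsIwanagaGorenstein R) (G : ∀ α : MorE R, Gluing α)
    (S : Cosyzygies R) : S.RespectsTriangles (stableFunctor hR G) := by
  have := isEquivalence_stableFunctor hR G
  refine ⟨suspensionIso hR G S, fun a b c x y z => ⟨?_, fun hT => ?_⟩⟩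
  · rintro ⟨α, β, γ, f, g, h, v, e₁, e₂, e₃, hgh, h₁, h₂, hx, hy, hz⟩
    -- The class of h is given a type that ends in the value of the suspension functor,
    -- definitionally equal to the chosen cosyzygy, so that naturality can be rewritten.
    obtain ⟨h', hz', hT⟩ : ∃ h' : (toStable R).obj γ ⟶ S.suspension.obj ((toStable R).obj α),
        z ≫ S.suspension.map e₁.hom = e₃.hom ≫ h' ∧
        Triangle.mk ((stableFunctor hR G).map ((toStable R).map f))
          ((stableFunctor hR G).map ((toStable R).map g)) ((stableFunctor hR G).map h' ≫
            (suspensionIso hR G S).hom.app ((toStable R).obj α)) ∈ distTriang (KQuot R) :=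
      ⟨_, hz, distinguished_of_isConflation hR G S f v hgh h₁ h₂⟩
    have nat : (stableFunctor hR G).map (S.suspension.map e₁.hom) ≫
        (suspensionIso hR G S).hom.app ((toStable R).obj α) =
        (suspensionIso hR G S).hom.app a ≫ ((stableFunctor hR G).map e₁.hom)⟦(1 : ℤ)⟧' :=
      (suspensionIso hR G S).hom.naturality e₁.hom
    refine isomorphic_distinguished _ hT _ (Triangle.isoMk _ _ ((stableFunctor hR G).mapIso e₁)
      ((stableFunctor hR G).mapIso e₂) ((stableFunctor hR G).mapIso e₃) ?_ ?_ ?_)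
    · exact ((stableFunctor hR G).map_comp _ _).symm.trans
        ((congrArg (stableFunctor hR G).map hx).trans ((stableFunctor hR G).map_comp _ _))
    · exact ((stableFunctor hR G).map_comp _ _).symm.trans
        ((congrArg (stableFunctor hR G).map hy).trans ((stableFunctor hR G).map_comp _ _))
    · change ((stableFunctor hR G).map z ≫ (suspensionIso hR G S).hom.app a) ≫
        ((stableFunctor hR G).map e₁.hom)⟦(1 : ℤ)⟧' =
        (stableFunctor hR G).map e₃.hom ≫ (stableFunctor hR G).map h' ≫
          (suspensionIso hR G S).hom.app ((toStable R).obj α)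
      rw [Category.assoc, ← nat, ← Functor.map_comp_assoc, hz', Functor.map_comp_assoc]
  · obtain ⟨f, rfl⟩ := (toStable R).map_surjective (X := a.as) (Y := b.as) x
    obtain ⟨γ, g, h, v, hgh, h₁, h₂⟩ := (S.conf a.as).exists_pushout hR f
    obtain ⟨h', hh', hT'⟩ : ∃ h' : (toStable R).obj γ ⟶ S.suspension.obj a,
        h' = (toStable R).map h ∧
        Triangle.mk ((stableFunctor hR G).map ((toStable R).map f))
          ((stableFunctor hR G).map ((toStable R).map g)) ((stableFunctor hR G).map h' ≫
            (suspensionIso hR G S).hom.app a) ∈ distTriang (KQuot R) :=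
      ⟨_, rfl, distinguished_of_isConflation hR G S f v hgh h₁ h₂⟩
    let e := isoTriangleOfIso₁₂ _ _ hT hT' (Iso.refl _) (Iso.refl _)
      ((Category.comp_id _).trans (Category.id_comp _).symm)
    let e₃ : (stableFunctor hR G).obj c ≅ (stableFunctor hR G).obj ((toStable R).obj γ) :=
      Triangle.π₃.mapIso e
    have c₂ : (stableFunctor hR G).map y ≫ e₃.hom =
        (stableFunctor hR G).map ((toStable R).map g) :=
      e.hom.comm₂.trans (Category.id_comp _)
    have c₃ : (stableFunctor hR G).map z ≫ (suspensionIso hR G S).hom.app a =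
        e₃.hom ≫ (stableFunctor hR G).map h' ≫ (suspensionIso hR G S).hom.app a := by
      refine Eq.trans ?_ e.hom.comm₃
      exact ((congrArg (_ ≫ ·) ((shiftFunctor (KQuot R) (1 : ℤ)).map_id _)).trans
        (Category.comp_id _)).symm
    -- The component of the suspension isomorphism is cancelled and faithfulness brings the third
    -- square back to the stable category.
    have hz : z = ((stableFunctor hR G).preimageIso e₃).hom ≫ h' := by
      apply (stableFunctor hR G).map_injective
      rw [Functor.map_comp, Functor.preimageIso_hom, Functor.map_preimage,
        ← cancel_mono ((suspensionIso hR G S).hom.app a), Category.assoc]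
      exact c₃
    refine ⟨a.as, b.as, γ, f, g, h, v, Iso.refl _, Iso.refl _,
      (stableFunctor hR G).preimageIso e₃, hgh, h₁, h₂, ?_, ?_, ?_⟩
    · exact (Category.comp_id _).trans (Category.id_comp _).symm
    · refine Eq.trans ?_ (Category.id_comp _).symm
      apply (stableFunctor hR G).map_injective
      rw [Functor.map_comp, Functor.preimageIso_hom, Functor.map_preimage]
      exact c₂
    · refine (congrArg (_ ≫ ·) (S.suspension.map_id _)).trans ((Category.comp_id _).trans ?_)
      rw [← hh']
      exact hz

end Triangles

end MorE

end IwanagaGorenstein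

end

open IwanagaGorenstein in
theorem mainTheorem4 (R : Type u) [Ring R] (hR : IsIwanagaGorenstein R) :
    MorE.IsFrobenius R ∧ Nonempty (MorE.Cosyzygies R) ∧
    (∀ α : MorE R, Nonempty (MorE.Gluing α)) ∧
    ∀ G : (∀ α : MorE R, MorE.Gluing α),
      ∃ F : MorE R ⥤ KInfB R, MorE.IsGluingFunctor G F ∧
      ∃ Φ : MorE.Stable R ⥤ KQuot R,
        Nonempty (MorE.toStable R ⋙ Φ ≅ F ⋙ KQuot.Q R) ∧
        Φ.IsEquivalence ∧
        ∀ S : MorE.Cosyzygies R, S.RespectsTriangles Φ :=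
  ⟨MorE.isFrobenius hR, MorE.nonempty_cosyzygies hR, MorE.exists_gluing hR, fun G =>
    ⟨MorE.gluingFunctor hR G, MorE.isGluingFunctor hR G, MorE.stableFunctor hR G,
      ⟨CategoryTheory.Quotient.lift.isLift _ _ _⟩, MorE.isEquivalence_stableFunctor hR G,
      MorE.respectsTriangles hR G⟩⟩
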